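/- Let $G$ be a compact Lie group with an $\operatorname{Ad}$-invariant inner product $\cdot$ on its Lie algebra $\mathfrak g$, let $\theta^L,\theta^R\in\Omega^1(G,\mathfrak g)$ be the left- and right-invariant Maurer-Cartan forms and $\eta=\frac1{12}\theta^L\cdot[\theta^L,\theta^L]$. A group valued Hamiltonian $G$-manifold is a triple $(M,\omega,\Phi)$ of a $G$-manifold $M$, an invariant 2-form $\omega$ and a smooth map $\Phi:M\to G$, equivariant for conjugation, such that $d\omega=\Phi^*\eta$, $\iota(\xi_M)\omega=\frac12\Phi^*(\theta^L+\theta^R)\cdot\xi$ for $\xi\in\mathfrak g$, and $\ker\omega_m=\{\xi_M(m)\mid(\operatorname{Ad}_{\Phi(m)}+1)\xi=0\}$ for all $m\in M$; here $\xi_M(m)=\frac{d}{dt}|_{t=0}\exp(-t\xi).m$. Let $\operatorname{Cl}(\mathfrak g)$ be the Clifford algebra with relations $x_ix_j+x_jx_i=\delta_{ij}$ for generators $x_i$ corresponding to an orthonormal basis $e_i$ of $\mathfrak g$, let $\alpha$ be its parity automorphism, $\sigma:\operatorname{Cl}(\mathfrak g)\to\wedge\mathfrak g$ the symbol map, and $\operatorname{Pin}(\mathfrak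 g)\subset\operatorname{Cl}(\mathfrak g)^\times$ the subgroup generated by the vectors $\xi\in\mathfrak g$ with $\xi\cdot\xi=2$. An element $s\in \operatorname{Pin}(\mathfrak g)$ lifts $\operatorname{Ad}_g$ if $\alpha(s)\xi s^{-1}=\operatorname{Ad}_g\xi$ for all $\xi\in\mathfrak g$. For a homomorphism $\tau:G\to\operatorname{Pin}(\mathfrak g)$ lifting the adjoint action, let $\mathcal T_g$ be obtained from $\sigma(\tau(g))$ by substituting $\frac12\theta^R\cdot\xi$ for $\xi\in\mathfrak g$, and put $\Gamma=\exp(\omega)\,\Phi^*\mathcal T$. In the absence of such a $\tau$, the same construction with a lift of $\operatorname{Ad}_{\Phi(m)}$ to $\operatorname{Pin}(\mathfrak g)$ at each point $m$ defines $\Gamma$ as a form with values in the orientation bundle of $M$, the sign being fixed by requiring that $\Gamma_{[\dim M]}$ is positive. The measure $\nu=\Gamma_{[\dim M]}$ is the Liouville measure and $\mathfrak m=\Phi_*\nu$ the Duistermaat-Heckman measure. All this applies in particular to the group $G\times G$, with the sum inner product on $\mathfrak g\oplus\mathfrak g$; given a lift $\tau$ for $G$, one uses the product $\tau(g_1)\tau(g_2)\in\operatorname{Cl}(\mathfrak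 g\oplus\mathfrak g)$ for $(g_1,g_2)\in G\times G$, so that $\Gamma=\exp(\omega)\,\Phi_1^*\mathcal T\,\Phi_2^*\mathcal T$. **Theorem (Products).** Let $(M,\omega,(\Phi_1,\Phi_2))$ be a group valued Hamiltonian $G\times G$-manifold, and let $\tilde M=M$ be its fusion, with diagonal $G$-action, moment map $\tilde\Phi=\Phi_1\Phi_2$ and 2-form $\tilde\omega=\omega-\frac12\Phi_1^*\theta^L\cdot\Phi_2^*\theta^R$. Let $e_i$ be an orthonormal basis of $\mathfrak g$ and $\iota_i^1,\iota_i^2$ the contractions with the generating vector fields of $e_i$ for the first and second $G$-factor. Then $$\tilde\Gamma=\exp\Big(-\frac12\sum_i\iota_i^1\iota_i^2\Big)\Gamma ,$$ and in particular $\tilde\Gamma_{[\dim M]}=\Gamma_{[\dim M]}$. This holds for the forms $\Gamma,\tilde\Gamma$ defined by any lift $\tau:G\to\operatorname{Pin}(\mathfrak g)$ of the adjoint action and, for general $G$, for the forms with values in the orientation bundle. Hence $\tilde\nu=\nu$, and $\tilde{\mathfrak m}$ is the push-forward of $\mathfrak m$ under the multiplication $G\times G\to G$. If $M_1\circledast M_2$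 is the fusion of the product $M_1\times M_2$ of two group valued Hamiltonian $G$-manifolds, then its volume form $\Gamma_{[\dim]}$ (for a given lift $\tau$) is the exterior product of those of $M_1$ and $M_2$, its Liouville measure is the product measure $\nu_1\otimes\nu_2$, and its Duistermaat-Heckman measure is the convolution $\mathfrak m_1*\mathfrak m_2$. -/

import Mathlib

open scoped Manifold ContDiff Nat

noncomputable section

namespace GroupValued

/-! ## Exterior algebra of a cotangent space -/

section Exterior

/-- The exponential series of an algebra element, cut off after the `n`-th power.  It is only used
for elements whose `(n+1)`-st power vanishes, where it is the exponential. -/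
def expUpTo {A : Type*} [Ring A] [Algebra ℝ A] (n : ℕ) (a : A) : A :=
  ∑ k ∈ Finset.range (n + 1), ((k ! : ℝ)⁻¹) • a ^ k

/-- The algebra `⋀ V*` of (mixed degree) alternating forms on `V`. -/
abbrev Forms (V : Type*) [AddCommGroup V] [Module ℝ V] : Type _ :=
  ExteriorAlgebra ℝ (Module.Dual ℝ V)

variable {V : Type*} [AddCommGroup V] [Module ℝ V]

/-- The contraction operator of a vector `v`, the odd derivation of `⋀ V*` extending `α ↦ α v`. -/
def contraction (v : V) : Module.End ℝ (Forms V) :=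
  CliffordAlgebra.contractLeft (Module.Dual.eval ℝ V v)

/-- The component of degree `k` of a form. -/
def degreePart (k : ℕ) (x : Forms V) : ⋀[ℝ]^k (Module.Dual ℝ V) :=
  DirectSum.decompose (fun i : ℕ => ⋀[ℝ]^i (Module.Dual ℝ V)) x k

/-- The value of the degree `k` component of a form on `k` vectors, normalised by
`(α₁ ∧ … ∧ αₖ) (v₁, …, vₖ) = det (αᵢ vⱼ)`. -/
def evalForm {k : ℕ} (x : Forms V) (v : Fin k → V) : ℝ :=
  exteriorPower.pairingDual ℝ V k (degreePart k x) (exteriorPower.ιMulti ℝ k v)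

/-- The pull-back of forms under a linear map. -/
def pullback {V' : Type*} [AddCommGroup V'] [Module ℝ V'] (f : V →ₗ[ℝ] V') :
    Forms V' →ₐ[ℝ] Forms V :=
  ExteriorAlgebra.map f.dualMap

/-- An alternating bilinear form as an element of `⋀ V*`: `½ ∑ᵢⱼ w(bᵢ, bⱼ) bᵢ* ∧ bⱼ*` in terms of
any basis `b` of `V`. -/
def ofTwoForm [TopologicalSpace V] [FiniteDimensional ℝ V] (w : V [⋀^Fin 2]→L[ℝ] ℝ) : Forms V :=
  (1 / 2 : ℝ) • ∑ i, ∑ j, w ![Module.finBasis ℝ V i, Module.finBasis ℝ V j] •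
    (ExteriorAlgebra.ι ℝ ((Module.finBasis ℝ V).coord i) *
      ExteriorAlgebra.ι ℝ ((Module.finBasis ℝ V).coord j))

/-- The 2-form `α · β` of two `W`-valued 1-forms: the wedge product combined with the bilinear
form `B` on `W`, that is `(α · β)(u, v) = B (α u) (β v) - B (α v) (β u)`. -/
def wedgeDot [TopologicalSpace V] {W : Type*} [AddCommGroup W] [Module ℝ W] [TopologicalSpace W]
    [IsTopologicalAddGroup W] [ContinuousSMul ℝ W] [T2Space W] [FiniteDimensional ℝ W]
    (B : LinearMap.BilinForm ℝ W) (α β : V →L[ℝ] W) : V [⋀^Fin 2]→L[ℝ] ℝ where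
  toFun v := B (α (v 0)) (β (v 1)) - B (α (v 1)) (β (v 0))
  map_update_add' v i x y := by
    fin_cases i <;> simp [Function.update] <;> ring
  map_update_smul' v i c x := by
    fin_cases i <;> simp [Function.update] <;> ring
  map_eq_zero_of_eq' v i j h hij := by
    fin_cases i <;> fin_cases j <;> simp_all
  cont := by
    have hB : Continuous fun p : W × W => B p.1 p.2 := by
      let b := Module.finBasis ℝ W
      have h : (fun p : W × W => B p.1 p.2) =
          fun p => ∑ i, ∑ j, b.coord i p.1 * b.coord j p.2 * B (b i) (b j) := by
        funext p
        conv_lhs => rw [← b.sum_repr p.1, ← b.sum_repr p.2]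
        simp only [map_sum, LinearMap.sum_apply, map_smul, LinearMap.smul_apply, smul_eq_mul,
          Module.Basis.coord_apply, Finset.mul_sum, mul_assoc]
        rw [Finset.sum_comm]
        refine Finset.sum_congr rfl fun i _ => Finset.sum_congr rfl fun j _ => ?_
        ring
      rw [h]
      have hc : ∀ i, Continuous (b.coord i) := fun i =>
        (b.coord i).continuous_of_finiteDimensional
      fun_prop
    exact (hB.comp (((α.continuous.comp (continuous_apply 0))).prodMk
      (β.continuous.comp (continuous_apply 1)))).sub
      (hB.comp (((α.continuous.comp (continuous_apply 1))).prodMk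
      (β.continuous.comp (continuous_apply 0))))

end Exterior

/-! ## Clifford algebra, Pin group and symbol map -/

section Clifford

variable {W : Type*} [AddCommGroup W] [Module ℝ W]

/-- The quadratic form `ξ ↦ ½ ξ·ξ`.  In its Clifford algebra an orthonormal basis satisfies
`xᵢ xⱼ + xⱼ xᵢ = δᵢⱼ`. -/
def halfSq (B : LinearMap.BilinForm ℝ W) : QuadraticForm ℝ W :=
  (1 / 2 : ℝ) • LinearMap.BilinMap.toQuadraticMap B

/-- The Clifford algebra `Cl(W)`. -/
abbrev Cl (B : LinearMap.BilinForm ℝ W) : Type _ := CliffordAlgebra (halfSq B)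

/-- The group `Pin(W)`, generated in `Cl(W)ˣ` by the vectors `ξ` with `ξ·ξ = 2`. -/
def Pin (B : LinearMap.BilinForm ℝ W) : Subgroup (Cl B)ˣ :=
  Subgroup.closure {u | ∃ ξ : W, B ξ ξ = 2 ∧ (u : Cl B) = CliffordAlgebra.ι (halfSq B) ξ}

/-- `s` lifts the endomorphism `A` of `W`: the twisted adjoint action `y ↦ α(s) y s⁻¹` of `s`
restricts to `A` on `W ⊆ Cl(W)`. -/
def IsLift (B : LinearMap.BilinForm ℝ W) (s : Pin B) (A : W → W) : Prop :=
  ∀ ξ : W, CliffordAlgebra.involute ((s : (Cl B)ˣ) : Cl B) * CliffordAlgebra.ι (halfSq B) ξ *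
    (((s : (Cl B)ˣ)⁻¹ : (Cl B)ˣ) : Cl B) = CliffordAlgebra.ι (halfSq B) (A ξ)

/-- Some lift to `Pin(W)` of an orthogonal transformation; lifts always exist. -/
def someLift (B : LinearMap.BilinForm ℝ W) (A : W → W) : Pin B :=
  Classical.epsilon fun s => IsLift B s A

/-- The symbol map `σ : Cl(W) → ⋀ W`. -/
def symbol (B : LinearMap.BilinForm ℝ W) : Cl B ≃ₗ[ℝ] ExteriorAlgebra ℝ W :=
  CliffordAlgebra.equivExterior (halfSq B)

/-- The sum of two bilinear forms on a product. -/
def sumForm {W₁ W₂ : Type*} [AddCommGroup W₁] [Module ℝ W₁] [AddCommGroup W₂] [Module ℝ W₂]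
    (B₁ : LinearMap.BilinForm ℝ W₁) (B₂ : LinearMap.BilinForm ℝ W₂) :
    LinearMap.BilinForm ℝ (W₁ × W₂) :=
  B₁.compl₁₂ (LinearMap.fst ℝ W₁ W₂) (LinearMap.fst ℝ W₁ W₂) +
    B₂.compl₁₂ (LinearMap.snd ℝ W₁ W₂) (LinearMap.snd ℝ W₁ W₂)

/-- The inclusion `Cl(W₁) → Cl(W₁ ⊕ W₂)`. -/
def clInl {W₁ W₂ : Type*} [AddCommGroup W₁] [Module ℝ W₁] [AddCommGroup W₂] [Module ℝ W₂]
    (B₁ : LinearMap.BilinForm ℝ W₁) (B₂ : LinearMap.BilinForm ℝ W₂) :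
    Cl B₁ →ₐ[ℝ] Cl (sumForm B₁ B₂) :=
  CliffordAlgebra.map { LinearMap.inl ℝ W₁ W₂ with map_app' := by simp [halfSq, sumForm] }

/-- The inclusion `Cl(W₂) → Cl(W₁ ⊕ W₂)`. -/
def clInr {W₁ W₂ : Type*} [AddCommGroup W₁] [Module ℝ W₁] [AddCommGroup W₂] [Module ℝ W₂]
    (B₁ : LinearMap.BilinForm ℝ W₁) (B₂ : LinearMap.BilinForm ℝ W₂) :
    Cl B₂ →ₐ[ℝ] Cl (sumForm B₁ B₂) :=
  CliffordAlgebra.map { LinearMap.inr ℝ W₁ W₂ with map_app' := by simp [halfSq, sumForm] }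

end Clifford

/-! ## Lie groups -/

section Tangent

variable {E : Type*} [NormedAddCommGroup E] [NormedSpace ℝ E] {H : Type*} [TopologicalSpace H]
  (J : ModelWithCorners ℝ E H) {M : Type*} [TopologicalSpace M] [ChartedSpace H M]

instance [FiniteDimensional ℝ E] (m : M) : FiniteDimensional ℝ (TangentSpace J m) :=
  inferInstanceAs (FiniteDimensional ℝ E)

instance (m : M) : T2Space (TangentSpace J m) := inferInstanceAs (T2Space E)

end Tangent

section LieGroup

variable {E : Type*} [NormedAddCommGroup E] [NormedSpace ℝ E] {H : Type*} [TopologicalSpace H]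
  (I : ModelWithCorners ℝ E H) {G : Type*} [TopologicalSpace G] [ChartedSpace H G] [Group G]

/-- The left-invariant Maurer-Cartan form `θᴸ` at `g`. -/
def thetaL (g : G) : TangentSpace I g →L[ℝ] GroupLieAlgebra I G :=
  mfderiv I I (fun x : G => g⁻¹ * x) g

/-- The right-invariant Maurer-Cartan form `θᴿ` at `g`. -/
def thetaR (g : G) : TangentSpace I g →L[ℝ] GroupLieAlgebra I G :=
  mfderiv I I (fun x : G => x * g⁻¹) g

/-- The adjoint action of `g` on the Lie algebra. -/
def Ad (g : G) : GroupLieAlgebra I G →L[ℝ] GroupLieAlgebra I G :=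
  mfderiv I I (fun x : G => g * x * g⁻¹) 1

/-- `B` is an inner product on the Lie algebra of `G` that is invariant under the adjoint
action. -/
structure IsInvariantInner (B : LinearMap.BilinForm ℝ (GroupLieAlgebra I G)) : Prop where
  symm : ∀ ξ ζ, B ξ ζ = B ζ ξ
  pos : ∀ ξ, ξ ≠ 0 → 0 < B ξ ξ
  invariant : ∀ (g : G) (ξ ζ), B (Ad I g ξ) (Ad I g ζ) = B ξ ζ

/-- The canonical 3-form `η = (1/12) θᴸ·[θᴸ, θᴸ]` at `g`.  Evaluated on three vectors this is
`½ θᴸ(u)·[θᴸ(v), θᴸ(w)]`, since `[θᴸ, θᴸ](v, w) = 2 [θᴸ(v), θᴸ(w)]` and the wedge product with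
`θᴸ` contributes three equal terms. -/
def eta (B : LinearMap.BilinForm ℝ (GroupLieAlgebra I G)) (g : G) (u v w : TangentSpace I g) : ℝ :=
  (1 / 2) * B (thetaL I g u) ⁅thetaL I g v, thetaL I g w⁆

/-- `τ : G → Pin(𝔤)` lifts the adjoint action. -/
def LiftsAd (B : LinearMap.BilinForm ℝ (GroupLieAlgebra I G)) (τ : G →* Pin B) : Prop :=
  ∀ g, IsLift B (τ g) (Ad I g)

end LieGroup

/-! ## 2-forms and densities on manifolds -/

section Manifold

variable {E : Type*} [NormedAddCommGroup E] [NormedSpace ℝ E] {H : Type*} [TopologicalSpace H]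
  (J : ModelWithCorners ℝ E H) {M : Type*} [TopologicalSpace M] [ChartedSpace H M]

/-- The expression of a 2-form in the preferred chart at `x₀`. -/
def formInChart (w : ∀ m : M, TangentSpace J m [⋀^Fin 2]→L[ℝ] ℝ) (x₀ : M) (y : E) :
    E [⋀^Fin 2]→L[ℝ] ℝ :=
  (w ((extChartAt J x₀).symm y)).compContinuousLinearMap
    (mfderiv 𝓘(ℝ, E) J (extChartAt J x₀).symm y)

/-- Smoothness of a 2-form. -/
def IsSmoothForm (w : ∀ m : M, TangentSpace J m [⋀^Fin 2]→L[ℝ] ℝ) : Prop :=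
  ∀ x₀ : M, ContDiffOn ℝ ∞ (formInChart J w x₀) (extChartAt J x₀).target

/-- The exterior derivative of a 2-form at `m`, computed in the preferred chart at `m`. -/
def extDerivAt (w : ∀ m : M, TangentSpace J m [⋀^Fin 2]→L[ℝ] ℝ) (m : M) :
    TangentSpace J m [⋀^Fin 3]→L[ℝ] ℝ :=
  (extDeriv (formInChart J w m) (extChartAt J m m)).compContinuousLinearMap
    (mfderiv J 𝓘(ℝ, E) (extChartAt J m) m)

/-- The inverse of the preferred chart at `x₀`, with linear coordinates on the model space. -/
def coordSymm [FiniteDimensional ℝ E] (x₀ : M) (y : Fin (Module.finrank ℝ E) → ℝ) : M :=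
  (extChartAt J x₀).symm ((Module.finBasis ℝ E).equivFun.symm y)

/-- The coordinate vectors `∂/∂y₁, …, ∂/∂yₙ` of the preferred chart at `x₀`. -/
def coordFrame [FiniteDimensional ℝ E] (x₀ : M) (y : Fin (Module.finrank ℝ E) → ℝ)
    (i : Fin (Module.finrank ℝ E)) : TangentSpace J (coordSymm J x₀ y) :=
  mfderiv 𝓘(ℝ, E) J (extChartAt J x₀).symm ((Module.finBasis ℝ E).equivFun.symm y)
    (Module.finBasis ℝ E i)

/-- The measure `δ(∂/∂y₁, …, ∂/∂yₙ) dy₁ ⋯ dyₙ` defined by a density `δ` on the domain of the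
preferred chart at `x₀`. -/
def chartMeasure [FiniteDimensional ℝ E] [MeasurableSpace M]
    (δ : ∀ m : M, (Fin (Module.finrank ℝ E) → TangentSpace J m) → ℝ) (x₀ : M) :
    MeasureTheory.Measure M :=
  ((MeasureTheory.volume.restrict
      ((Module.finBasis ℝ E).equivFun.symm ⁻¹' (extChartAt J x₀).target)).withDensity
    fun y => ENNReal.ofReal (δ (coordSymm J x₀ y) (coordFrame J x₀ y))).map (coordSymm J x₀)

/-- The measure defined by a density.  The measures on the chart domains agree on overlaps, and
their supremum is the measure on `M` that they glue to. -/
def densityMeasure [FiniteDimensional ℝ E] [MeasurableSpace M]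
    (δ : ∀ m : M, (Fin (Module.finrank ℝ E) → TangentSpace J m) → ℝ) :
    MeasureTheory.Measure M :=
  ⨆ x₀ : M, chartMeasure J δ x₀

end Manifold

/-! ## Group valued Hamiltonian manifolds -/

section Hamiltonian

variable {E : Type*} [NormedAddCommGroup E] [NormedSpace ℝ E] {H : Type*} [TopologicalSpace H]
  (I : ModelWithCorners ℝ E H) {G : Type*} [TopologicalSpace G] [ChartedSpace H G] [Group G]
  {F : Type*} [NormedAddCommGroup F] [NormedSpace ℝ F] {K : Type*} [TopologicalSpace K]
  (J : ModelWithCorners ℝ F K) {M : Type*} [TopologicalSpace M] [ChartedSpace K M]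

/-- The generating vector field `ξ_M(m) = d/dt|₀ exp(-tξ).m` of an action, i.e. minus the image of
`ξ` under the differential at the identity of `g ↦ g.m`. -/
def genField (act : G →* Equiv.Perm M) (ξ : GroupLieAlgebra I G) (m : M) : TangentSpace J m :=
  -((mfderiv I J (fun g : G => act g m) 1 : TangentSpace I (1 : G) →L[ℝ] TangentSpace J m) ξ)

variable (G M) in
/-- A triple `(M, ω, Φ)`: an action of `G` on `M`, a 2-form and a map to `G`. -/
structure Triple where
  act : G →* Equiv.Perm M
  form : ∀ m : M, TangentSpace J m [⋀^Fin 2]→L[ℝ] ℝ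
  moment : M → G

variable {J}

/-- The differential of the moment map. -/
def Triple.dMoment (X : Triple G J M) (m : M) : TangentSpace J m →L[ℝ] TangentSpace I (X.moment m) :=
  mfderiv J I X.moment m

/-- `(M, ω, Φ)` is a group valued Hamiltonian `G`-manifold, with respect to the invariant inner
product `B` on the Lie algebra of `G`. -/
structure IsHamiltonian (B : LinearMap.BilinForm ℝ (GroupLieAlgebra I G)) (X : Triple G J M) :
    Prop where
  smooth_act : ContMDiff (I.prod J) J ∞ fun p : G × M => X.act p.1 p.2
  smooth_form : IsSmoothForm J X.form
  smooth_moment : ContMDiff J I ∞ X.moment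
  /-- `ω` is invariant. -/
  form_invariant : ∀ (g : G) (m : M), (X.form (X.act g m)).compContinuousLinearMap
    (mfderiv J J (X.act g) m) = X.form m
  /-- `Φ` is equivariant for the conjugation action on `G`. -/
  moment_equivariant : ∀ (g : G) (m : M), X.moment (X.act g m) = g * X.moment m * g⁻¹
  /-- `dω = Φ^* η`. -/
  deriv_form : ∀ (m : M) (u v w : TangentSpace J m), extDerivAt J X.form m ![u, v, w] =
    eta I B (X.moment m) (X.dMoment I m u) (X.dMoment I m v) (X.dMoment I m w)
  /-- `ι(ξ_M) ω = ½ Φ^*(θᴸ + θᴿ)·ξ`. -/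
  moment_condition : ∀ (ξ : GroupLieAlgebra I G) (m : M) (v : TangentSpace J m),
    X.form m ![genField I J X.act ξ m, v] =
      (1 / 2) * B (thetaL I (X.moment m) (X.dMoment I m v) +
        thetaR I (X.moment m) (X.dMoment I m v)) ξ
  /-- `ker ω_m = {ξ_M(m) | (Ad_Φ(m) + 1) ξ = 0}`. -/
  minimal_degeneracy : ∀ (m : M) (u : TangentSpace J m), (∀ v, X.form m ![u, v] = 0) ↔
    ∃ ξ : GroupLieAlgebra I G, Ad I (X.moment m) ξ + ξ = 0 ∧ genField I J X.act ξ m = u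

variable [FiniteDimensional ℝ F]

/-- The form `Γ = exp(ω) Φ^*𝒯` at `m`, where `s ∈ Cl(𝔤)` is the value at `Φ(m)` of the lift of the
adjoint action from which `𝒯` is constructed.  Thus `Φ^*𝒯` arises from the symbol `σ(s) ∈ ⋀ 𝔤` by
the substitution of `½ Φ^*θᴿ·ξ` for `ξ ∈ 𝔤`. -/
def Gamma (B : LinearMap.BilinForm ℝ (GroupLieAlgebra I G)) (X : Triple G J M) (m : M) (s : Cl B) :
    Forms (TangentSpace J m) :=
  expUpTo (Module.finrank ℝ F) (ofTwoForm (X.form m)) *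
    ExteriorAlgebra.map ((1 / 2 : ℝ) • (LinearMap.lcomp ℝ ℝ
      ((thetaR I (X.moment m)).comp (X.dMoment I m)).toLinearMap ∘ₗ B.flip)) (symbol B s)

/-- The form `Γ` in the general case, as a form with values in the orientation bundle: its value
at `m` with respect to the orientation of `T_mM` given by a basis `b`.  It is `± Γ` for any lift of
`Ad_Φ(m)` to `Pin(𝔤)`, with the sign that makes the top degree part positive on `b`. -/
def twistedGamma (B : LinearMap.BilinForm ℝ (GroupLieAlgebra I G)) (X : Triple G J M) (m : M)
    (b : Fin (Module.finrank ℝ F) → TangentSpace J m) : Forms (TangentSpace J m) :=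
  let γ := Gamma I B X m ((someLift B (Ad I (X.moment m)) : (Cl B)ˣ) : Cl B)
  (SignType.sign (evalForm γ b) : ℝ) • γ

/-- The Liouville measure `ν = Γ_[dim M]`. -/
def liouville [MeasurableSpace M] (B : LinearMap.BilinForm ℝ (GroupLieAlgebra I G))
    (X : Triple G J M) : MeasureTheory.Measure M :=
  densityMeasure J fun m b => evalForm (twistedGamma I B X m b) b

/-- The Duistermaat-Heckman measure `Φ_* ν`. -/
def duistermaatHeckman [MeasurableSpace M] [MeasurableSpace G]
    (B : LinearMap.BilinForm ℝ (GroupLieAlgebra I G)) (X : Triple G J M) :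
    MeasureTheory.Measure G :=
  (liouville I B X).map X.moment


end Hamiltonian

/-! ## Products and fusion -/

section Fusion

variable {E : Type*} [NormedAddCommGroup E] [NormedSpace ℝ E] {H : Type*} [TopologicalSpace H]
  (I : ModelWithCorners ℝ E H) {G : Type*} [TopologicalSpace G] [ChartedSpace H G] [Group G]
  {F : Type*} [NormedAddCommGroup F] [NormedSpace ℝ F] {K : Type*} [TopologicalSpace K]
  {J : ModelWithCorners ℝ F K} {M : Type*} [TopologicalSpace M] [ChartedSpace K M]

/-- The action of the first factor of `G × G`. -/
def Triple.act₁ (X : Triple (G × G) J M) : G →* Equiv.Perm M :=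
  X.act.comp (MonoidHom.inl G G)

/-- The action of the second factor of `G × G`. -/
def Triple.act₂ (X : Triple (G × G) J M) : G →* Equiv.Perm M :=
  X.act.comp (MonoidHom.inr G G)

/-- The fusion of a group valued Hamiltonian `G × G`-manifold `(M, ω, (Φ₁, Φ₂))`: the diagonal
action, the 2-form `ω - ½ Φ₁^*θᴸ · Φ₂^*θᴿ` and the moment map `Φ₁ Φ₂`. -/
def Triple.fusion [FiniteDimensional ℝ E] (B : LinearMap.BilinForm ℝ (GroupLieAlgebra I G))
    (X : Triple (G × G) J M) : Triple G J M where
  act := X.act.comp ((MonoidHom.id G).prod (MonoidHom.id G))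
  form m := X.form m - (1 / 2 : ℝ) • wedgeDot B
    ((thetaL I (X.moment m).1).comp (mfderiv J I (fun x => (X.moment x).1) m))
    ((thetaR I (X.moment m).2).comp (mfderiv J I (fun x => (X.moment x).2) m))
  moment m := (X.moment m).1 * (X.moment m).2

/-- The operator `-½ ∑ᵢ ιᵢ¹ ιᵢ²` on forms at `m`, where `ιᵢ¹`, `ιᵢ²` are the contractions with the
generating vector fields of `e i` for the actions of the two factors of `G × G`. -/
def fusionOperator (X : Triple (G × G) J M) {d : ℕ} (e : Fin d → GroupLieAlgebra I G) (m : M) :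
    Module.End ℝ (Forms (TangentSpace J m)) :=
  (-(1 / 2) : ℝ) • ∑ i, contraction (genField I J X.act₁ (e i) m) *
    contraction (genField I J X.act₂ (e i) m)

/-- The direct product of a `G₁`-manifold and a `G₂`-manifold, as a `G₁ × G₂`-manifold. -/
def Triple.prod {G₁ G₂ : Type*} [Group G₁] [Group G₂]
    {F₁ : Type*} [NormedAddCommGroup F₁] [NormedSpace ℝ F₁] {K₁ : Type*} [TopologicalSpace K₁]
    {J₁ : ModelWithCorners ℝ F₁ K₁} {M₁ : Type*} [TopologicalSpace M₁] [ChartedSpace K₁ M₁]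
    {F₂ : Type*} [NormedAddCommGroup F₂] [NormedSpace ℝ F₂] {K₂ : Type*} [TopologicalSpace K₂]
    {J₂ : ModelWithCorners ℝ F₂ K₂} {M₂ : Type*} [TopologicalSpace M₂] [ChartedSpace K₂ M₂]
    (X₁ : Triple G₁ J₁ M₁) (X₂ : Triple G₂ J₂ M₂) :
    Triple (G₁ × G₂) (J₁.prod J₂) (M₁ × M₂) where
  act :=
    { toFun := fun g => Equiv.prodCongr (X₁.act g.1) (X₂.act g.2)
      map_one' := by ext x <;> simp
      map_mul' := fun g h => by ext x <;> simp }
  form m :=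
    (X₁.form m.1).compContinuousLinearMap (mfderiv (J₁.prod J₂) J₁ Prod.fst m) +
      (X₂.form m.2).compContinuousLinearMap (mfderiv (J₁.prod J₂) J₂ Prod.snd m)
  moment m := (X₁.moment m.1, X₂.moment m.2)

/-- The inner product on the Lie algebra `𝔤 ⊕ 𝔤` of `G × G`, the sum of the inner products of the
two factors. -/
def squareForm (B : LinearMap.BilinForm ℝ (GroupLieAlgebra I G)) :
    LinearMap.BilinForm ℝ (GroupLieAlgebra (I.prod I) (G × G)) :=
  sumForm B B

/-- The product `τ(g₁) τ(g₂)` in `Cl(𝔤 ⊕ 𝔤)`, a lift of the adjoint action of `(g₁, g₂)`.  The form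
`𝒯` on `G × G` constructed from it is the product of the forms `𝒯` on the two factors, and thus
the form `Γ` constructed from it is `exp(ω) Φ₁^*𝒯 Φ₂^*𝒯`. -/
def liftSquare (B : LinearMap.BilinForm ℝ (GroupLieAlgebra I G)) (τ : G →* Pin B) (g : G × G) :
    Cl (squareForm I B) :=
  clInl B B ((τ g.1 : (Cl B)ˣ) : Cl B) * clInr B B ((τ g.2 : (Cl B)ˣ) : Cl B)

end Fusion
end GroupValued

end

/-!
# Fusion of group valued Hamiltonian manifolds

*The fusion formula.* At a point `m` the form `Γ` is the image of a lift `s ∈ Pin(𝔤)` of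
`Ad_Φ(m)` under the map `expSubst`, which sends `z ∈ Cl(𝔤)` to `exp(ω) ρ(σ(z))`, where `ρ`
substitutes `½ Φ^*θᴿ·ξ` for `ξ`.  By the moment map condition and the equivariance of `Φ`, the
contraction with the generating vector field of `ξ` corresponds under this map to the operator
`z ↦ Ad_Φ(m)(ξ) z + α(z) ξ` on the Clifford algebra (`contraction_expSubst`).  Since `u` lifts the
adjoint action, this operator sends `u x` to `α(u) (ξ x + α(x) ξ)`, and the symbol of the bracket is
twice the exterior product `ξ ∧ σ(x)`.  For a `G × G`-manifold and `u = s₁¹ s₂²` it follows that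
`exp(-½ ∑ᵢ ιᵢ¹ ιᵢ²) Γ` is the image of `u K`, where `K ∈ Cl(𝔤 ⊕ 𝔤)` has the symbol
`exp(-2 ∑ᵢ eᵢ¹ ∧ eᵢ²)`.

The element `K` has two properties.  It intertwines the two copies of `Cl(𝔤)`, that is `y² K = K y¹`
(`clInr_mul_fusionKernel_id`), and it is conjugated by `s¹`, for a lift `s` of `A`, into the element
`K_A` with symbol `exp(-2 ∑ᵢ (A eᵢ)¹ ∧ eᵢ²)` (`clInl_mul_fusionKernel_id`; this is checked on the
reflections that generate the Pin group).  Hence `s₁¹ s₂² K = K_A (s₁ s₂)¹` for `A = Ad_Φ₁(m)`, and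
the symbol of this product is `exp(-2 ∑ᵢ (A eᵢ)¹ ∧ eᵢ²)` times the image of `σ(s₁ s₂)` under
`ξ ↦ (ξ, Aᵀ ξ)` (`symbol_fusionKernel_mul`).  After the substitution, the first factor is the
exponential of `-½ Φ₁^*θᴸ·Φ₂^*θᴿ`, the change of the 2-form under fusion, and the second one reflects
the formula `(Φ₁ Φ₂)^*θᴿ = Φ₁^*θᴿ + Ad_Φ₁ Φ₂^*θᴿ`.  This is `Gamma_fusion`.  Contractions do not
contribute to the top degree, so the volume forms agree.

*Forms with values in the orientation bundle.* Lifts to the Pin group are unique up to sign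
(`isLift_eq_or_eq_neg`), and the sign drops out of the twisted form, which can therefore be computed
from any lift (`twistedGamma_eq`), in particular from the product of two lifts.

*Products.* The form `Γ` of a direct product is the product of the forms of the factors
(`Gamma_prod`).  The Liouville measure of a direct product is compared with the product measure in
charts, by Tonelli's theorem.  This needs that the densities are measurable in charts; to see this,
`Ad_Φ(m)` is lifted to the Pin group in a measurable way, by writing an isometry as a product of
reflections that depend measurably on it (`exists_weakMeasurable_lift`).  The measures on the charts
glue because densities transform with the absolute value of the Jacobian determinant
(`chartMeasure_overlap`).
-/

noncomputable section

namespace GroupValued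

/-! ### The truncated exponential -/

section ExpUpTo

variable {A : Type*} [Ring A] [Algebra ℝ A]

/-- Once the powers of `a` vanish, the point at which the series is cut off does not matter. -/
theorem expUpTo_of_le {n m : ℕ} {a : A} (ha : a ^ (n + 1) = 0) (h : n ≤ m) :
    expUpTo m a = expUpTo n a := by
  refine (Finset.sum_subset (Finset.range_mono (by omega)) fun k _ hk => ?_).symm
  rw [pow_eq_zero_of_le (by simpa using hk) ha, smul_zero]

theorem expUpTo_add {n : ℕ} {a b : A} (h : Commute a b) (ha : a ^ (n + 1) = 0)
    (hb : b ^ (n + 1) = 0) (hab : (a + b) ^ (n + 1) = 0) :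
    expUpTo n (a + b) = expUpTo n a * expUpTo n b := by
  let _ : Module ℚ A := Module.compHom A (algebraMap ℚ ℝ)
  have key : ∀ c : A, c ^ (n + 1) = 0 → expUpTo n c = IsNilpotent.exp c := by
    intro c hc
    rw [IsNilpotent.exp_eq_sum hc]
    refine Finset.sum_congr rfl fun k _ => ?_
    change _ = (algebraMap ℚ ℝ ((k ! : ℚ)⁻¹)) • c ^ k
    simp
  rw [key _ ha, key _ hb, key _ hab, IsNilpotent.exp_add_of_commute h ⟨_, ha⟩ ⟨_, hb⟩]

theorem map_expUpTo {A' : Type*} [Ring A'] [Algebra ℝ A'] (f : A →ₐ[ℝ] A') (n : ℕ) (a : A) :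
    f (expUpTo n a) = expUpTo n (f a) := by
  simp [expUpTo]

theorem Commute.expUpTo_right {a b : A} (h : Commute a b) (n : ℕ) : Commute a (expUpTo n b) :=
  Commute.sum_right _ _ _ fun k _ => (h.pow_right k).smul_right _

/-- The chain rule for an operator that differentiates multiplication by an element `b`. -/
theorem expUpTo_mul_of_derivation {n : ℕ} {b c : A} (hc : Commute c b)
    (hcb : c * b ^ n = 0) (δ : A →ₗ[ℝ] A) (hδ : ∀ x, δ (b * x) = c * x + b * δ x) (x : A) :
    δ (expUpTo n b * x) = c * expUpTo n b * x + expUpTo n b * δ x := by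
  have hk : ∀ k : ℕ, ∀ x, δ (b ^ k * x) = (k : ℝ) • (c * b ^ (k - 1) * x) + b ^ k * δ x := by
    intro k
    induction k with
    | zero => intro x; simp
    | succ k ih =>
      intro x
      rw [pow_succ', mul_assoc, hδ, ih, mul_add, ← mul_assoc c, ← mul_assoc b (b ^ k), ← add_assoc,
        mul_smul_comm]
      congr 1
      rcases k with _ | k
      · simp
      · have : b * (c * b ^ k * x) = c * b ^ (k + 1) * x := by
          rw [← mul_assoc, ← mul_assoc, ← hc.eq, mul_assoc c, pow_succ']
        simp only [Nat.add_sub_cancel, this]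
        push_cast
        module
  have hlast : c * expUpTo n b =
      ∑ k ∈ Finset.range (n + 1), ((k ! : ℝ)⁻¹) • ((k : ℝ) • (c * b ^ (k - 1))) := by
    rw [Finset.sum_range_succ', expUpTo, Finset.sum_range_succ, mul_add, mul_smul_comm, hcb]
    simp only [smul_zero, add_zero, Nat.cast_zero, zero_smul]
    rw [Finset.mul_sum]
    refine Finset.sum_congr rfl fun k _ => ?_
    rw [mul_smul_comm, Nat.add_sub_cancel, smul_smul]
    congr 1
    rw [Nat.factorial_succ]
    have : ((k : ℝ) + 1) ≠ 0 := by positivity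
    push_cast
    field_simp
  rw [hlast]
  simp only [expUpTo, Finset.sum_mul, map_sum, ← Finset.sum_add_distrib, smul_mul_assoc, map_smul,
    hk, smul_add]

end ExpUpTo

/-! ### Bivectors and contractions in exterior algebras -/

section ExteriorBasics

variable {V : Type*} [AddCommGroup V] [Module ℝ V]

theorem ι_mul_ι_mem (a b : V) :
    ExteriorAlgebra.ι ℝ a * ExteriorAlgebra.ι ℝ b ∈ ⋀[ℝ]^2 V := by
  rw [ExteriorAlgebra.exteriorPower, pow_two]
  exact Submodule.mul_mem_mul ⟨a, rfl⟩ ⟨b, rfl⟩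

theorem two_form_induction {p : ExteriorAlgebra ℝ V → Prop} {x : ExteriorAlgebra ℝ V}
    (hx : x ∈ ⋀[ℝ]^2 V) (hadd : ∀ x y, p x → p y → p (x + y))
    (hmul : ∀ a b, p (ExteriorAlgebra.ι ℝ a * ExteriorAlgebra.ι ℝ b)) : p x := by
  rw [ExteriorAlgebra.exteriorPower, pow_two] at hx
  refine Submodule.mul_induction_on hx ?_ hadd
  rintro _ ⟨a, rfl⟩ _ ⟨b, rfl⟩
  exact hmul a b

theorem two_form_commute {β : ExteriorAlgebra ℝ V} (hβ : β ∈ ⋀[ℝ]^2 V)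
    (x : ExteriorAlgebra ℝ V) : Commute β x := by
  refine two_form_induction (p := fun β : ExteriorAlgebra ℝ V => Commute β x) hβ
    (fun _ _ => Commute.add_left) fun a b => ?_
  have hab : ∀ c d : V, ExteriorAlgebra.ι ℝ c * ExteriorAlgebra.ι ℝ d =
      -(ExteriorAlgebra.ι ℝ d * ExteriorAlgebra.ι ℝ c) := fun c d =>
    eq_neg_of_add_eq_zero_left (ExteriorAlgebra.ι_add_mul_swap c d)
  induction x using ExteriorAlgebra.induction with
  | algebraMap r => exact (Algebra.commutes r _).symm
  | ι x =>
    change _ * _ = _ * _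
    rw [mul_assoc, hab b x, mul_neg, ← mul_assoc, hab a x, neg_mul, neg_neg, mul_assoc]
  | mul x y hx hy => exact hx.mul_right hy
  | add x y hx hy => exact hx.add_right hy

/-- The contraction of a bivector is a vector, and contractions differentiate the multiplication by
a bivector, without a sign. -/
theorem two_form_contract {β : ExteriorAlgebra ℝ V} (hβ : β ∈ ⋀[ℝ]^2 V)
    (d : Module.Dual ℝ V) :
    (∃ c : V, CliffordAlgebra.contractLeft d β = ExteriorAlgebra.ι ℝ c) ∧
    ∀ x : ExteriorAlgebra ℝ V, CliffordAlgebra.contractLeft d (β * x) =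
      CliffordAlgebra.contractLeft d β * x + β * CliffordAlgebra.contractLeft d x := by
  refine two_form_induction (p := fun β : ExteriorAlgebra ℝ V =>
    (∃ c : V, CliffordAlgebra.contractLeft d β = ExteriorAlgebra.ι ℝ c) ∧
    ∀ x : ExteriorAlgebra ℝ V, CliffordAlgebra.contractLeft d (β * x) =
      CliffordAlgebra.contractLeft d β * x + β * CliffordAlgebra.contractLeft d x)
    hβ ?_ ?_
  · rintro x y ⟨⟨c, hc⟩, hx⟩ ⟨⟨c', hc'⟩, hy⟩
    refine ⟨⟨c + c', by simp [hc, hc']⟩, fun z => ?_⟩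
    simp only [add_mul, map_add, hx, hy]
    abel
  · intro a b
    refine ⟨⟨d a • b - d b • a, ?_⟩, fun x => ?_⟩
    · rw [CliffordAlgebra.contractLeft_ι_mul, CliffordAlgebra.contractLeft_ι]
      simp [← Algebra.commutes, Algebra.smul_def]
    · rw [mul_assoc, CliffordAlgebra.contractLeft_ι_mul, CliffordAlgebra.contractLeft_ι_mul,
        CliffordAlgebra.contractLeft_ι_mul, CliffordAlgebra.contractLeft_ι]
      simp only [mul_sub, sub_mul, mul_assoc, ← Algebra.commutes]
      simp only [Algebra.smul_def, mul_assoc, Algebra.left_comm]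
      rw [sub_add]

theorem exteriorPower_eq_bot [FiniteDimensional ℝ V] {k : ℕ} (hk : Module.finrank ℝ V < k) :
    ⋀[ℝ]^k V = ⊥ := by
  have h := exteriorPower.finrank_eq ℝ k (M := V)
  rw [Nat.choose_eq_zero_of_lt hk] at h
  exact Submodule.finrank_eq_zero.mp h

theorem two_form_pow_eq_zero [FiniteDimensional ℝ V] {β : ExteriorAlgebra ℝ V}
    (hβ : β ∈ ⋀[ℝ]^2 V) {n : ℕ} (hn : Module.finrank ℝ V ≤ n) : β ^ (n + 1) = 0 := by
  have h := SetLike.pow_mem_graded (A := fun i : ℕ => ⋀[ℝ]^i V) (n + 1) hβ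
  rw [smul_eq_mul] at h
  rw [exteriorPower_eq_bot (by omega)] at h
  exact h

/-- Contractions differentiate the multiplication by the exponential of a bivector. -/
theorem contractLeft_expUpTo_mul [FiniteDimensional ℝ V] {β : ExteriorAlgebra ℝ V}
    (hβ : β ∈ ⋀[ℝ]^2 V) {n : ℕ} (hn : Module.finrank ℝ V ≤ n) (d : Module.Dual ℝ V)
    (x : ExteriorAlgebra ℝ V) :
    CliffordAlgebra.contractLeft d (expUpTo n β * x) =
      CliffordAlgebra.contractLeft d β * expUpTo n β * x +
        expUpTo n β * CliffordAlgebra.contractLeft d x := by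
  refine expUpTo_mul_of_derivation (two_form_commute hβ _).symm ?_
    (CliffordAlgebra.contractLeft d) (two_form_contract hβ d).2 x
  -- The product of the vector `c` with the last power of `β` has degree above the dimension.
  obtain ⟨c, hc⟩ := (two_form_contract hβ d).1
  rw [hc]
  have h := SetLike.mul_mem_graded (A := fun i : ℕ => ⋀[ℝ]^i V)
    (show ExteriorAlgebra.ι ℝ c ∈ ⋀[ℝ]^1 V by
      rw [ExteriorAlgebra.exteriorPower, pow_one]; exact ⟨c, rfl⟩) (SetLike.pow_mem_graded n hβ)
  rw [smul_eq_mul] at h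
  rcases Nat.eq_zero_or_pos n with h0 | h0
  · rw [exteriorPower_eq_bot (by omega)] at h
    exact h
  · rw [exteriorPower_eq_bot (by omega)] at h
    exact h

theorem involute_contractLeft (d : Module.Dual ℝ V) (x : ExteriorAlgebra ℝ V) :
    CliffordAlgebra.involute (CliffordAlgebra.contractLeft d x) =
      -CliffordAlgebra.contractLeft d (CliffordAlgebra.involute x) := by
  induction x using CliffordAlgebra.left_induction with
  | algebraMap r => simp
  | add x y hx hy => simp [hx, hy, add_comm]
  | ι_mul x a hx =>
    rw [CliffordAlgebra.contractLeft_ι_mul, map_mul, CliffordAlgebra.involute_ι, neg_mul, map_neg,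
      CliffordAlgebra.contractLeft_ι_mul, map_sub, map_smul, map_mul, hx,
      CliffordAlgebra.involute_ι]
    simp

theorem involute_two_form {β : ExteriorAlgebra ℝ V} (hβ : β ∈ ⋀[ℝ]^2 V) :
    CliffordAlgebra.involute β = β := by
  refine two_form_induction (p := fun β : ExteriorAlgebra ℝ V => CliffordAlgebra.involute β = β)
    hβ (fun x y hx hy => by rw [map_add, hx, hy]) fun a b => ?_
  rw [map_mul, CliffordAlgebra.involute_ι, CliffordAlgebra.involute_ι, neg_mul_neg]

/-- Contractions after substitution of linear forms. -/
theorem contractLeft_map {V' : Type*} [AddCommGroup V'] [Module ℝ V'] (f : V →ₗ[ℝ] V')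
    (d : Module.Dual ℝ V') (x : ExteriorAlgebra ℝ V) :
    CliffordAlgebra.contractLeft d (ExteriorAlgebra.map f x) =
      ExteriorAlgebra.map f (CliffordAlgebra.contractLeft (d ∘ₗ f) x) := by
  induction x using CliffordAlgebra.left_induction with
  | algebraMap r => simp
  | add x y hx hy => simp [hx, hy]
  | ι_mul x a hx =>
    have ha : ExteriorAlgebra.map f (CliffordAlgebra.ι 0 a) = CliffordAlgebra.ι 0 (f a) :=
      ExteriorAlgebra.map_apply_ι f a
    rw [CliffordAlgebra.contractLeft_ι_mul, map_mul (ExteriorAlgebra.map f), map_sub, map_smul,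
      map_mul (ExteriorAlgebra.map f), ← hx, ha, CliffordAlgebra.contractLeft_ι_mul]
    rfl

end ExteriorBasics

/-! ### Clifford multiplication in terms of symbols -/

section Symbol

variable {W : Type*} [AddCommGroup W] [Module ℝ W] {B : LinearMap.BilinForm ℝ W}

theorem ι_mul_ι_add_swap (hB : ∀ x y, B x y = B y x) (a b : W) :
    CliffordAlgebra.ι (halfSq B) a * CliffordAlgebra.ι (halfSq B) b +
      CliffordAlgebra.ι (halfSq B) b * CliffordAlgebra.ι (halfSq B) a = algebraMap ℝ _ (B a b) := by
  rw [CliffordAlgebra.ι_mul_ι_add_swap]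
  congr 1
  simp [halfSq, QuadraticMap.polar, hB b a]
  ring

theorem ι_mul_self (a : W) :
    CliffordAlgebra.ι (halfSq B) a * CliffordAlgebra.ι (halfSq B) a =
      algebraMap ℝ _ ((1 / 2) * B a a) := by
  rw [CliffordAlgebra.ι_sq_scalar]
  simp [halfSq]

@[simp] theorem symbol_one : symbol B 1 = 1 :=
  CliffordAlgebra.changeForm_one CliffordAlgebra.changeForm.associated_neg_proof

@[simp] theorem symbol_algebraMap (r : ℝ) : symbol B (algebraMap ℝ _ r) = algebraMap ℝ _ r :=
  CliffordAlgebra.changeForm_algebraMap CliffordAlgebra.changeForm.associated_neg_proof r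

@[simp] theorem symbol_ι (a : W) :
    symbol B (CliffordAlgebra.ι (halfSq B) a) = ExteriorAlgebra.ι ℝ a :=
  CliffordAlgebra.changeForm_ι CliffordAlgebra.changeForm.associated_neg_proof a

/-- Left Clifford multiplication by a vector in terms of symbols. -/
theorem symbol_ι_mul (hB : ∀ x y, B x y = B y x) (a : W) (x : Cl B) :
    symbol B (CliffordAlgebra.ι (halfSq B) a * x) = ExteriorAlgebra.ι ℝ a * symbol B x +
      (1 / 2 : ℝ) • CliffordAlgebra.contractLeft (B a) (symbol B x) := by
  have h := CliffordAlgebra.changeForm_ι_mul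
    (CliffordAlgebra.changeForm.associated_neg_proof (Q := halfSq B)) a x
  have ha : (QuadraticMap.associated (R := ℝ) (-(halfSq B))) a = -((1 / 2 : ℝ) • B a) := by
    ext b
    simp [QuadraticMap.associated_apply, halfSq, hB b a]
    ring
  refine h.trans ?_
  change ExteriorAlgebra.ι ℝ a * symbol B x - CliffordAlgebra.contractLeft
    ((QuadraticMap.associated (R := ℝ) (-(halfSq B))) a) (symbol B x) = _
  rw [ha, map_neg, map_smul, LinearMap.neg_apply, LinearMap.smul_apply, sub_neg_eq_add]

theorem symbol_involute (hB : ∀ x y, B x y = B y x) (x : Cl B) :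
    symbol B (CliffordAlgebra.involute x) = CliffordAlgebra.involute (symbol B x) := by
  induction x using CliffordAlgebra.left_induction with
  | algebraMap r => simp
  | add x y hx hy => simp [hx, hy]
  | ι_mul x a hx =>
    rw [map_mul, CliffordAlgebra.involute_ι, neg_mul, map_neg, symbol_ι_mul hB, symbol_ι_mul hB,
      map_add, map_mul, map_smul, involute_contractLeft, hx, CliffordAlgebra.involute_ι]
    simp
    abel

/-- Right Clifford multiplication by a vector in terms of symbols. -/
theorem symbol_involute_mul_ι (hB : ∀ x y, B x y = B y x) (a : W) (x : Cl B) :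
    symbol B (CliffordAlgebra.involute x * CliffordAlgebra.ι (halfSq B) a) =
      ExteriorAlgebra.ι ℝ a * symbol B x -
      (1 / 2 : ℝ) • CliffordAlgebra.contractLeft (B a) (symbol B x) := by
  induction x using CliffordAlgebra.left_induction with
  | algebraMap r =>
    rw [AlgHom.commutes, ← Algebra.smul_def, map_smul, symbol_ι,
      symbol_algebraMap, CliffordAlgebra.contractLeft_algebraMap, smul_zero, sub_zero,
      ← Algebra.commutes, Algebra.smul_def]
  | add x y hx hy => simp only [map_add, add_mul, hx, hy, mul_add, smul_add]; abel
  | ι_mul x b hx =>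
    have hab : ExteriorAlgebra.ι ℝ b * (ExteriorAlgebra.ι ℝ a * symbol B x) =
        -(ExteriorAlgebra.ι ℝ a * (ExteriorAlgebra.ι ℝ b * symbol B x)) := by
      rw [← mul_assoc, ← mul_assoc, eq_neg_of_add_eq_zero_left (ExteriorAlgebra.ι_add_mul_swap b a),
        neg_mul]
    rw [map_mul CliffordAlgebra.involute, CliffordAlgebra.involute_ι, neg_mul, neg_mul,
      map_neg, mul_assoc, symbol_ι_mul hB, hx, symbol_ι_mul hB]
    simp only [mul_sub, map_sub, map_smul, mul_smul_comm, map_add, mul_add, hab]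
    have h1 := CliffordAlgebra.contractLeft_ι_mul (Q := (0 : QuadraticForm ℝ W)) (B b) a
      (symbol B x)
    have h2 := CliffordAlgebra.contractLeft_ι_mul (Q := (0 : QuadraticForm ℝ W)) (B a) b
      (symbol B x)
    have h3 := CliffordAlgebra.contractLeft_comm (Q := (0 : QuadraticForm ℝ W)) (B b) (B a)
      (symbol B x)
    rw [h1, h2, h3, hB b a]
    module

/-- The operator `z ↦ a z + α(z) a` on the Clifford algebra corresponds to twice the exterior
multiplication by `a`. -/
theorem symbol_add_involute (hB : ∀ x y, B x y = B y x) (a : W) (x : Cl B) :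
    symbol B (CliffordAlgebra.ι (halfSq B) a * x +
      CliffordAlgebra.involute x * CliffordAlgebra.ι (halfSq B) a) =
      (2 : ℝ) • (ExteriorAlgebra.ι ℝ a * symbol B x) := by
  rw [map_add, symbol_ι_mul hB, symbol_involute_mul_ι hB]
  module

end Symbol

/-! ### The Clifford algebra of an orthogonal sum -/

section SumForm

variable {W₁ W₂ : Type*} [AddCommGroup W₁] [Module ℝ W₁] [AddCommGroup W₂] [Module ℝ W₂]
  {B₁ : LinearMap.BilinForm ℝ W₁} {B₂ : LinearMap.BilinForm ℝ W₂}

@[simp] theorem sumForm_apply (x y : W₁ × W₂) :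
    sumForm B₁ B₂ x y = B₁ x.1 y.1 + B₂ x.2 y.2 := rfl

theorem sumForm_symm (h₁ : ∀ x y, B₁ x y = B₁ y x) (h₂ : ∀ x y, B₂ x y = B₂ y x)
    (x y : W₁ × W₂) : sumForm B₁ B₂ x y = sumForm B₁ B₂ y x := by
  simp [h₁ x.1, h₂ x.2]

@[simp] theorem clInl_ι (x : W₁) : clInl B₁ B₂ (CliffordAlgebra.ι (halfSq B₁) x) =
    CliffordAlgebra.ι (halfSq (sumForm B₁ B₂)) (x, 0) :=
  CliffordAlgebra.map_apply_ι _ _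

@[simp] theorem clInr_ι (x : W₂) : clInr B₁ B₂ (CliffordAlgebra.ι (halfSq B₂) x) =
    CliffordAlgebra.ι (halfSq (sumForm B₁ B₂)) (0, x) :=
  CliffordAlgebra.map_apply_ι _ _

theorem involute_clInl (x : Cl B₁) : CliffordAlgebra.involute (clInl B₁ B₂ x) =
    clInl B₁ B₂ (CliffordAlgebra.involute x) := by
  have : (CliffordAlgebra.involute.comp (clInl B₁ B₂)) =
      (clInl B₁ B₂).comp CliffordAlgebra.involute := by
    ext a; simp
  exact DFunLike.congr_fun this x

theorem involute_clInr (x : Cl B₂) : CliffordAlgebra.involute (clInr B₁ B₂ x) =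
    clInr B₁ B₂ (CliffordAlgebra.involute x) := by
  have : (CliffordAlgebra.involute.comp (clInr B₁ B₂)) =
      (clInr B₁ B₂).comp CliffordAlgebra.involute := by
    ext a; simp
  exact DFunLike.congr_fun this x

/-- Vectors of the second summand commute with the first copy of the Clifford algebra up to
parity. -/
theorem ι_inr_mul_clInl (h₁ : ∀ x y, B₁ x y = B₁ y x) (h₂ : ∀ x y, B₂ x y = B₂ y x)
    (x : Cl B₁) (b : W₂) :
    CliffordAlgebra.ι (halfSq (sumForm B₁ B₂)) (0, b) * clInl B₁ B₂ x =
      clInl B₁ B₂ (CliffordAlgebra.involute x) *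
        CliffordAlgebra.ι (halfSq (sumForm B₁ B₂)) (0, b) := by
  induction x using CliffordAlgebra.left_induction with
  | algebraMap r => simp [Algebra.commutes]
  | add x y hx hy => simp [hx, hy, add_mul, mul_add]
  | ι_mul x a hx =>
    have h := ι_mul_ι_add_swap (sumForm_symm h₁ h₂) ((0, b) : W₁ × W₂) (a, 0)
    simp only [sumForm_apply, map_zero, LinearMap.zero_apply, add_zero] at h
    rw [map_mul, clInl_ι, ← mul_assoc, eq_neg_of_add_eq_zero_left h, map_mul,
      CliffordAlgebra.involute_ι, neg_mul, mul_assoc, hx]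
    simp [mul_assoc]

/-- Vectors of the first summand commute with the second copy of the Clifford algebra up to
parity. -/
theorem ι_inl_mul_clInr (h₁ : ∀ x y, B₁ x y = B₁ y x) (h₂ : ∀ x y, B₂ x y = B₂ y x)
    (x : Cl B₂) (a : W₁) :
    CliffordAlgebra.ι (halfSq (sumForm B₁ B₂)) (a, 0) * clInr B₁ B₂ x =
      clInr B₁ B₂ (CliffordAlgebra.involute x) *
        CliffordAlgebra.ι (halfSq (sumForm B₁ B₂)) (a, 0) := by
  induction x using CliffordAlgebra.left_induction with
  | algebraMap r => simp [Algebra.commutes]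
  | add x y hx hy => simp [hx, hy, add_mul, mul_add]
  | ι_mul x b hx =>
    have h := ι_mul_ι_add_swap (sumForm_symm h₁ h₂) ((a, 0) : W₁ × W₂) (0, b)
    simp only [sumForm_apply, map_zero, LinearMap.zero_apply, add_zero] at h
    rw [map_mul, clInr_ι, ← mul_assoc, eq_neg_of_add_eq_zero_left h, map_mul,
      CliffordAlgebra.involute_ι, neg_mul, mul_assoc, hx]
    simp [mul_assoc]

/-- Symbols are multiplicative on products of elements of the Clifford algebras of two orthogonal
summands. -/
theorem symbol_clInl_mul_clInr (h₁ : ∀ x y, B₁ x y = B₁ y x) (h₂ : ∀ x y, B₂ x y = B₂ y x)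
    (x : Cl B₁) (y : Cl B₂) :
    symbol (sumForm B₁ B₂) (clInl B₁ B₂ x * clInr B₁ B₂ y) =
      ExteriorAlgebra.map (LinearMap.inl ℝ W₁ W₂) (symbol B₁ x) *
        ExteriorAlgebra.map (LinearMap.inr ℝ W₁ W₂) (symbol B₂ y) := by
  have hz : ∀ (a : W₁) (y : ExteriorAlgebra ℝ W₂),
      CliffordAlgebra.contractLeft (sumForm B₁ B₂ (a, 0))
        (ExteriorAlgebra.map (LinearMap.inr ℝ W₁ W₂) y) = 0 := fun a y => by
    rw [contractLeft_map, show (sumForm B₁ B₂ (a, 0) ∘ₗ LinearMap.inr ℝ W₁ W₂) = 0 by ext; simp]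
    simp
  induction x using CliffordAlgebra.left_induction with
  | algebraMap r =>
    rw [AlgHom.commutes, symbol_algebraMap, AlgHom.commutes, ← Algebra.smul_def,
      ← Algebra.smul_def, map_smul]
    congr 1
    induction y using CliffordAlgebra.left_induction with
    | algebraMap r => simp
    | add x y hx hy => simp [hx, hy]
    | ι_mul y b hy =>
      rw [map_mul, clInr_ι, symbol_ι_mul (sumForm_symm h₁ h₂), hy, symbol_ι_mul h₂, map_add,
        map_mul, ExteriorAlgebra.map_apply_ι, map_smul, contractLeft_map]
      rw [show sumForm B₁ B₂ (0, b) ∘ₗ LinearMap.inr ℝ W₁ W₂ = B₂ b by ext; simp]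
      rfl
  | add x y hx hy => simp [hx, hy, add_mul]
  | ι_mul x a hx =>
    rw [map_mul (clInl B₁ B₂), clInl_ι, mul_assoc, symbol_ι_mul (sumForm_symm h₁ h₂), hx,
      symbol_ι_mul h₁, map_add, map_mul (ExteriorAlgebra.map _), ExteriorAlgebra.map_apply_ι,
      add_mul, mul_assoc, map_smul]
    congr 1
    rw [smul_mul_assoc]
    congr 1
    have : ∀ z : ExteriorAlgebra ℝ W₁, CliffordAlgebra.contractLeft (sumForm B₁ B₂ (a, 0))
        (ExteriorAlgebra.map (LinearMap.inl ℝ W₁ W₂) z *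
          ExteriorAlgebra.map (LinearMap.inr ℝ W₁ W₂) (symbol B₂ y)) =
        ExteriorAlgebra.map (LinearMap.inl ℝ W₁ W₂) (CliffordAlgebra.contractLeft (B₁ a) z) *
          ExteriorAlgebra.map (LinearMap.inr ℝ W₁ W₂) (symbol B₂ y) := by
      intro z
      induction z using CliffordAlgebra.left_induction with
      | algebraMap r =>
        rw [CliffordAlgebra.contractLeft_algebraMap, map_zero, zero_mul, AlgHom.commutes,
          CliffordAlgebra.contractLeft_algebraMap_mul, hz, mul_zero]
      | add x y hx hy => simp [hx, hy, add_mul]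
      | ι_mul z c hz =>
        have hc : ExteriorAlgebra.map (LinearMap.inl ℝ W₁ W₂) (CliffordAlgebra.ι 0 c) =
          CliffordAlgebra.ι 0 (c, 0) := ExteriorAlgebra.map_apply_ι _ c
        rw [map_mul (ExteriorAlgebra.map _), hc, mul_assoc, CliffordAlgebra.contractLeft_ι_mul, hz,
          CliffordAlgebra.contractLeft_ι_mul, map_sub, map_smul, map_mul (ExteriorAlgebra.map _),
          hc, sub_mul, smul_mul_assoc, mul_assoc]
        simp
    exact this _

end SumForm

/-! ### The Clifford element with symbol the exponential of a bivector -/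

section FusionKernel

variable {W : Type*} [AddCommGroup W] [Module ℝ W] {d : ℕ}

/-- The bivector `-2 ∑ᵢ (A eᵢ)¹ ∧ eᵢ²` of `W ⊕ W`. -/
def fusionBivector (e : Fin d → W) (A : W →ₗ[ℝ] W) : ExteriorAlgebra ℝ (W × W) :=
  (-2 : ℝ) • ∑ i, ExteriorAlgebra.ι ℝ (A (e i), 0) * ExteriorAlgebra.ι ℝ (0, e i)

theorem fusionBivector_mem (e : Fin d → W) (A : W →ₗ[ℝ] W) :
    fusionBivector e A ∈ ⋀[ℝ]^2 (W × W) :=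
  Submodule.smul_mem _ _ (Submodule.sum_mem _ fun _ _ => ι_mul_ι_mem _ _)

theorem contractLeft_fusionBivector (e : Fin d → W) (A : W →ₗ[ℝ] W)
    (f : Module.Dual ℝ (W × W)) :
    CliffordAlgebra.contractLeft f (fusionBivector e A) = ExteriorAlgebra.ι ℝ
      ((-2 : ℝ) • ∑ i, (f (A (e i), 0) • (0, e i) - f (0, e i) • (A (e i), 0))) := by
  simp only [fusionBivector, map_smul, map_sum]
  refine congrArg _ (Finset.sum_congr rfl fun i _ => ?_)
  rw [CliffordAlgebra.contractLeft_ι_mul, CliffordAlgebra.contractLeft_ι,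
    ← Algebra.commutes, ← Algebra.smul_def, map_sub, map_smul, map_smul]

variable {B : LinearMap.BilinForm ℝ W}

/-- The expansion of a vector in an orthonormal basis. -/
theorem sum_form_smul (e : Module.Basis (Fin d) ℝ W)
    (he : ∀ i j, B (e i) (e j) = if i = j then 1 else 0) (v : W) :
    ∑ i, B v (e i) • e i = v := by
  conv_rhs => rw [← e.sum_repr v]
  refine Finset.sum_congr rfl fun i _ => ?_
  congr 1
  conv_lhs => rw [← e.sum_repr v]
  simp only [map_sum, map_smul, LinearMap.sum_apply, LinearMap.smul_apply, he]
  simp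

variable (B) in
/-- The transpose of `A` with respect to an inner product with orthonormal basis `e`. -/
def transposeBy (e : Fin d → W) (A : W →ₗ[ℝ] W) : W →ₗ[ℝ] W :=
  ∑ i, (B.flip (A (e i))).smulRight (e i)

theorem transposeBy_apply (e : Fin d → W) (A : W →ₗ[ℝ] W) (v : W) :
    transposeBy B e A v = ∑ i, B v (A (e i)) • e i := by
  simp [transposeBy]

theorem form_transposeBy (e : Module.Basis (Fin d) ℝ W) (hB : ∀ x y, B x y = B y x)
    (he : ∀ i j, B (e i) (e j) = if i = j then 1 else 0) (A : W →ₗ[ℝ] W) (u v : W) :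
    B u (transposeBy B e A v) = B (A u) v := by
  conv_rhs => rw [← sum_form_smul e he u]
  simp [transposeBy_apply, hB v, mul_comm]

variable (B) in
/-- The element of `Cl(W ⊕ W)` with symbol `exp(-2 ∑ᵢ (A eᵢ)¹ ∧ eᵢ²)`. -/
def fusionKernel (N : ℕ) (e : Fin d → W) (A : W →ₗ[ℝ] W) : Cl (sumForm B B) :=
  (symbol (sumForm B B)).symm (expUpTo N (fusionBivector e A))

theorem symbol_fusionKernel (N : ℕ) (e : Fin d → W) (A : W →ₗ[ℝ] W) :
    symbol (sumForm B B) (fusionKernel B N e A) = expUpTo N (fusionBivector e A) :=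
  LinearEquiv.apply_symm_apply _ _

theorem involute_expUpTo_fusionBivector (N : ℕ) (e : Fin d → W) (A : W →ₗ[ℝ] W) :
    CliffordAlgebra.involute (expUpTo N (fusionBivector e A)) =
      expUpTo N (fusionBivector e A) := by
  rw [map_expUpTo, involute_two_form (fusionBivector_mem e A)]

theorem involute_fusionKernel (hB : ∀ x y, B x y = B y x) (N : ℕ) (e : Fin d → W)
    (A : W →ₗ[ℝ] W) :
    CliffordAlgebra.involute (fusionKernel B N e A) = fusionKernel B N e A := by
  apply (symbol (sumForm B B)).injective
  rw [symbol_involute (sumForm_symm hB hB), symbol_fusionKernel, involute_expUpTo_fusionBivector]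

theorem contractLeft_inl_fusionBivector (e : Fin d → W) (A : W →ₗ[ℝ] W) (v : W) :
    CliffordAlgebra.contractLeft (sumForm B B (v, 0)) (fusionBivector e A) =
      ExteriorAlgebra.ι ℝ (0, (-2 : ℝ) • transposeBy B e A v) := by
  rw [contractLeft_fusionBivector]
  congr 1
  ext <;> simp [transposeBy_apply, Prod.fst_sum, Prod.snd_sum]

theorem contractLeft_inr_fusionBivector (e : Module.Basis (Fin d) ℝ W)
    (he : ∀ i j, B (e i) (e j) = if i = j then 1 else 0) (A : W →ₗ[ℝ] W) (v : W) :
    CliffordAlgebra.contractLeft (sumForm B B (0, v)) (fusionBivector e A) =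
      ExteriorAlgebra.ι ℝ ((2 : ℝ) • A v, 0) := by
  rw [contractLeft_fusionBivector]
  congr 1
  conv_rhs => rw [← sum_form_smul e he v]
  ext <;> simp [Prod.fst_sum, Prod.snd_sum]

variable [FiniteDimensional ℝ W] {N : ℕ}

/-- The kernel for `A = id` intertwines the two inclusions of vectors. -/
theorem ι_mul_fusionKernel_id (hB : ∀ x y, B x y = B y x) (e : Module.Basis (Fin d) ℝ W)
    (he : ∀ i j, B (e i) (e j) = if i = j then 1 else 0) (hN : Module.finrank ℝ (W × W) ≤ N)
    (v : W) :
    CliffordAlgebra.ι (halfSq (sumForm B B)) (0, v) * fusionKernel B N e LinearMap.id =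
      fusionKernel B N e LinearMap.id * CliffordAlgebra.ι (halfSq (sumForm B B)) (v, 0) := by
  apply (symbol (sumForm B B)).injective
  have hm := fusionBivector_mem e (LinearMap.id : W →ₗ[ℝ] W)
  rw [symbol_ι_mul (sumForm_symm hB hB)]
  conv_rhs => rw [← involute_fusionKernel hB]
  rw [symbol_involute_mul_ι (sumForm_symm hB hB), symbol_fusionKernel]
  have h1 := contractLeft_expUpTo_mul hm hN (sumForm B B (0, v)) 1
  have h2 := contractLeft_expUpTo_mul hm hN (sumForm B B (v, 0)) 1
  rw [CliffordAlgebra.contractLeft_one, mul_one, mul_zero, add_zero, mul_one] at h1 h2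
  rw [h1, h2, contractLeft_inl_fusionBivector, contractLeft_inr_fusionBivector e he,
    ← smul_mul_assoc, ← smul_mul_assoc, ← map_smul (ExteriorAlgebra.ι ℝ),
    ← map_smul (ExteriorAlgebra.ι ℝ), ← add_mul, ← sub_mul, ← map_add,
    ← map_sub]
  congr 2
  have ht : transposeBy B e LinearMap.id v = v := by
    rw [transposeBy_apply]; exact sum_form_smul e he v
  ext <;> simp [ht, smul_smul]

/-- The kernel for `A = id` intertwines the two copies of the Clifford algebra. -/
theorem clInr_mul_fusionKernel_id (hB : ∀ x y, B x y = B y x) (e : Module.Basis (Fin d) ℝ W)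
    (he : ∀ i j, B (e i) (e j) = if i = j then 1 else 0) (hN : Module.finrank ℝ (W × W) ≤ N)
    (y : Cl B) :
    clInr B B y * fusionKernel B N e LinearMap.id =
      fusionKernel B N e LinearMap.id * clInl B B y := by
  induction y using CliffordAlgebra.left_induction with
  | algebraMap r => simp [Algebra.commutes]
  | add x y hx hy => simp [hx, hy, add_mul, mul_add]
  | ι_mul y v hy =>
    rw [map_mul, map_mul, clInr_ι, clInl_ι, mul_assoc, hy, ← mul_assoc,
      ι_mul_fusionKernel_id hB e he hN, mul_assoc]

/-- Conjugation of the kernel by a unit vector composes `A` with the reflection in that vector. -/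
theorem ι_mul_fusionKernel (hB : ∀ x y, B x y = B y x) (e : Fin d → W)
    (hN : Module.finrank ℝ (W × W) ≤ N) (A : W →ₗ[ℝ] W) (v : W) (hv : B v v = 2) :
    CliffordAlgebra.ι (halfSq (sumForm B B)) (v, 0) * fusionKernel B N e A =
      fusionKernel B N e (A - (B v ∘ₗ A).smulRight v) *
        CliffordAlgebra.ι (halfSq (sumForm B B)) (v, 0) := by
  set A' := A - (B v ∘ₗ A).smulRight v with hA'
  set w := transposeBy B e A v with hw
  apply (symbol (sumForm B B)).injective
  rw [symbol_ι_mul (sumForm_symm hB hB)]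
  conv_rhs => rw [← involute_fusionKernel hB]
  rw [symbol_involute_mul_ι (sumForm_symm hB hB), symbol_fusionKernel, symbol_fusionKernel]
  have hm := fusionBivector_mem e A
  have hm' := fusionBivector_mem e A'
  have h1 := contractLeft_expUpTo_mul hm hN (sumForm B B (v, 0)) 1
  have h2 := contractLeft_expUpTo_mul hm' hN (sumForm B B (v, 0)) 1
  rw [CliffordAlgebra.contractLeft_one, mul_one, mul_zero, add_zero, mul_one] at h1 h2
  have hw' : transposeBy B e A' v = -w := by
    rw [hw, transposeBy_apply, transposeBy_apply, ← Finset.sum_neg_distrib]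
    refine Finset.sum_congr rfl fun i _ => ?_
    rw [← neg_smul]
    congr 1
    simp [hA', hv]
    ring
  rw [h1, h2, contractLeft_inl_fusionBivector, contractLeft_inl_fusionBivector,
    ← smul_mul_assoc, ← smul_mul_assoc, ← map_smul (ExteriorAlgebra.ι ℝ),
    ← map_smul (ExteriorAlgebra.ι ℝ), ← add_mul, ← sub_mul, ← map_add,
    ← map_sub, hw', ← hw]
  have hc1 : ((v, 0) : W × W) + (1 / 2 : ℝ) • (0, (-2 : ℝ) • w) = (v, -w) := by
    ext <;> simp [smul_smul]
  have hc2 : ((v, 0) : W × W) - (1 / 2 : ℝ) • (0, (-2 : ℝ) • -w) = (v, -w) := by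
    ext <;> simp [smul_smul]
  rw [hc1, hc2]
  -- The two bivectors differ by a multiple of `(v, 0) ∧ (0, w)`, which `(v, -w)` annihilates.
  set γ : ExteriorAlgebra ℝ (W × W) :=
    (2 : ℝ) • (ExteriorAlgebra.ι ℝ (v, 0) * ExteriorAlgebra.ι ℝ (0, w)) with hγ
  have hγm : γ ∈ ⋀[ℝ]^2 (W × W) := Submodule.smul_mem _ _ (ι_mul_ι_mem _ _)
  have hdiff : fusionBivector e A' = γ + fusionBivector e A := by
    have hw2 : ExteriorAlgebra.ι ℝ ((0, w) : W × W) =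
        ∑ i, B v (A (e i)) • ExteriorAlgebra.ι ℝ ((0, e i) : W × W) := by
      simp_rw [← map_smul, ← map_sum]
      congr 1
      ext <;> simp [hw, transposeBy_apply, Prod.fst_sum, Prod.snd_sum]
    rw [hγ, hw2, fusionBivector, fusionBivector, Finset.mul_sum, Finset.smul_sum, Finset.smul_sum,
      Finset.smul_sum, ← Finset.sum_add_distrib]
    refine Finset.sum_congr rfl fun i _ => ?_
    have : ((A' (e i), 0) : W × W) = (A (e i), 0) - B v (A (e i)) • (v, 0) := by
      ext <;> simp [hA']
    rw [this, map_sub, map_smul, sub_mul, smul_mul_assoc, mul_smul_comm]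
    module
  have hcγ : ExteriorAlgebra.ι ℝ (v, -w) * γ = 0 := by
    have : ((v, -w) : W × W) = (v, 0) - (0, w) := by ext <;> simp
    rw [this, map_sub, hγ, mul_smul_comm, sub_mul, ← mul_assoc, ExteriorAlgebra.ι_sq_zero,
      ← mul_assoc, eq_neg_of_add_eq_zero_left (ExteriorAlgebra.ι_add_mul_swap (0, w) (v, 0)),
      neg_mul, mul_assoc, ExteriorAlgebra.ι_sq_zero]
    simp
  have hcexp : ExteriorAlgebra.ι ℝ (v, -w) * expUpTo N γ = ExteriorAlgebra.ι ℝ (v, -w) := by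
    rw [expUpTo, Finset.mul_sum, Finset.sum_eq_single 0]
    · simp
    · intro k _ hk
      obtain ⟨k, rfl⟩ := Nat.exists_eq_succ_of_ne_zero hk
      rw [mul_smul_comm, pow_succ', ← mul_assoc, hcγ, zero_mul, smul_zero]
    · simp
  rw [hdiff, expUpTo_add (two_form_commute hγm _) (two_form_pow_eq_zero hγm hN)
    (two_form_pow_eq_zero hm hN) (two_form_pow_eq_zero (add_mem hγm hm) hN), ← mul_assoc, hcexp]

/-- Right Clifford multiplication of the kernel by an element of the first copy of `Cl(W)`. -/
theorem symbol_fusionKernel_mul (hB : ∀ x y, B x y = B y x) (e : Fin d → W)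
    (hN : Module.finrank ℝ (W × W) ≤ N) (A : W →ₗ[ℝ] W) (x : Cl B) :
    symbol (sumForm B B) (fusionKernel B N e A * clInl B B x) =
      expUpTo N (fusionBivector e A) *
        ExteriorAlgebra.map (LinearMap.id.prod (transposeBy B e A)) (symbol B x) := by
  have hm := fusionBivector_mem e A
  set X := expUpTo N (fusionBivector e A) with hX
  set j := (LinearMap.id : W →ₗ[ℝ] W).prod (transposeBy B e A) with hj
  set n : Cl B → Cl (sumForm B B) := fun x =>
    (symbol (sumForm B B)).symm (X * ExteriorAlgebra.map j (symbol B x)) with hn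
  have hsn : ∀ x, symbol (sumForm B B) (n x) = X * ExteriorAlgebra.map j (symbol B x) :=
    fun x => LinearEquiv.apply_symm_apply _ _
  -- `n` is linear over right multiplication by vectors, up to parity
  have key : ∀ (v : W) (x : Cl B),
      n (CliffordAlgebra.involute x * CliffordAlgebra.ι (halfSq B) v) =
        CliffordAlgebra.involute (n x) * CliffordAlgebra.ι (halfSq (sumForm B B)) (v, 0) := by
    intro v x
    apply (symbol (sumForm B B)).injective
    rw [hsn, symbol_involute_mul_ι hB, symbol_involute_mul_ι (sumForm_symm hB hB), hsn,
      hX, contractLeft_expUpTo_mul hm hN, contractLeft_map, contractLeft_inl_fusionBivector, ← hX,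
      show sumForm B B (v, 0) ∘ₗ j = B v by ext; simp [hj]]
    simp only [map_sub, map_smul, map_mul, ExteriorAlgebra.map_apply_ι, mul_sub, mul_smul_comm,
      smul_add]
    have hjv : j v = (v, 0) - (1 / 2 : ℝ) • (0, (-2 : ℝ) • transposeBy B e A v) := by
      ext <;> simp [hj, smul_smul]
    have hXc : ∀ c, X * ExteriorAlgebra.ι ℝ c = ExteriorAlgebra.ι ℝ c * X := fun c =>
      ((Commute.expUpTo_right (two_form_commute hm (ExteriorAlgebra.ι ℝ c)).symm N).eq).symm
    rw [← mul_assoc, hXc, hjv, map_sub, map_smul, sub_mul, sub_mul, mul_assoc, smul_mul_assoc,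
      smul_mul_assoc, sub_sub]
  have hinv := involute_fusionKernel hB N e A
  have main : ∀ x : Cl B, n x = fusionKernel B N e A * clInl B B x ∧
      n (CliffordAlgebra.involute x) =
        fusionKernel B N e A * clInl B B (CliffordAlgebra.involute x) := by
    intro x
    induction x using CliffordAlgebra.right_induction with
    | algebraMap r =>
      have : n (algebraMap ℝ _ r) = fusionKernel B N e A * clInl B B (algebraMap ℝ _ r) := by
        apply (symbol (sumForm B B)).injective
        rw [hsn, AlgHom.commutes, symbol_algebraMap, AlgHom.commutes, ← Algebra.commutes,
          ← Algebra.commutes, ← Algebra.smul_def, ← Algebra.smul_def, map_smul,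
          symbol_fusionKernel]
      refine ⟨this, ?_⟩
      rw [AlgHom.commutes]
      exact this
    | add x y hx hy =>
      have hadd : ∀ x y, n (x + y) = n x + n y := fun x y => by simp [hn, mul_add]
      simp only [map_add, hadd, hx, hy, mul_add, and_self]
    | mul_ι v x hx =>
      have hneg : ∀ x, n (-x) = -n x := fun x => by simp [hn]
      constructor
      · conv_lhs => rw [← CliffordAlgebra.involute_involute x]
        rw [key, hx.2, map_mul, hinv, involute_clInl, CliffordAlgebra.involute_involute, map_mul,
          clInl_ι, mul_assoc]
      · rw [map_mul, CliffordAlgebra.involute_ι, mul_neg, hneg, key, hx.1, map_neg, mul_neg,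
          map_mul, hinv, map_mul, clInl_ι, involute_clInl, mul_assoc]
  rw [← (main x).1, hsn]

end FusionKernel

/-! ### Lifts to the Pin group -/

section Lift

variable {W : Type*} [AddCommGroup W] [Module ℝ W] {B : LinearMap.BilinForm ℝ W}

theorem isLift_iff {s : Pin B} {A : W → W} : IsLift B s A ↔
    ∀ ξ, CliffordAlgebra.involute ((s : (Cl B)ˣ) : Cl B) * CliffordAlgebra.ι (halfSq B) ξ =
      CliffordAlgebra.ι (halfSq B) (A ξ) * ((s : (Cl B)ˣ) : Cl B) := by
  refine forall_congr' fun ξ => ?_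
  rw [Units.mul_inv_eq_iff_eq_mul]

/-- The image of a lift under the parity automorphism is again a lift. -/
theorem lift_involute {s : Cl B} {A : W → W}
    (h : ∀ ξ, CliffordAlgebra.involute s * CliffordAlgebra.ι (halfSq B) ξ =
      CliffordAlgebra.ι (halfSq B) (A ξ) * s) (ξ : W) :
    s * CliffordAlgebra.ι (halfSq B) ξ =
      CliffordAlgebra.ι (halfSq B) (A ξ) * CliffordAlgebra.involute s := by
  have := congrArg CliffordAlgebra.involute (h ξ)
  simpa using this

theorem ι_injective_halfSq :
    Function.Injective (CliffordAlgebra.ι (halfSq B)) := fun x y h => by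
  have := congrArg (symbol B) h
  rw [symbol_ι, symbol_ι, ExteriorAlgebra.ι_inj] at this
  exact this

theorem isLift_unique {s : Pin B} {A A' : W → W}
    (h : IsLift B s A) (h' : IsLift B s A') : A = A' := by
  funext ξ
  exact ι_injective_halfSq ((h ξ).symm.trans (h' ξ))

/-- Induction over the Pin group by left multiplication with vectors. -/
theorem pin_induction {p : Cl B → Prop} (h1 : p 1)
    (hv : ∀ (v : W) (x : Cl B), B v v = 2 → p x → p (CliffordAlgebra.ι (halfSq B) v * x))
    (s : Pin B) : p ((s : (Cl B)ˣ) : Cl B) := by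
  obtain ⟨s, hs⟩ := s
  refine Subgroup.closure_induction_left (p := fun (s : (Cl B)ˣ) _ => p (s : Cl B)) ?_ ?_ ?_ hs
  · simpa using h1
  · rintro u ⟨v, hvv, huv⟩ y _ hy
    rw [Units.val_mul, huv]
    exact hv v _ hvv hy
  · rintro u ⟨v, hvv, huv⟩ y _ hy
    have : u⁻¹ = u := by
      rw [inv_eq_iff_mul_eq_one]
      ext
      rw [Units.val_mul, huv, ι_mul_self, hvv]
      simp
    rw [this, Units.val_mul, huv]
    exact hv v _ hvv hy

/-- The product of a vector of square length `2` with a lift of `A` lifts the composition of `A`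
with the reflection in that vector. -/
theorem involute_ι_mul_lift (hB : ∀ x y, B x y = B y x) {x : Cl B} {A : W →ₗ[ℝ] W} {v : W}
    (hv : B v v = 2)
    (hx : ∀ ξ, CliffordAlgebra.involute x * CliffordAlgebra.ι (halfSq B) ξ =
      CliffordAlgebra.ι (halfSq B) (A ξ) * x) (ξ : W) :
    CliffordAlgebra.involute (CliffordAlgebra.ι (halfSq B) v * x) *
        CliffordAlgebra.ι (halfSq B) ξ =
      CliffordAlgebra.ι (halfSq B) ((A - (B v ∘ₗ A).smulRight v) ξ) *
        (CliffordAlgebra.ι (halfSq B) v * x) := by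
  have hsq : CliffordAlgebra.ι (halfSq B) v * CliffordAlgebra.ι (halfSq B) v = 1 := by
    rw [ι_mul_self, hv]; simp
  rw [map_mul, CliffordAlgebra.involute_ι, mul_assoc, hx, ← mul_assoc, ← mul_assoc]
  congr 1
  have h := ι_mul_ι_add_swap hB v (A ξ)
  rw [LinearMap.sub_apply, LinearMap.smulRight_apply, map_sub, map_smul, sub_mul, smul_mul_assoc,
    hsq, neg_mul, eq_sub_of_add_eq h, Algebra.algebraMap_eq_smul_one]
  simp

/-- The product of lifts of `A₁` and `A₂` is a lift of `A₁ ⊕ A₂`. -/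
theorem lift_clInl_mul_clInr {W₁ W₂ : Type*} [AddCommGroup W₁] [Module ℝ W₁] [AddCommGroup W₂]
    [Module ℝ W₂] {B₁ : LinearMap.BilinForm ℝ W₁} {B₂ : LinearMap.BilinForm ℝ W₂}
    (h₁ : ∀ x y, B₁ x y = B₁ y x) (h₂ : ∀ x y, B₂ x y = B₂ y x)
    {s₁ : Cl B₁} {s₂ : Cl B₂} {A₁ : W₁ →ₗ[ℝ] W₁} {A₂ : W₂ →ₗ[ℝ] W₂}
    (hs₁ : ∀ ξ, CliffordAlgebra.involute s₁ * CliffordAlgebra.ι (halfSq B₁) ξ =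
      CliffordAlgebra.ι (halfSq B₁) (A₁ ξ) * s₁)
    (hs₂ : ∀ ξ, CliffordAlgebra.involute s₂ * CliffordAlgebra.ι (halfSq B₂) ξ =
      CliffordAlgebra.ι (halfSq B₂) (A₂ ξ) * s₂) (ξ : W₁ × W₂) :
    CliffordAlgebra.involute (clInl B₁ B₂ s₁ * clInr B₁ B₂ s₂) *
        CliffordAlgebra.ι (halfSq (sumForm B₁ B₂)) ξ =
      CliffordAlgebra.ι (halfSq (sumForm B₁ B₂)) (A₁.prodMap A₂ ξ) *
        (clInl B₁ B₂ s₁ * clInr B₁ B₂ s₂) := by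
  have hsplit : ∀ ζ : W₁ × W₂, CliffordAlgebra.ι (halfSq (sumForm B₁ B₂)) ζ =
      CliffordAlgebra.ι (halfSq (sumForm B₁ B₂)) (ζ.1, 0) +
        CliffordAlgebra.ι (halfSq (sumForm B₁ B₂)) (0, ζ.2) := fun ζ => by
    rw [← map_add]; simp
  rw [hsplit ξ, hsplit (A₁.prodMap A₂ ξ), mul_add, add_mul, map_mul, involute_clInl,
    involute_clInr]
  congr 1
  · rw [mul_assoc, ← ι_inl_mul_clInr h₁ h₂, ← mul_assoc, ← clInl_ι, ← map_mul, hs₁, map_mul,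
      clInl_ι, mul_assoc]
    rfl
  · rw [mul_assoc, ← clInr_ι, ← map_mul, hs₂, map_mul, clInr_ι, ← mul_assoc, ← mul_assoc,
      ι_inr_mul_clInl h₁ h₂]
    rfl

end Lift

/-! ### Contractions and Clifford multiplication -/

section ExpSubst

variable {V : Type*} [AddCommGroup V] [Module ℝ V] {W : Type*} [AddCommGroup W] [Module ℝ W]
  {B : LinearMap.BilinForm ℝ W}

/-- Sums of products of two contractions are nilpotent: they are the images of elements of `⋀² V`
under the action of `⋀ V` on forms. -/
theorem sum_contraction_pow [FiniteDimensional ℝ V] {d : ℕ} (n : ℕ)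
    (hn : Module.finrank ℝ V ≤ n) (c : ℝ) (x y : Fin d → V) :
    (c • ∑ i, contraction (x i) * contraction (y i) : Module.End ℝ (Forms V)) ^ (n + 1) = 0 := by
  have hc : ∀ v : V, (CliffordAlgebra.contractLeft ∘ₗ Module.Dual.eval ℝ V :
      V →ₗ[ℝ] Module.End ℝ (Forms V)) v *
      (CliffordAlgebra.contractLeft ∘ₗ Module.Dual.eval ℝ V :
      V →ₗ[ℝ] Module.End ℝ (Forms V)) v = 0 := fun v =>
    LinearMap.ext fun x => CliffordAlgebra.contractLeft_contractLeft _ x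
  let L := ExteriorAlgebra.lift ℝ ⟨_, hc⟩
  have hL : ∀ v, L (ExteriorAlgebra.ι ℝ v) = contraction v := fun v =>
    ExteriorAlgebra.lift_ι_apply _ _ _ _
  have : (c • ∑ i, contraction (x i) * contraction (y i) : Module.End ℝ (Forms V)) =
      L (c • ∑ i, ExteriorAlgebra.ι ℝ (x i) * ExteriorAlgebra.ι ℝ (y i)) := by
    simp [hL]
  rw [this, ← map_pow, two_form_pow_eq_zero _ hn, map_zero]
  exact Submodule.smul_mem _ _ (Submodule.sum_mem _ fun _ _ => ι_mul_ι_mem _ _)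

/-- The form `exp(Ω) ρ(σ(z))` on `V`, for a 2-form `Ω` and a substitution `ρ` of linear forms on `V`
for elements of `W`. -/
def expSubst (B : LinearMap.BilinForm ℝ W) (n : ℕ)
    (Ω : Forms V) (r : W →ₗ[ℝ] Module.Dual ℝ V) : Cl B →ₗ[ℝ] Forms V :=
  LinearMap.mulLeft ℝ (expUpTo n Ω) ∘ₗ (ExteriorAlgebra.map r).toLinearMap ∘ₗ
    (symbol B).toLinearMap

theorem expSubst_apply (n : ℕ) (Ω : Forms V) (r : W →ₗ[ℝ] Module.Dual ℝ V) (z : Cl B) :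
    expSubst B n Ω r z = expUpTo n Ω * ExteriorAlgebra.map r (symbol B z) := rfl

/-- Contractions with vectors satisfying the moment map condition correspond to the operators
`z ↦ A(ξ) z + α(z) ξ` on the Clifford algebra. -/
theorem contraction_expSubst [FiniteDimensional ℝ V] (hB : ∀ x y, B x y = B y x) {n : ℕ}
    (hn : Module.finrank ℝ V ≤ n) {Ω : Forms V} (hΩ : Ω ∈ ⋀[ℝ]^2 (Module.Dual ℝ V))
    (r : W →ₗ[ℝ] Module.Dual ℝ V) (ξ ξ' : W) (v : V)
    (h1 : contraction v Ω = ExteriorAlgebra.ι ℝ (r (ξ' + ξ)))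
    (h2 : ∀ ζ, r ζ v = (1 / 2) * B (ξ' - ξ) ζ) (z : Cl B) :
    contraction v (expSubst B n Ω r z) = expSubst B n Ω r
      (CliffordAlgebra.ι (halfSq B) ξ' * z +
        CliffordAlgebra.involute z * CliffordAlgebra.ι (halfSq B) ξ) := by
  have hn' : Module.finrank ℝ (Module.Dual ℝ V) ≤ n := by rwa [Subspace.dual_finrank_eq]
  have hd : Module.Dual.eval ℝ V v ∘ₗ r = (1 / 2 : ℝ) • B (ξ' - ξ) := by
    ext ζ; simp [h2]
  rw [contraction] at h1
  rw [contraction, expSubst_apply, expSubst_apply, contractLeft_expUpTo_mul hΩ hn', h1,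
    contractLeft_map, hd, map_add (symbol B), symbol_ι_mul hB, symbol_involute_mul_ι hB]
  have hc := (Commute.expUpTo_right (two_form_commute hΩ (ExteriorAlgebra.ι ℝ (r (ξ' + ξ)))).symm
    n).eq
  rw [hc, mul_assoc, ← mul_add]
  congr 1
  simp only [map_add, map_sub, map_smul, map_mul, ExteriorAlgebra.map_apply_ι, LinearMap.smul_apply,
    LinearMap.sub_apply]
  simp only [add_mul, smul_sub]
  abel

end ExpSubst

/-! ### The fusion formula in linear algebra -/

section Pointwise

variable {W : Type*} [AddCommGroup W] [Module ℝ W] [FiniteDimensional ℝ W]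
  {B : LinearMap.BilinForm ℝ W} {d : ℕ} {N : ℕ}

/-- Conjugation of the kernel for `A = id` by a lift of `A` gives the kernel for `A`. -/
theorem clInl_mul_fusionKernel_id (hB : ∀ x y, B x y = B y x) (e : Module.Basis (Fin d) ℝ W)
    (hN : Module.finrank ℝ (W × W) ≤ N) (s : Pin B) (A : W →ₗ[ℝ] W) (hs : IsLift B s A) :
    clInl B B ((s : (Cl B)ˣ) : Cl B) * fusionKernel B N e LinearMap.id =
      fusionKernel B N e A * clInl B B ((s : (Cl B)ˣ) : Cl B) := by
  obtain ⟨A', hA', h⟩ := pin_induction (p := fun s => ∃ A : W →ₗ[ℝ] W,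
    (∀ ξ, CliffordAlgebra.involute s * CliffordAlgebra.ι (halfSq B) ξ =
      CliffordAlgebra.ι (halfSq B) (A ξ) * s) ∧
    clInl B B s * fusionKernel B N e LinearMap.id = fusionKernel B N e A * clInl B B s)
    ⟨LinearMap.id, by simp, by simp⟩
    (by
      rintro v x hv ⟨A, hA, h⟩
      refine ⟨A - (B v ∘ₗ A).smulRight v, involute_ι_mul_lift hB hv hA, ?_⟩
      rw [map_mul, clInl_ι, mul_assoc, h, ← mul_assoc, ι_mul_fusionKernel hB e hN A v hv,
        mul_assoc]) s
  have : A = A' := by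
    have := isLift_unique hs (isLift_iff.mpr hA')
    exact DFunLike.coe_injective this
  rw [this, h]

variable {V : Type*} [AddCommGroup V] [Module ℝ V] [FiniteDimensional ℝ V]

/-- The exponential of the fusion operator, applied to the form of a lift of `A = (A₁, A₂)`, is the
form for the 2-form and the substitution after fusion. -/
theorem expUpTo_sum_contraction_expSubst (hB : ∀ x y, B x y = B y x)
    (e : Module.Basis (Fin d) ℝ W) (he : ∀ i j, B (e i) (e j) = if i = j then 1 else 0)
    {n : ℕ} (hn : Module.finrank ℝ V ≤ n) {Ω : Forms V} (hΩ : Ω ∈ ⋀[ℝ]^2 (Module.Dual ℝ V))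
    (r : W × W →ₗ[ℝ] Module.Dual ℝ V) (A₁ A₂ : W →ₗ[ℝ] W) (s₁ s₂ : Pin B)
    (hs₁ : IsLift B s₁ A₁) (hs₂ : IsLift B s₂ A₂) (gen : W × W → V)
    (h1 : ∀ ξ, contraction (gen ξ) Ω = ExteriorAlgebra.ι ℝ (r (A₁.prodMap A₂ ξ + ξ)))
    (h2 : ∀ ξ ζ, r ζ (gen ξ) = (1 / 2) * sumForm B B (A₁.prodMap A₂ ξ - ξ) ζ) :
    expUpTo n ((-(1 / 2) : ℝ) • ∑ i, contraction (gen (e i, 0)) * contraction (gen (0, e i)))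
        (expSubst (sumForm B B) n Ω r (clInl B B (s₁ : (Cl B)ˣ) * clInr B B (s₂ : (Cl B)ˣ))) =
      expSubst B n (Ω + ExteriorAlgebra.map r (fusionBivector e A₁))
        (r ∘ₗ LinearMap.id.prod (transposeBy B e A₁))
        ((s₁ * s₂ : Pin B) : (Cl B)ˣ) := by
  set N := Module.finrank ℝ (W × W) + n with hN
  have hNW : Module.finrank ℝ (W × W) ≤ N := by omega
  have hS := sumForm_symm hB hB
  set D : Module.End ℝ (Forms V) :=
    (-(1 / 2) : ℝ) • ∑ i, contraction (gen (e i, 0)) * contraction (gen (0, e i)) with hD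
  set u : Cl (sumForm B B) := clInl B B (s₁ : (Cl B)ˣ) * clInr B B (s₂ : (Cl B)ˣ) with hu
  have hDn : D ^ (n + 1) = 0 := sum_contraction_pow n hn _ _ _
  have hlift := lift_clInl_mul_clInr hB hB (isLift_iff.mp hs₁) (isLift_iff.mp hs₂)
  rw [← hu] at hlift
  have hstep : ∀ (w : Cl (sumForm B B)) (ξ : W × W),
      (∀ ζ, CliffordAlgebra.involute w * CliffordAlgebra.ι (halfSq (sumForm B B)) ζ =
        CliffordAlgebra.ι (halfSq (sumForm B B)) (A₁.prodMap A₂ ζ) * w) →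
      ∀ x, contraction (gen ξ) (expSubst (sumForm B B) n Ω r
        (w * (symbol (sumForm B B)).symm x)) =
        (2 : ℝ) • expSubst (sumForm B B) n Ω r (CliffordAlgebra.involute w *
          (symbol (sumForm B B)).symm (ExteriorAlgebra.ι ℝ ξ * x)) := by
    intro w ξ hw x
    rw [contraction_expSubst hS hn hΩ r ξ (A₁.prodMap A₂ ξ) _ (h1 ξ) (h2 ξ), ← mul_assoc, ← hw,
      map_mul, mul_assoc, mul_assoc, ← mul_add, ← map_smul]
    congr 1
    rw [← mul_smul_comm, ← map_smul (symbol (sumForm B B)).symm]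
    congr 1
    apply (symbol (sumForm B B)).injective
    rw [symbol_add_involute hS, LinearEquiv.apply_symm_apply, LinearEquiv.apply_symm_apply]
  have hDx : ∀ x, D (expSubst (sumForm B B) n Ω r (u * (symbol (sumForm B B)).symm x)) =
      expSubst (sumForm B B) n Ω r (u * (symbol (sumForm B B)).symm
        (fusionBivector e LinearMap.id * x)) := by
    intro x
    have hlift' := lift_involute hlift
    have hi : CliffordAlgebra.involute (CliffordAlgebra.involute u) = u :=
      CliffordAlgebra.involute_involute u
    rw [hD, LinearMap.smul_apply, LinearMap.sum_apply, fusionBivector, smul_mul_assoc,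
      Finset.sum_mul, map_smul, map_sum, mul_smul_comm, Finset.mul_sum, map_smul, map_sum,
      Finset.smul_sum, Finset.smul_sum]
    refine Finset.sum_congr rfl fun i _ => ?_
    rw [Module.End.mul_apply, hstep u _ hlift, map_smul, hstep _ _ (fun ζ => by
      rw [hi]; exact hlift' ζ), hi, ← mul_assoc (ExteriorAlgebra.ι ℝ ((e i, 0) : W × W)),
      smul_smul, smul_smul]
    norm_num
  have hDk : ∀ k : ℕ, (D ^ k) (expSubst (sumForm B B) n Ω r u) =
      expSubst (sumForm B B) n Ω r (u * (symbol (sumForm B B)).symm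
        (fusionBivector e LinearMap.id ^ k)) := by
    intro k
    induction k with
    | zero =>
      have : (symbol (sumForm B B)).symm 1 = 1 := by
        rw [LinearEquiv.symm_apply_eq, symbol_one]
      simp [this]
    | succ k ih => rw [pow_succ', Module.End.mul_apply, ih, hDx, ← pow_succ']
  have hexp : expUpTo n D (expSubst (sumForm B B) n Ω r u) =
      expSubst (sumForm B B) n Ω r (u * fusionKernel B N e LinearMap.id) := by
    rw [← expUpTo_of_le hDn (show n ≤ N by omega), fusionKernel]
    simp only [expUpTo, LinearMap.sum_apply, LinearMap.smul_apply, hDk, map_sum, map_smul,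
      Finset.mul_sum, mul_smul_comm]
  have hn' : Module.finrank ℝ (Module.Dual ℝ V) ≤ n := by rwa [Subspace.dual_finrank_eq]
  have hβ : ExteriorAlgebra.map r (fusionBivector e A₁) ∈ ⋀[ℝ]^2 (Module.Dual ℝ V) := by
    simp only [fusionBivector, map_smul, map_sum, map_mul, ExteriorAlgebra.map_apply_ι]
    exact Submodule.smul_mem _ _ (Submodule.sum_mem _ fun _ _ => ι_mul_ι_mem _ _)
  rw [hexp, hu, mul_assoc, clInr_mul_fusionKernel_id hB e he hNW, ← mul_assoc,
    clInl_mul_fusionKernel_id hB e hNW s₁ A₁ hs₁, mul_assoc, ← map_mul, expSubst_apply,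
    symbol_fusionKernel_mul hB e hNW, map_mul, map_expUpTo, ← mul_assoc, expSubst_apply,
    expUpTo_of_le (two_form_pow_eq_zero hβ hn') (show n ≤ N by omega),
    expUpTo_add (two_form_commute hΩ _) (two_form_pow_eq_zero hΩ hn')
      (two_form_pow_eq_zero hβ hn') (two_form_pow_eq_zero (add_mem hΩ hβ) hn')]
  congr 1
  rw [← ExteriorAlgebra.map_comp_map]
  rfl

end Pointwise

/-! ### Two-forms as elements of the exterior algebra -/

section TwoForms

theorem ι_eq_sum_coord {V : Type*} [AddCommGroup V] [Module ℝ V] [FiniteDimensional ℝ V]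
    (f : Module.Dual ℝ V) : ExteriorAlgebra.ι ℝ f =
    ∑ i, f (Module.finBasis ℝ V i) • ExteriorAlgebra.ι ℝ ((Module.finBasis ℝ V).coord i) := by
  simp_rw [← map_smul, ← map_sum]
  congr 1
  refine (Module.finBasis ℝ V).ext fun j => ?_
  simp

variable {V : Type*} [AddCommGroup V] [Module ℝ V] [TopologicalSpace V]

/-- The bilinear map underlying an alternating 2-form. -/
def twoFormBilin (w : V [⋀^Fin 2]→L[ℝ] ℝ) : V →ₗ[ℝ] V →ₗ[ℝ] ℝ :=
  have h1 : ∀ x y z : V, w ![x + y, z] = w ![x, z] + w ![y, z] := fun x y z =>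
    w.toAlternatingMap.map_vecCons_add ![z] x y
  have h2 : ∀ (c : ℝ) (x z : V), w ![c • x, z] = c • w ![x, z] := fun c x z =>
    w.toAlternatingMap.map_vecCons_smul ![z] c x
  have h3 : ∀ x y : V, w ![x, y] = -w ![y, x] := fun x y => by
    have := w.toAlternatingMap.map_swap ![x, y] (show (0 : Fin 2) ≠ 1 by decide)
    have hs : (![x, y] ∘ Equiv.swap (0 : Fin 2) 1) = ![y, x] := by
      ext i; fin_cases i <;> simp
    rw [hs] at this
    exact neg_eq_iff_eq_neg.mp this.symm
  LinearMap.mk₂ ℝ (fun x y => w ![x, y]) h1 h2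
    (fun x y z => by rw [h3, h1, h3 y, h3 z, neg_add, neg_neg, neg_neg])
    (fun c x y => by rw [h3, h2, h3 x, smul_neg])

theorem twoFormBilin_apply (w : V [⋀^Fin 2]→L[ℝ] ℝ) (x y : V) :
    twoFormBilin w x y = w ![x, y] := rfl

theorem twoFormBilin_swap (w : V [⋀^Fin 2]→L[ℝ] ℝ) (x y : V) :
    twoFormBilin w x y = -twoFormBilin w y x := by
  have h := (twoFormBilin w).map_add₂ x y (x + y)
  have h0 : ∀ z, twoFormBilin w z z = 0 := fun z =>
    w.map_eq_zero_of_eq ![z, z] (i := 0) (j := 1) (by simp) (by decide)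
  rw [h0, map_add, map_add, h0, h0] at h
  linarith

variable [FiniteDimensional ℝ V]

theorem ofTwoForm_mem (w : V [⋀^Fin 2]→L[ℝ] ℝ) :
    ofTwoForm w ∈ ⋀[ℝ]^2 (Module.Dual ℝ V) :=
  Submodule.smul_mem _ _ <| Submodule.sum_mem _ fun _ _ => Submodule.sum_mem _ fun _ _ =>
    Submodule.smul_mem _ _ (ι_mul_ι_mem _ _)

theorem ofTwoForm_sub [IsTopologicalAddGroup V] (w w' : V [⋀^Fin 2]→L[ℝ] ℝ) :
    ofTwoForm (w - w') = ofTwoForm w - ofTwoForm w' := by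
  simp only [ofTwoForm, ContinuousAlternatingMap.sub_apply, sub_smul, Finset.sum_sub_distrib,
    smul_sub]

theorem ofTwoForm_add (w w' : V [⋀^Fin 2]→L[ℝ] ℝ) :
    ofTwoForm (w + w') = ofTwoForm w + ofTwoForm w' := by
  simp only [ofTwoForm, ContinuousAlternatingMap.add_apply, add_smul, Finset.sum_add_distrib,
    smul_add]

theorem ofTwoForm_smul (c : ℝ) (w : V [⋀^Fin 2]→L[ℝ] ℝ) :
    ofTwoForm (c • w) = c • ofTwoForm w := by
  rw [ofTwoForm, ofTwoForm, smul_comm c]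
  simp only [Finset.smul_sum, smul_smul, ContinuousAlternatingMap.smul_apply, smul_eq_mul]

/-- A 2-form that is a sum of wedge products of linear forms. -/
theorem ofTwoForm_eq_sum {κ : Type*} (s : Finset κ) (w : V [⋀^Fin 2]→L[ℝ] ℝ)
    (f g : κ → Module.Dual ℝ V)
    (h : ∀ u v, w ![u, v] = ∑ k ∈ s, (f k u * g k v - f k v * g k u)) :
    ofTwoForm w = ∑ k ∈ s, ExteriorAlgebra.ι ℝ (f k) * ExteriorAlgebra.ι ℝ (g k) := by
  have key : ∀ f g : Module.Dual ℝ V, ∑ i, ∑ j, (f (Module.finBasis ℝ V i) *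
      g (Module.finBasis ℝ V j)) • (ExteriorAlgebra.ι ℝ ((Module.finBasis ℝ V).coord i) *
      ExteriorAlgebra.ι ℝ ((Module.finBasis ℝ V).coord j)) =
      ExteriorAlgebra.ι ℝ f * ExteriorAlgebra.ι ℝ g := by
    intro f g
    rw [ι_eq_sum_coord f, ι_eq_sum_coord g, Finset.sum_mul_sum]
    simp only [smul_mul_smul_comm]
  have hk : ∀ k, ExteriorAlgebra.ι ℝ (f k) * ExteriorAlgebra.ι ℝ (g k) = (1 / 2 : ℝ) •
      ∑ i, ∑ j, (f k (Module.finBasis ℝ V i) * g k (Module.finBasis ℝ V j) -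
        f k (Module.finBasis ℝ V j) * g k (Module.finBasis ℝ V i)) •
        (ExteriorAlgebra.ι ℝ ((Module.finBasis ℝ V).coord i) *
          ExteriorAlgebra.ι ℝ ((Module.finBasis ℝ V).coord j)) := by
    intro k
    simp only [sub_smul, Finset.sum_sub_distrib]
    rw [key]
    simp_rw [mul_comm (f k _) (g k _)]
    rw [key, eq_neg_of_add_eq_zero_left (ExteriorAlgebra.ι_add_mul_swap (g k) (f k))]
    module
  simp only [hk, ofTwoForm, h, Finset.sum_smul, ← Finset.smul_sum]
  congr 1
  rw [Finset.sum_comm' (t' := Finset.univ) (s' := fun _ => s) (by simp)]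
  refine Finset.sum_congr rfl fun i _ => ?_
  rw [Finset.sum_comm]

/-- The contraction of a 2-form with a vector, computed in the exterior algebra, is the linear form
obtained by inserting the vector. -/
theorem contraction_ofTwoForm (w : V [⋀^Fin 2]→L[ℝ] ℝ) (v : V) (f : Module.Dual ℝ V)
    (hf : ∀ u, w ![v, u] = f u) :
    contraction v (ofTwoForm w) = ExteriorAlgebra.ι ℝ f := by
  set b := Module.finBasis ℝ V with hb
  have hw : ofTwoForm w = (1 / 2 : ℝ) • ∑ i, ExteriorAlgebra.ι ℝ (b.coord i) *
      ExteriorAlgebra.ι ℝ (twoFormBilin w (b i)) := by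
    rw [ofTwoForm]
    congr 1
    refine Finset.sum_congr rfl fun i _ => ?_
    rw [ι_eq_sum_coord (twoFormBilin w (b i)), Finset.mul_sum]
    refine Finset.sum_congr rfl fun j _ => ?_
    rw [mul_smul_comm]
    rfl
  have h1 : ∑ i, b.coord i v • twoFormBilin w (b i) = f := by
    ext u
    rw [← hf, ← twoFormBilin_apply]
    have := congrArg (fun z => twoFormBilin w z u) (b.sum_repr v)
    simp only [map_sum, map_smul, LinearMap.sum_apply, LinearMap.smul_apply] at this
    simpa only [LinearMap.sum_apply, LinearMap.smul_apply, Module.Basis.coord_apply] using this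
  have h2 : ∑ i, twoFormBilin w (b i) v • b.coord i = -f := by
    refine b.ext fun j => ?_
    rw [LinearMap.neg_apply, ← hf, ← twoFormBilin_apply, twoFormBilin_swap, neg_neg]
    simp [Finsupp.single_apply]
  have hc : ∀ i, contraction v (ExteriorAlgebra.ι ℝ (b.coord i) *
      ExteriorAlgebra.ι ℝ (twoFormBilin w (b i))) = ExteriorAlgebra.ι ℝ
        (b.coord i v • twoFormBilin w (b i) - twoFormBilin w (b i) v • b.coord i) := by
    intro i
    rw [contraction, CliffordAlgebra.contractLeft_ι_mul, CliffordAlgebra.contractLeft_ι,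
      ← Algebra.commutes, ← Algebra.smul_def, map_sub, map_smul, map_smul]
    rfl
  rw [hw, map_smul, map_sum]
  simp only [hc]
  rw [← map_sum, Finset.sum_sub_distrib, h1, h2, ← map_smul]
  congr 1
  module

end TwoForms

/-! ### Homogeneous components of forms -/

section Degree

variable {V : Type*} [AddCommGroup V] [Module ℝ V]

/-- Contractions lower the degree. -/
theorem contraction_mem (v : V) {k : ℕ} {x : Forms V} (hx : x ∈ ⋀[ℝ]^(k + 1) (Module.Dual ℝ V)) :
    contraction v x ∈ ⋀[ℝ]^k (Module.Dual ℝ V) := by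
  induction k generalizing x with
  | zero =>
    rw [ExteriorAlgebra.exteriorPower, zero_add, pow_one] at hx
    obtain ⟨f, rfl⟩ := hx
    rw [contraction, CliffordAlgebra.contractLeft_ι, ExteriorAlgebra.exteriorPower, pow_zero]
    exact Submodule.mem_one.mpr ⟨_, rfl⟩
  | succ k ih =>
    rw [ExteriorAlgebra.exteriorPower, pow_succ'] at hx
    refine Submodule.mul_induction_on hx ?_ fun x y hx hy => ?_
    · rintro _ ⟨f, rfl⟩ y hy
      rw [contraction, CliffordAlgebra.contractLeft_ι_mul]
      refine sub_mem (Submodule.smul_mem _ _ hy) ?_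
      have := ih hy
      rw [ExteriorAlgebra.exteriorPower, pow_succ']
      exact Submodule.mul_mem_mul ⟨f, rfl⟩ this
    · rw [map_add]; exact add_mem hx hy

theorem degreePart_coe_of_mem {k : ℕ} {x : Forms V} (hx : x ∈ ⋀[ℝ]^k (Module.Dual ℝ V)) :
    (degreePart k x : Forms V) = x :=
  DirectSum.decompose_of_mem_same _ hx

theorem degreePart_of_mem_ne {k l : ℕ} {x : Forms V} (hx : x ∈ ⋀[ℝ]^l (Module.Dual ℝ V))
    (h : l ≠ k) : degreePart k x = 0 := by
  ext
  exact DirectSum.decompose_of_mem_ne _ hx h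

theorem degreePart_add (k : ℕ) (x y : Forms V) :
    degreePart k (x + y) = degreePart k x + degreePart k y := by
  simp [degreePart, DirectSum.decompose_add]

theorem degreePart_smul (k : ℕ) (c : ℝ) (x : Forms V) :
    degreePart k (c • x) = c • degreePart k x := by
  rw [degreePart, DirectSum.decompose_smul]; rfl

theorem degreePart_sum {κ : Type*} (k : ℕ) (s : Finset κ) (x : κ → Forms V) :
    degreePart k (∑ i ∈ s, x i) = ∑ i ∈ s, degreePart k (x i) := by
  classical
  induction s using Finset.induction_on with
  | empty => simp [degreePart]
  | insert a s ha ih => rw [Finset.sum_insert ha, Finset.sum_insert ha, degreePart_add, ih]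

/-- Induction on homogeneous components. -/
theorem forms_induction {p : Forms V → Prop} (x : Forms V)
    (hom : ∀ k, ∀ x ∈ ⋀[ℝ]^k (Module.Dual ℝ V), p x) (add : ∀ x y, p x → p y → p (x + y)) :
    p x :=
  DirectSum.Decomposition.inductionOn (fun i : ℕ => ⋀[ℝ]^i (Module.Dual ℝ V))
    (motive := p) (hom 0 0 (zero_mem _)) (fun {i} m => hom i m m.2) add x

variable [FiniteDimensional ℝ V]

/-- Contractions do not contribute to the part of top degree. -/
theorem degreePart_finrank_contraction (v : V) (x : Forms V) :
    degreePart (Module.finrank ℝ V) (contraction v x) = 0 := by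
  refine forms_induction (p := fun x => degreePart (Module.finrank ℝ V) (contraction v x) = 0) x
    (fun k x hx => ?_) fun x y hx hy => by
      rw [map_add, degreePart_add, hx, hy, add_zero]
  rcases k with _ | k
  · rw [ExteriorAlgebra.exteriorPower, pow_zero] at hx
    obtain ⟨r, rfl⟩ := Submodule.mem_one.mp hx
    rw [contraction, CliffordAlgebra.contractLeft_algebraMap]
    simp [degreePart]
  · by_cases hk : k = Module.finrank ℝ V
    · rw [exteriorPower_eq_bot (by rw [Subspace.dual_finrank_eq]; omega)] at hx
      rw [(Submodule.mem_bot ℝ).mp hx]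
      simp [degreePart]
    · exact degreePart_of_mem_ne (contraction_mem v hx) hk

/-- The exponential of a sum of products of contractions does not change the part of top degree. -/
theorem degreePart_finrank_expUpTo {d : ℕ} (n : ℕ) (c : ℝ) (x y : Fin d → V) (γ : Forms V) :
    degreePart (Module.finrank ℝ V)
      (expUpTo n (c • ∑ i, contraction (x i) * contraction (y i) : Module.End ℝ (Forms V)) γ) =
      degreePart (Module.finrank ℝ V) γ := by
  rw [expUpTo, LinearMap.sum_apply, degreePart_sum, Finset.sum_eq_single 0]
  · simp
  · intro k _ hk
    obtain ⟨k, rfl⟩ := Nat.exists_eq_succ_of_ne_zero hk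
    rw [pow_succ', LinearMap.smul_apply, Module.End.mul_apply, LinearMap.smul_apply,
      LinearMap.sum_apply, degreePart_smul, degreePart_smul, degreePart_sum]
    simp only [Module.End.mul_apply, degreePart_finrank_contraction, Finset.sum_const_zero,
      smul_zero]
  · simp

end Degree

/-! ### Differentials as maps of the model spaces -/

section ModelDeriv

variable {E : Type*} [NormedAddCommGroup E] [NormedSpace ℝ E] {H : Type*} [TopologicalSpace H]
  (I : ModelWithCorners ℝ E H) {N : Type*} [TopologicalSpace N] [ChartedSpace H N]
  {E' : Type*} [NormedAddCommGroup E'] [NormedSpace ℝ E'] {H' : Type*} [TopologicalSpace H']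
  (I' : ModelWithCorners ℝ E' H') {N' : Type*} [TopologicalSpace N'] [ChartedSpace H' N']
  {E'' : Type*} [NormedAddCommGroup E''] [NormedSpace ℝ E''] {H'' : Type*} [TopologicalSpace H'']
  (I'' : ModelWithCorners ℝ E'' H'') {N'' : Type*} [TopologicalSpace N''] [ChartedSpace H'' N'']

/-- The differential `mfderiv I I' f x`, as a map of the model vector spaces. Its type does not
depend on the base points. -/
def modelDeriv (f : N → N') (x : N) : E →L[ℝ] E' := mfderiv I I' f x

variable {I I' I''}

theorem modelDeriv_comp {g : N' → N''} {f : N → N'} {x : N} {y : N'} (hy : f x = y)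
    (hg : MDifferentiableAt I' I'' g y) (hf : MDifferentiableAt I I' f x) :
    modelDeriv I I'' (fun x => g (f x)) x =
      (modelDeriv I' I'' g y).comp (modelDeriv I I' f x) := by
  subst hy
  exact mfderiv_comp x hg hf

theorem modelDeriv_id (x : N) : modelDeriv I I (fun x : N => x) x = ContinuousLinearMap.id ℝ E :=
  mfderiv_id

theorem modelDeriv_const (y : N') (x : N) : modelDeriv I I' (fun _ : N => y) x = 0 :=
  mfderiv_const

theorem modelDeriv_prodMk {f : N → N'} {g : N → N''} {x : N} (hf : MDifferentiableAt I I' f x)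
    (hg : MDifferentiableAt I I'' g x) :
    modelDeriv I (I'.prod I'') (fun x => (f x, g x)) x =
      (modelDeriv I I' f x).prod (modelDeriv I I'' g x) :=
  mfderiv_prodMk hf hg

theorem modelDeriv_fst {p : N × N'} :
    modelDeriv (I.prod I') I Prod.fst p = ContinuousLinearMap.fst ℝ E E' := mfderiv_fst

theorem modelDeriv_snd {p : N × N'} :
    modelDeriv (I.prod I') I' Prod.snd p = ContinuousLinearMap.snd ℝ E E' := mfderiv_snd

theorem modelDeriv_prodMap {E₃ : Type*} [NormedAddCommGroup E₃] [NormedSpace ℝ E₃] {H₃ : Type*}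
    [TopologicalSpace H₃] {I₃ : ModelWithCorners ℝ E₃ H₃} {N₃ : Type*} [TopologicalSpace N₃]
    [ChartedSpace H₃ N₃] {f : N → N'} {g : N'' → N₃} {p : N × N''}
    (hf : MDifferentiableAt I I' f p.1) (hg : MDifferentiableAt I'' I₃ g p.2) :
    modelDeriv (I.prod I'') (I'.prod I₃) (Prod.map f g) p =
      (modelDeriv I I' f p.1).prodMap (modelDeriv I'' I₃ g p.2) :=
  mfderiv_prodMap hf hg

end ModelDeriv

/-! ### Maurer-Cartan forms and the adjoint action -/

section Lie

variable {E : Type*} [NormedAddCommGroup E] [NormedSpace ℝ E] {H : Type*} [TopologicalSpace H]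
  {I : ModelWithCorners ℝ E H} {G : Type*} [TopologicalSpace G] [ChartedSpace H G]
  {F : Type*} [NormedAddCommGroup F] [NormedSpace ℝ F] {K : Type*} [TopologicalSpace K]
  {J : ModelWithCorners ℝ F K} {M : Type*} [TopologicalSpace M] [ChartedSpace K M]

theorem mfderiv_fst_apply {Φ : M → G × G} {m : M} (hΦ : MDifferentiableAt J (I.prod I) Φ m)
    (v : TangentSpace J m) :
    (mfderiv J I (fun x => (Φ x).1) m v : E) = (mfderiv J (I.prod I) Φ m v : E × E).1 := by
  have := modelDeriv_comp (g := (Prod.fst : G × G → G)) rfl mdifferentiableAt_fst hΦ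
  rw [modelDeriv_fst] at this
  exact DFunLike.congr_fun this v

theorem mfderiv_snd_apply {Φ : M → G × G} {m : M} (hΦ : MDifferentiableAt J (I.prod I) Φ m)
    (v : TangentSpace J m) :
    (mfderiv J I (fun x => (Φ x).2) m v : E) = (mfderiv J (I.prod I) Φ m v : E × E).2 := by
  have := modelDeriv_comp (g := (Prod.snd : G × G → G)) rfl mdifferentiableAt_snd hΦ
  rw [modelDeriv_snd] at this
  exact DFunLike.congr_fun this v

variable [Group G] [LieGroup I ∞ G]

theorem mdifferentiableAt_mul' {f h : M → G} {m : M} (hf : MDifferentiableAt J I f m)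
    (hh : MDifferentiableAt J I h m) : MDifferentiableAt J I (fun x => f x * h x) m := by
  have : MDifferentiableAt (I.prod I) I (fun p : G × G => p.1 * p.2) (f m, h m) :=
    (contMDiff_mul I ∞).mdifferentiableAt (by simp)
  exact this.comp m (hf.prodMk hh)

/-- The product rule at a point where both factors are the identity. -/
theorem modelDeriv_mul {f h : M → G} {m : M} (hf : MDifferentiableAt J I f m)
    (hh : MDifferentiableAt J I h m) (hf1 : f m = 1) (hh1 : h m = 1) :
    modelDeriv J I (fun x => f x * h x) m = modelDeriv J I f m + modelDeriv J I h m := by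
  have hmul : MDifferentiableAt (I.prod I) I (fun p : G × G => p.1 * p.2) (1, 1) :=
    (contMDiff_mul I ∞).mdifferentiableAt (by simp)
  have h1 : modelDeriv (I.prod I) I (fun p : G × G => p.1 * p.2) (1, 1) =
      ContinuousLinearMap.fst ℝ E E + ContinuousLinearMap.snd ℝ E E := by
    refine (mfderiv_prod_eq_add_comp hmul).trans ?_
    have hl : modelDeriv I I (fun z : G => z * 1) 1 = ContinuousLinearMap.id ℝ E := by
      simp only [mul_one]; exact modelDeriv_id 1
    have hr : modelDeriv I I (fun z : G => 1 * z) 1 = ContinuousLinearMap.id ℝ E := by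
      simp only [one_mul]; exact modelDeriv_id 1
    congr 1
    · exact (congrArg (fun L : E →L[ℝ] E => L.comp (ContinuousLinearMap.fst ℝ E E)) hl).trans
        (ContinuousLinearMap.id_comp _)
    · exact (congrArg (fun L : E →L[ℝ] E => L.comp (ContinuousLinearMap.snd ℝ E E)) hr).trans
        (ContinuousLinearMap.id_comp _)
  rw [modelDeriv_comp (I' := I.prod I) (f := fun x => (f x, h x)) (y := ((1, 1) : G × G))
    (by simp [hf1, hh1]) hmul (hf.prodMk hh), h1, modelDeriv_prodMk hf hh]
  ext v
  simp

theorem modelDeriv_inv : modelDeriv I I (fun x : G => x⁻¹) 1 = -ContinuousLinearMap.id ℝ E := by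
  have h := modelDeriv_mul (I := I) (J := I) (f := fun x : G => x) (h := fun x : G => x⁻¹) (m := 1)
    mdifferentiableAt_id ((contMDiff_inv I ∞).mdifferentiableAt (by simp)) rfl inv_one
  simp only [mul_inv_cancel] at h
  rw [modelDeriv_const, modelDeriv_id] at h
  exact (neg_eq_of_add_eq_zero_right h.symm).symm

variable (I) in
theorem mdifferentiableAt_conj (g x : G) : MDifferentiableAt I I (fun x : G => g * x * g⁻¹) x :=
  mdifferentiableAt_mul' (mdifferentiableAt_mul' mdifferentiableAt_const mdifferentiableAt_id)
    mdifferentiableAt_const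

/-- The pull-back of the right Maurer-Cartan form is the differential of a right translate of the
map. -/
theorem thetaR_comp (Φ : M → G) (m : M) (hΦ : MDifferentiableAt J I Φ m) :
    ((thetaR I (Φ m)).comp (mfderiv J I Φ m) : F →L[ℝ] E) =
      modelDeriv J I (fun x => Φ x * (Φ m)⁻¹) m :=
  (modelDeriv_comp (g := fun x : G => x * (Φ m)⁻¹) rfl
    (mdifferentiableAt_mul' mdifferentiableAt_id mdifferentiableAt_const) hΦ).symm

/-- The chain rule for conjugations, at a point that is mapped to the identity. -/
theorem modelDeriv_conj {f : M → G} {m : M} (hf : MDifferentiableAt J I f m) (h1 : f m = 1)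
    (g : G) : modelDeriv J I (fun x => g * f x * g⁻¹) m =
      (modelDeriv I I (fun x => g * x * g⁻¹) 1).comp (modelDeriv J I f m) :=
  modelDeriv_comp (g := fun x : G => g * x * g⁻¹) h1 (mdifferentiableAt_conj I g 1) hf

theorem Ad_thetaL (g : G) (v : TangentSpace I g) : Ad I g (thetaL I g v) = thetaR I g v := by
  have h := modelDeriv_conj (J := I) (f := fun x : G => g⁻¹ * x) (m := g)
    (mdifferentiableAt_mul' mdifferentiableAt_const mdifferentiableAt_id) (inv_mul_cancel g) g
  simp only [mul_inv_cancel_left] at h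
  exact (DFunLike.congr_fun h v).symm

theorem Ad_mul (g h : G) (ξ : GroupLieAlgebra I G) : Ad I (g * h) ξ = Ad I g (Ad I h ξ) := by
  have := modelDeriv_conj (J := I) (f := fun x : G => h * x * h⁻¹) (m := 1)
    (mdifferentiableAt_conj I h 1) (by simp) g
  have h2 : (fun x : G => g * (h * x * h⁻¹) * g⁻¹) = fun x => g * h * x * (g * h)⁻¹ := by
    funext x; group
  rw [h2] at this
  exact DFunLike.congr_fun this ξ

/-- The right Maurer-Cartan form of a product of two maps. -/
theorem thetaR_mul (Φ₁ Φ₂ : M → G) (m : M) (h₁ : MDifferentiableAt J I Φ₁ m)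
    (h₂ : MDifferentiableAt J I Φ₂ m) (v : TangentSpace J m) :
    thetaR I (Φ₁ m * Φ₂ m) (mfderiv J I (fun x => Φ₁ x * Φ₂ x) m v) =
      thetaR I (Φ₁ m) (mfderiv J I Φ₁ m v) +
        Ad I (Φ₁ m) (thetaR I (Φ₂ m) (mfderiv J I Φ₂ m v)) := by
  have e0 := thetaR_comp (fun x => Φ₁ x * Φ₂ x) m (mdifferentiableAt_mul' h₁ h₂)
  have e1 := thetaR_comp Φ₁ m h₁
  have e2 := thetaR_comp Φ₂ m h₂
  have d1 : MDifferentiableAt J I (fun x => Φ₁ x * (Φ₁ m)⁻¹) m :=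
    mdifferentiableAt_mul' h₁ mdifferentiableAt_const
  have d2 : MDifferentiableAt J I (fun x => Φ₂ x * (Φ₂ m)⁻¹) m :=
    mdifferentiableAt_mul' h₂ mdifferentiableAt_const
  have e3 := modelDeriv_conj d2 (mul_inv_cancel _) (Φ₁ m)
  have e4 := modelDeriv_mul d1 (mdifferentiableAt_mul' (mdifferentiableAt_mul'
    (mdifferentiableAt_const (c := Φ₁ m)) d2) (mdifferentiableAt_const (c := (Φ₁ m)⁻¹)))
    (mul_inv_cancel _) (by simp)
  have h5 : (fun x => Φ₁ x * (Φ₁ m)⁻¹ * (Φ₁ m * (Φ₂ x * (Φ₂ m)⁻¹) * (Φ₁ m)⁻¹)) =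
      fun x => Φ₁ x * Φ₂ x * (Φ₁ m * Φ₂ m)⁻¹ := by
    funext x; group
  rw [h5, e3, ← e1, ← e2] at e4
  rw [← e0] at e4
  exact DFunLike.congr_fun e4 v

/-- The right Maurer-Cartan form on generating vector fields for the conjugation action. -/
theorem thetaR_genField (act : G →* Equiv.Perm M) (Φ : M → G)
    (hact : ContMDiff (I.prod J) J ∞ fun p : G × M => act p.1 p.2)
    (hΦ : ContMDiff J I ∞ Φ) (heq : ∀ g m, Φ (act g m) = g * Φ m * g⁻¹) (m : M)
    (ξ : GroupLieAlgebra I G) :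
    thetaR I (Φ m) (mfderiv J I Φ m (genField I J act ξ m)) = Ad I (Φ m) ξ - ξ := by
  have hR := thetaR_comp Φ m (hΦ.mdifferentiableAt (by simp))
  have hR' : MDifferentiableAt J I (fun x => Φ x * (Φ m)⁻¹) m :=
    mdifferentiableAt_mul' (hΦ.mdifferentiableAt (by simp)) mdifferentiableAt_const
  have ha : MDifferentiableAt I J (fun g : G => act g m) 1 := by
    have : MDifferentiableAt (I.prod J) J (fun p : G × M => act p.1 p.2) ((1, m) : G × M) :=
      hact.mdifferentiableAt (by simp)
    exact this.comp (1 : G) (mdifferentiableAt_id.prodMk mdifferentiableAt_const)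
  have h1 : modelDeriv I I (fun g => Φ (act g m) * (Φ m)⁻¹) 1 =
      (modelDeriv J I (fun x => Φ x * (Φ m)⁻¹) m).comp (modelDeriv I J (fun g => act g m) 1) :=
    modelDeriv_comp (by simp) hR' ha
  have h2 : (fun g => Φ (act g m) * (Φ m)⁻¹) = fun g => g * (Φ m * g⁻¹ * (Φ m)⁻¹) := by
    funext g; rw [heq]; group
  have hi : MDifferentiableAt I I (fun x : G => x⁻¹) 1 :=
    (contMDiff_inv I ∞).mdifferentiableAt (by simp)
  have h3 := modelDeriv_mul (J := I) (f := fun g : G => g) (h := fun g => Φ m * g⁻¹ * (Φ m)⁻¹)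
    (m := 1) mdifferentiableAt_id (mdifferentiableAt_mul' (mdifferentiableAt_mul'
      mdifferentiableAt_const hi) mdifferentiableAt_const) rfl (by simp)
  rw [modelDeriv_conj hi inv_one, modelDeriv_inv, modelDeriv_id, ← h2, h1, ← hR] at h3
  have h4 := DFunLike.congr_fun h3 ξ
  set w : TangentSpace J m := modelDeriv I J (fun g => act g m) 1 ξ with hw
  have h5 : thetaR I (Φ m) (mfderiv J I Φ m (-w)) = -thetaR I (Φ m) (mfderiv J I Φ m w) := by
    rw [map_neg, map_neg]
  have h6 : thetaR I (Φ m) (mfderiv J I Φ m w) = ξ + Ad I (Φ m) (-ξ) := h4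
  refine h5.trans ?_
  rw [h6, map_neg]
  abel

theorem Ad_prod (g : G × G) (ξ : GroupLieAlgebra (I.prod I) (G × G)) :
    Ad (I.prod I) g ξ = ((Ad I g.1 (ξ : E × E).1, Ad I g.2 (ξ : E × E).2) : E × E) :=
  DFunLike.congr_fun (modelDeriv_prodMap (p := ((1, 1) : G × G)) (f := fun x => g.1 * x * g.1⁻¹)
    (g := fun x => g.2 * x * g.2⁻¹) (mdifferentiableAt_conj I g.1 1)
    (mdifferentiableAt_conj I g.2 1)) ξ

theorem thetaR_prod (g : G × G) (v : TangentSpace (I.prod I) g) :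
    thetaR (I.prod I) g v = ((thetaR I g.1 (v : E × E).1, thetaR I g.2 (v : E × E).2) : E × E) :=
  DFunLike.congr_fun (modelDeriv_prodMap (p := g) (f := fun x => x * g.1⁻¹)
    (g := fun x => x * g.2⁻¹)
    (mdifferentiableAt_mul' (I := I) mdifferentiableAt_id mdifferentiableAt_const)
    (mdifferentiableAt_mul' (I := I) mdifferentiableAt_id mdifferentiableAt_const)) v

end Lie

/-! ### The fusion formula for the forms `Γ` -/

section Fusion

variable {E : Type*} [NormedAddCommGroup E] [NormedSpace ℝ E]
  {H : Type*} [TopologicalSpace H] {I : ModelWithCorners ℝ E H} {G : Type*} [TopologicalSpace G]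
  [ChartedSpace H G] [Group G]
  {F : Type*} [NormedAddCommGroup F] [NormedSpace ℝ F] {K : Type*}
  [TopologicalSpace K] {J : ModelWithCorners ℝ F K} {M : Type*} [TopologicalSpace M]
  [ChartedSpace K M]

variable (I) in
/-- The substitution `ξ ↦ ½ Φ^*θᴿ·ξ` of linear forms on `T_mM` for elements of the Lie algebra. -/
def momentSubst (B : LinearMap.BilinForm ℝ (GroupLieAlgebra I G)) (X : Triple G J M) (m : M) :
    GroupLieAlgebra I G →ₗ[ℝ] Module.Dual ℝ (TangentSpace J m) :=
  (1 / 2 : ℝ) • (LinearMap.lcomp ℝ ℝ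
      ((thetaR I (X.moment m)).comp (X.dMoment I m)).toLinearMap ∘ₗ B.flip)

theorem momentSubst_apply (B : LinearMap.BilinForm ℝ (GroupLieAlgebra I G)) (X : Triple G J M)
    (m : M) (ξ : GroupLieAlgebra I G) (v : TangentSpace J m) :
    momentSubst I B X m ξ v = (1 / 2) * B (thetaR I (X.moment m) (X.dMoment I m v)) ξ := rfl

theorem Gamma_eq_expSubst [FiniteDimensional ℝ F]
    (B : LinearMap.BilinForm ℝ (GroupLieAlgebra I G)) (X : Triple G J M) (m : M) (s : Cl B) :
    Gamma I B X m s =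
      expSubst B (Module.finrank ℝ F) (ofTwoForm (X.form m)) (momentSubst I B X m) s := rfl

variable (I) in
/-- The pointwise consequences of the axioms of a group valued Hamiltonian manifold that enter the
fusion formula: the moment map condition, and equivariance of the moment map. -/
structure MomentAt (B : LinearMap.BilinForm ℝ (GroupLieAlgebra I G)) (X : Triple G J M) (m : M) :
    Prop where
  mdiff_act : MDifferentiableAt I J (fun g : G => X.act g m) 1
  mdiff_moment : MDifferentiableAt J I X.moment m
  form_genField : ∀ ξ (v : TangentSpace J m), X.form m ![genField I J X.act ξ m, v] =
    momentSubst I B X m (Ad I (X.moment m) ξ + ξ) v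
  theta_genField : ∀ ξ, thetaR I (X.moment m) (X.dMoment I m (genField I J X.act ξ m)) =
    Ad I (X.moment m) ξ - ξ

theorem mdifferentiableAt_act {act : G →* Equiv.Perm M}
    (h : ContMDiff (I.prod J) J ∞ fun p : G × M => act p.1 p.2) (m : M) :
    MDifferentiableAt I J (fun g : G => act g m) 1 := by
  have : MDifferentiableAt (I.prod J) J (fun p : G × M => act p.1 p.2) ((1, m) : G × M) :=
    h.mdifferentiableAt (by simp)
  exact this.comp (1 : G) (mdifferentiableAt_id.prodMk mdifferentiableAt_const)

variable [LieGroup I ∞ G]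

theorem IsHamiltonian.momentAt {B : LinearMap.BilinForm ℝ (GroupLieAlgebra I G)}
    (hi : ∀ (g : G) x y, B (Ad I g x) (Ad I g y) = B x y)
    {X : Triple G J M} (hX : IsHamiltonian I B X) (m : M) : MomentAt I B X m where
  mdiff_act := mdifferentiableAt_act hX.smooth_act m
  mdiff_moment := hX.smooth_moment.mdifferentiableAt (by simp)
  form_genField ξ v := by
    rw [hX.moment_condition, momentSubst_apply, map_add, map_add, LinearMap.add_apply]
    congr 1
    rw [add_comm, ← Ad_thetaL, hi, Ad_thetaL, add_comm]
  theta_genField ξ := thetaR_genField X.act X.moment hX.smooth_act hX.smooth_moment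
    hX.moment_equivariant m ξ

omit [LieGroup I ∞ G] in
theorem squareForm_symm {B : LinearMap.BilinForm ℝ (GroupLieAlgebra I G)}
    (hs : ∀ x y, B x y = B y x) (x y) : squareForm I B x y = squareForm I B y x :=
  sumForm_symm hs hs x y

theorem squareForm_invariant {B : LinearMap.BilinForm ℝ (GroupLieAlgebra I G)}
    (hi : ∀ (g : G) x y, B (Ad I g x) (Ad I g y) = B x y) (g : G × G) (x y) :
    squareForm I B (Ad (I.prod I) g x) (Ad (I.prod I) g y) = squareForm I B x y := by
  rw [Ad_prod, Ad_prod]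
  exact congrArg₂ (· + ·) (hi _ _ _) (hi _ _ _)

omit [LieGroup I ∞ G] in
theorem genField_act₁ {X : Triple (G × G) J M} {m : M}
    (hX : MDifferentiableAt (I.prod I) J (fun g : G × G => X.act g m) 1)
    (ξ : GroupLieAlgebra I G) :
    genField I J X.act₁ ξ m = genField (I.prod I) J X.act ((ξ, 0) : E × E) m := by
  have h := modelDeriv_comp (f := fun g : G => ((g, 1) : G × G)) (x := (1 : G)) rfl hX
    (mdifferentiableAt_id.prodMk mdifferentiableAt_const)
  have h1 : modelDeriv I (I.prod I) (fun g : G => ((g, 1) : G × G)) 1 =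
      (ContinuousLinearMap.id ℝ E).prod 0 :=
    (modelDeriv_prodMk mdifferentiableAt_id mdifferentiableAt_const).trans
      (congrArg₂ ContinuousLinearMap.prod (modelDeriv_id (1 : G))
        (modelDeriv_const (1 : G) (1 : G)))
  rw [h1] at h
  exact congrArg Neg.neg (DFunLike.congr_fun h ξ)

omit [LieGroup I ∞ G] in
theorem genField_act₂ {X : Triple (G × G) J M} {m : M}
    (hX : MDifferentiableAt (I.prod I) J (fun g : G × G => X.act g m) 1)
    (ξ : GroupLieAlgebra I G) :
    genField I J X.act₂ ξ m = genField (I.prod I) J X.act ((0, ξ) : E × E) m := by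
  have h := modelDeriv_comp (f := fun g : G => ((1, g) : G × G)) (x := (1 : G)) rfl hX
    (mdifferentiableAt_const.prodMk mdifferentiableAt_id)
  have h1 : modelDeriv I (I.prod I) (fun g : G => ((1, g) : G × G)) 1 =
      ContinuousLinearMap.prod 0 (ContinuousLinearMap.id ℝ E) :=
    (modelDeriv_prodMk mdifferentiableAt_const mdifferentiableAt_id).trans
      (congrArg₂ ContinuousLinearMap.prod (modelDeriv_const (1 : G) (1 : G))
        (modelDeriv_id (1 : G)))
  rw [h1] at h
  exact congrArg Neg.neg (DFunLike.congr_fun h ξ)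

variable (I) in
/-- The substitution of linear forms on `T_mM` for elements of `𝔤 ⊕ 𝔤` for a `G × G`-manifold, in
terms of the two components of the moment map. -/
def squareSubst (B : LinearMap.BilinForm ℝ (GroupLieAlgebra I G)) (X : Triple (G × G) J M) (m : M) :
    GroupLieAlgebra I G × GroupLieAlgebra I G →ₗ[ℝ] Module.Dual ℝ (TangentSpace J m) :=
  (1 / 2 : ℝ) • LinearMap.coprod
    (LinearMap.lcomp ℝ ℝ ((thetaR I (X.moment m).1).comp
      (mfderiv J I (fun x => (X.moment x).1) m)).toLinearMap ∘ₗ B.flip)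
    (LinearMap.lcomp ℝ ℝ ((thetaR I (X.moment m).2).comp
      (mfderiv J I (fun x => (X.moment x).2) m)).toLinearMap ∘ₗ B.flip)

omit [LieGroup I ∞ G] in
theorem squareSubst_apply (B : LinearMap.BilinForm ℝ (GroupLieAlgebra I G))
    (X : Triple (G × G) J M) (m : M) (ζ : GroupLieAlgebra I G × GroupLieAlgebra I G)
    (v : TangentSpace J m) : squareSubst I B X m ζ v = (1 / 2) *
      (B (thetaR I (X.moment m).1 (mfderiv J I (fun x => (X.moment x).1) m v)) ζ.1 +
        B (thetaR I (X.moment m).2 (mfderiv J I (fun x => (X.moment x).2) m v)) ζ.2) := rfl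

theorem squareSubst_eq (B : LinearMap.BilinForm ℝ (GroupLieAlgebra I G)) {X : Triple (G × G) J M}
    {m : M} (hΦ : MDifferentiableAt J (I.prod I) X.moment m)
    (ζ : GroupLieAlgebra I G × GroupLieAlgebra I G) (v : TangentSpace J m) :
    squareSubst I B X m ζ v = (1 / 2) *
      squareForm I B (thetaR (I.prod I) (X.moment m) (X.dMoment (I.prod I) m v)) ζ := by
  rw [squareSubst_apply, thetaR_prod]
  congr 2
  · exact congrArg (fun z => B (thetaR I (X.moment m).1 z) ζ.1) (mfderiv_fst_apply hΦ v)
  · exact congrArg (fun z => B (thetaR I (X.moment m).2 z) ζ.2) (mfderiv_snd_apply hΦ v)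

/-- Transport of `expSubst` along an equality of types.  It is needed because the Lie algebra of
`G × G` is the product of Lie algebras only up to unfolding of tangent spaces. -/
theorem expSubst_congr.{u} {V : Type*} [AddCommGroup V] [Module ℝ V] {W₁ W₂ : Type u}
    {i₁ : AddCommGroup W₁} {i₂ : AddCommGroup W₂} {mo₁ : Module ℝ W₁} {mo₂ : Module ℝ W₂}
    {B₁ : LinearMap.BilinForm ℝ W₁} {B₂ : LinearMap.BilinForm ℝ W₂}
    (hW : W₁ = W₂) (hi : HEq i₁ i₂) (hm : HEq mo₁ mo₂) (hB : HEq B₁ B₂) (n : ℕ) (Ω : Forms V)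
    {r₁ : W₁ →ₗ[ℝ] Module.Dual ℝ V} {r₂ : W₂ →ₗ[ℝ] Module.Dual ℝ V} (hr : HEq r₁ r₂)
    {s₁ : Cl B₁} {s₂ : Cl B₂} (hs : HEq s₁ s₂) :
    expSubst B₁ n Ω r₁ s₁ = expSubst B₂ n Ω r₂ s₂ := by
  subst hW
  obtain rfl := eq_of_heq hi
  obtain rfl := eq_of_heq hm
  obtain rfl := eq_of_heq hB
  obtain rfl := eq_of_heq hr
  obtain rfl := eq_of_heq hs
  rfl

/-- The form `Γ` of a `G × G`-manifold in terms of the Clifford algebra of `𝔤 ⊕ 𝔤`. -/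
theorem Gamma_square [FiniteDimensional ℝ F] (B : LinearMap.BilinForm ℝ (GroupLieAlgebra I G))
    {X : Triple (G × G) J M} {m : M} (hΦ : MDifferentiableAt J (I.prod I) X.moment m)
    (s : Cl (sumForm B B)) :
    Gamma (I.prod I) (squareForm I B) X m s =
      expSubst (sumForm B B) (Module.finrank ℝ F) (ofTwoForm (X.form m))
        (squareSubst I B X m) s := by
  have hr : HEq (momentSubst (I.prod I) (squareForm I B) X m) (squareSubst I B X m) := by
    have : (momentSubst (I.prod I) (squareForm I B) X m :
      GroupLieAlgebra I G × GroupLieAlgebra I G →ₗ[ℝ] Module.Dual ℝ (TangentSpace J m)) =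
      squareSubst I B X m :=
     LinearMap.ext fun ζ => LinearMap.ext fun v => (squareSubst_eq B hΦ ζ v).symm
    exact heq_of_eq this
  refine (Gamma_eq_expSubst (I := I.prod I) (squareForm I B) X m s).trans ?_
  exact @expSubst_congr (TangentSpace J m) _ _ (GroupLieAlgebra (I.prod I) (G × G))
    (GroupLieAlgebra I G × GroupLieAlgebra I G) (instAddCommGroupTangentSpace (I.prod I) 1)
    Prod.instAddCommGroup (instModuleTangentSpace (I.prod I) 1) Prod.instModule (squareForm I B)
    (sumForm B B) rfl HEq.rfl HEq.rfl HEq.rfl _ _ _ _ hr s s HEq.rfl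

variable [FiniteDimensional ℝ E] [FiniteDimensional ℝ F]

/-- The change of the 2-form under fusion comes from the bivector `-2 ∑ᵢ (Ad_Φ₁ eᵢ)¹ ∧ eᵢ²`. -/
theorem ofTwoForm_fusion {B : LinearMap.BilinForm ℝ (GroupLieAlgebra I G)}
    (hi : ∀ (g : G) x y, B (Ad I g x) (Ad I g y) = B x y)
    {d : ℕ} (e : Module.Basis (Fin d) ℝ (GroupLieAlgebra I G))
    (he : ∀ i j, B (e i) (e j) = if i = j then 1 else 0) (X : Triple (G × G) J M) (m : M) :
    ofTwoForm ((X.fusion I B).form m) = ofTwoForm (X.form m) +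
      ExteriorAlgebra.map (squareSubst I B X m)
        (fusionBivector e (Ad I (X.moment m).1).toLinearMap) := by
  set α := (thetaL I (X.moment m).1).comp (mfderiv J I (fun x => (X.moment x).1) m) with hα
  set β := (thetaR I (X.moment m).2).comp (mfderiv J I (fun x => (X.moment x).2) m) with hβ
  have h1 : (X.fusion I B).form m = X.form m - (1 / 2 : ℝ) • wedgeDot B α β := rfl
  have h2 : ofTwoForm (wedgeDot B α β) = ∑ i,
      ExteriorAlgebra.ι ℝ ((2 : ℝ) • squareSubst I B X m (Ad I (X.moment m).1 (e i), 0)) *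
        ExteriorAlgebra.ι ℝ ((2 : ℝ) • squareSubst I B X m (0, e i)) := by
    refine ofTwoForm_eq_sum _ _ _ _ fun u v => ?_
    have hf : ∀ i u, ((2 : ℝ) • squareSubst I B X m (Ad I (X.moment m).1 (e i), 0)) u =
        B (α u) (e i) := by
      intro i u
      rw [LinearMap.smul_apply, squareSubst_apply, ← Ad_thetaL, hi]
      simp [hα]
    have hg : ∀ i u, ((2 : ℝ) • squareSubst I B X m (0, e i)) u = B (β u) (e i) := by
      intro i u
      rw [LinearMap.smul_apply, squareSubst_apply]
      simp [hβ]
    have hexp : ∀ x y, B x y = ∑ i, B x (e i) * B y (e i) := by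
      intro x y
      conv_lhs => rw [← sum_form_smul e he y]
      simp [mul_comm]
    simp only [hf, hg]
    rw [Finset.sum_sub_distrib, ← hexp, ← hexp]
    rfl
  rw [h1, ofTwoForm_sub, ofTwoForm_smul, h2, sub_eq_add_neg]
  congr 1
  simp only [fusionBivector, map_smul, map_sum, map_mul, ExteriorAlgebra.map_apply_ι,
    Finset.smul_sum, ← Finset.sum_neg_distrib, smul_mul_assoc, mul_smul_comm]
  refine Finset.sum_congr rfl fun i _ => ?_
  module

omit [FiniteDimensional ℝ F] in
/-- The substitution after fusion is the one before fusion, composed with `ξ ↦ (ξ, Ad_Φ₁ᵀ ξ)`. -/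
theorem momentSubst_fusion {B : LinearMap.BilinForm ℝ (GroupLieAlgebra I G)}
    (hs : ∀ x y, B x y = B y x)
    {d : ℕ} (e : Module.Basis (Fin d) ℝ (GroupLieAlgebra I G))
    (he : ∀ i j, B (e i) (e j) = if i = j then 1 else 0) {X : Triple (G × G) J M} {m : M}
    (hΦ : MDifferentiableAt J (I.prod I) X.moment m) :
    momentSubst I B (X.fusion I B) m =
      squareSubst I B X m ∘ₗ
        LinearMap.id.prod (transposeBy B e (Ad I (X.moment m).1).toLinearMap) := by
  ext ξ v
  have h := thetaR_mul (I := I) (fun x => (X.moment x).1) (fun x => (X.moment x).2) m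
    (mdifferentiableAt_fst.comp m hΦ) (mdifferentiableAt_snd.comp m hΦ) v
  have h1 : momentSubst I B (X.fusion I B) m ξ v = (1 / 2) * B
    (thetaR I ((X.moment m).1 * (X.moment m).2)
      (mfderiv J I (fun x => (X.moment x).1 * (X.moment x).2) m v)) ξ := rfl
  rw [h1, h, LinearMap.comp_apply, squareSubst_apply, map_add, LinearMap.add_apply]
  congr 2
  exact (form_transposeBy e hs he (Ad I (X.moment m).1).toLinearMap _ ξ).symm

/-- The fusion formula at a point, for lifts of `Ad_{Φ₁(m)}` and `Ad_{Φ₂(m)}`. -/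
theorem Gamma_fusion {B : LinearMap.BilinForm ℝ (GroupLieAlgebra I G)}
    (hs : ∀ x y, B x y = B y x) (hi : ∀ (g : G) x y, B (Ad I g x) (Ad I g y) = B x y)
    {d : ℕ} (e : Module.Basis (Fin d) ℝ (GroupLieAlgebra I G))
    (he : ∀ i j, B (e i) (e j) = if i = j then 1 else 0) {X : Triple (G × G) J M} {m : M}
    (hX : MomentAt (I.prod I) (squareForm I B) X m) (s₁ s₂ : Pin B)
    (h₁ : IsLift B s₁ (Ad I (X.moment m).1)) (h₂ : IsLift B s₂ (Ad I (X.moment m).2)) :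
    Gamma I B (X.fusion I B) m ((s₁ * s₂ : Pin B) : (Cl B)ˣ) =
      expUpTo (Module.finrank ℝ F) (fusionOperator I X e m)
        (Gamma (I.prod I) (squareForm I B) X m
          (clInl B B (s₁ : (Cl B)ˣ) * clInr B B (s₂ : (Cl B)ˣ))) := by
  have hAd : ∀ ξ : GroupLieAlgebra I G × GroupLieAlgebra I G,
      Ad (I.prod I) (X.moment m) ξ =
      ((Ad I (X.moment m).1).toLinearMap.prodMap (Ad I (X.moment m).2).toLinearMap) ξ :=
    fun ξ => Ad_prod _ _
  have h3 : ∀ (ξ : GroupLieAlgebra I G × GroupLieAlgebra I G) (v : TangentSpace J m),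
      X.form m ![genField (I.prod I) J X.act ξ m, v] = squareSubst I B X m
        ((Ad I (X.moment m).1).toLinearMap.prodMap (Ad I (X.moment m).2).toLinearMap ξ + ξ) v := by
    intro ξ v
    rw [← hAd, squareSubst_eq B hX.mdiff_moment]
    exact hX.form_genField ξ v
  have h4 : ∀ ξ ζ : GroupLieAlgebra I G × GroupLieAlgebra I G,
      squareSubst I B X m ζ (genField (I.prod I) J X.act ξ m) = (1 / 2) * sumForm B B
        ((Ad I (X.moment m).1).toLinearMap.prodMap (Ad I (X.moment m).2).toLinearMap ξ - ξ) ζ := by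
    intro ξ ζ
    rw [← hAd, squareSubst_eq B hX.mdiff_moment]
    exact congrArg (fun t => 1 / 2 * squareForm I B t ζ) (hX.theta_genField ξ)
  have key := expUpTo_sum_contraction_expSubst (V := TangentSpace J m) hs e he
    (n := Module.finrank ℝ F) (show Module.finrank ℝ (TangentSpace J m) ≤ _ from le_rfl)
    (ofTwoForm_mem (X.form m)) (squareSubst I B X m)
    (Ad I (X.moment m).1).toLinearMap (Ad I (X.moment m).2).toLinearMap s₁ s₂ h₁ h₂
    (fun ξ => genField (I.prod I) J X.act ξ m)
    (fun ξ => contraction_ofTwoForm _ _ _ (h3 ξ)) h4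
  have hop : fusionOperator I X e m = (-(1 / 2) : ℝ) • ∑ i,
      contraction (V := TangentSpace J m) (genField (I.prod I) J X.act ((e i, 0) : E × E) m) *
        contraction (V := TangentSpace J m)
          (genField (I.prod I) J X.act ((0, e i) : E × E) m) := by
    rw [fusionOperator]
    refine congrArg _ (Finset.sum_congr rfl fun i _ => ?_)
    rw [genField_act₁ hX.mdiff_act, genField_act₂ hX.mdiff_act]
  rw [Gamma_eq_expSubst, ofTwoForm_fusion hi e he X m,
    momentSubst_fusion hs e he hX.mdiff_moment, hop, Gamma_square B hX.mdiff_moment]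
  exact key.symm

omit [LieGroup I ∞ G] [FiniteDimensional ℝ E] in
/-- The exponential of the fusion operator does not change the part of top degree. -/
theorem degreePart_fusionOperator {X : Triple (G × G) J M} {d : ℕ}
    (e : Fin d → GroupLieAlgebra I G) (m : M) (γ : Forms (TangentSpace J m)) :
    degreePart (Module.finrank ℝ F)
      (expUpTo (Module.finrank ℝ F) (fusionOperator I X e m) γ) =
      degreePart (Module.finrank ℝ F) γ :=
  degreePart_finrank_expUpTo (V := TangentSpace J m) _ _ _ _ γ

end Fusion

/-! ### Uniqueness of lifts up to sign -/

section Uniqueness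

variable {W : Type*} [AddCommGroup W] [Module ℝ W]

instance finite_exteriorAlgebra [FiniteDimensional ℝ W] :
    FiniteDimensional ℝ (ExteriorAlgebra ℝ W) := by
  have h : (⨆ k : Fin (Module.finrank ℝ W + 1), ⋀[ℝ]^(k : ℕ) W) = ⊤ := by
    rw [eq_top_iff, ← (DirectSum.Decomposition.isInternal
      (fun i : ℕ => ⋀[ℝ]^i W)).submodule_iSup_eq_top]
    refine iSup_le fun k => ?_
    by_cases hk : k < Module.finrank ℝ W + 1
    · exact le_iSup (fun k : Fin (Module.finrank ℝ W + 1) => ⋀[ℝ]^(k : ℕ) W) ⟨k, hk⟩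
    · rw [exteriorPower_eq_bot (by omega)]
      exact bot_le
  refine ⟨?_⟩
  rw [← h]
  exact Submodule.fg_iSup _ fun k => Module.Finite.iff_fg.mp inferInstance

/-- The operator `∑ᵢ eᵢ ∧ ι(eᵢ*)` is multiplication by `k` in degree `k`. -/
theorem sum_ι_mul_contractLeft {d : ℕ} (e : Module.Basis (Fin d) ℝ W) {k : ℕ}
    {x : ExteriorAlgebra ℝ W} (hx : x ∈ ⋀[ℝ]^k W) :
    ∑ i, ExteriorAlgebra.ι ℝ (e i) * CliffordAlgebra.contractLeft (e.coord i) x = (k : ℝ) • x := by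
  induction k generalizing x with
  | zero =>
    rw [ExteriorAlgebra.exteriorPower, pow_zero] at hx
    obtain ⟨r, rfl⟩ := Submodule.mem_one.mp hx
    simp [CliffordAlgebra.contractLeft_algebraMap]
  | succ k ih =>
    rw [ExteriorAlgebra.exteriorPower, pow_succ'] at hx
    induction hx using Submodule.mul_induction_on' with
    | mem_mul_mem a ha y hy =>
      obtain ⟨w, rfl⟩ := ha
      have h1 : ∀ i, ExteriorAlgebra.ι ℝ (e i) * CliffordAlgebra.contractLeft (e.coord i)
          (ExteriorAlgebra.ι ℝ w * y) = (e.coord i w) • (ExteriorAlgebra.ι ℝ (e i) * y) +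
          ExteriorAlgebra.ι ℝ w * (ExteriorAlgebra.ι ℝ (e i) *
            CliffordAlgebra.contractLeft (e.coord i) y) := by
        intro i
        rw [show CliffordAlgebra.contractLeft (e.coord i) (ExteriorAlgebra.ι ℝ w * y) =
            e.coord i w • y -
              ExteriorAlgebra.ι ℝ w * CliffordAlgebra.contractLeft (e.coord i) y from
            CliffordAlgebra.contractLeft_ι_mul (e.coord i) w y, mul_sub, mul_smul_comm, ← mul_assoc,
          ← mul_assoc,
          eq_neg_of_add_eq_zero_left (ExteriorAlgebra.ι_add_mul_swap (R := ℝ) (e i) w)]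
        simp [sub_eq_add_neg]
      simp only [h1, Finset.sum_add_distrib, ← Finset.mul_sum, ih hy]
      have h2 : ∑ i, (e.coord i w) • (ExteriorAlgebra.ι ℝ (e i) * y) =
          ExteriorAlgebra.ι ℝ w * y := by
        conv_rhs => rw [← e.sum_repr w, map_sum, Finset.sum_mul]
        simp only [map_smul, smul_mul_assoc, Module.Basis.coord_apply]
      rw [h2, mul_smul_comm]
      push_cast
      module
    | add x hx y hy hx' hy' =>
      simp only [map_add, mul_add, Finset.sum_add_distrib, smul_add, hx', hy']

/-- An element annihilated by all contractions is a scalar. -/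
theorem eq_algebraMap_of_contractLeft_eq_zero [FiniteDimensional ℝ W] {x : ExteriorAlgebra ℝ W}
    (hx : ∀ d : Module.Dual ℝ W, CliffordAlgebra.contractLeft d x = 0) :
    ∃ r : ℝ, x = algebraMap ℝ _ r := by
  classical
  let e := Module.finBasis ℝ W
  let 𝒜 := fun i : ℕ => ⋀[ℝ]^i W
  have h0 : ∑ i, ExteriorAlgebra.ι ℝ (e i) * CliffordAlgebra.contractLeft (e.coord i) x = 0 := by
    simp [hx]
  have hdec := DirectSum.sum_support_decompose 𝒜 x
  have h1 : ∑ k ∈ (DirectSum.decompose 𝒜 x).support,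
      ((k : ℝ) • (DirectSum.decompose 𝒜 x k : ExteriorAlgebra ℝ W)) = 0 := by
    rw [← hdec] at h0
    simp only [map_sum, Finset.mul_sum] at h0
    rw [Finset.sum_comm] at h0
    rw [← h0]
    refine Finset.sum_congr rfl fun k _ => (sum_ι_mul_contractLeft e ?_).symm
    exact (DirectSum.decompose 𝒜 x k).2
  have h2 : ∀ j, j ≠ 0 → (DirectSum.decompose 𝒜 x j : ExteriorAlgebra ℝ W) = 0 := by
    intro j hj
    by_cases hs : j ∈ (DirectSum.decompose 𝒜 x).support
    · have h3 := congrArg (fun y => (DirectSum.decompose 𝒜 y j : ExteriorAlgebra ℝ W)) h1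
      simp only [DirectSum.decompose_sum, DirectSum.decompose_smul, DirectSum.decompose_coe,
        DirectSum.decompose_zero] at h3
      rw [DFinsupp.finsetSum_apply, Finset.sum_eq_single j] at h3
      · simpa [DirectSum.smul_apply, hj] using h3
      · intro k _ hk
        rw [DirectSum.smul_apply, DirectSum.of_eq_of_ne _ _ _ hk.symm, smul_zero]
      · exact fun h => absurd hs h
    · simpa using hs
  have h3 : x = DirectSum.decompose 𝒜 x 0 := by
    conv_lhs => rw [← hdec]
    rw [Finset.sum_eq_single 0 (fun k _ hk => h2 k hk)]
    intro h; simpa using h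
  have h4 : x ∈ 𝒜 0 := by rw [h3]; exact Submodule.coe_mem _
  simp only [𝒜, ExteriorAlgebra.exteriorPower, pow_zero] at h4
  obtain ⟨r, hr⟩ := Submodule.mem_one.mp h4
  exact ⟨r, hr.symm⟩

variable [FiniteDimensional ℝ W] {B : LinearMap.BilinForm ℝ W}

/-- Every linear form is represented by an inner product. -/
theorem exists_form_eq (hp : ∀ x, x ≠ 0 → 0 < B x x) (d : Module.Dual ℝ W) : ∃ a, B a = d := by
  have hinj : Function.Injective B := by
    rw [← LinearMap.ker_eq_bot, LinearMap.ker_eq_bot']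
    intro x hx
    by_contra h
    have := hp x h
    simp [hx] at this
  have : Function.Surjective B := by
    refine (LinearMap.injective_iff_surjective_of_finrank_eq_finrank ?_).mp hinj
    exact Subspace.dual_finrank_eq.symm
  exact this d

omit [FiniteDimensional ℝ W] in
theorem reverse_mul_self (s : Pin B) :
    CliffordAlgebra.reverse ((s : (Cl B)ˣ) : Cl B) * ((s : (Cl B)ˣ) : Cl B) = 1 := by
  refine pin_induction (p := fun x => CliffordAlgebra.reverse x * x = 1) (by simp) ?_ s
  intro v x hv hx
  have hsq : CliffordAlgebra.ι (halfSq B) v * CliffordAlgebra.ι (halfSq B) v = 1 := by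
    rw [ι_mul_self, hv]; simp
  rw [CliffordAlgebra.reverse.map_mul, CliffordAlgebra.reverse_ι, mul_assoc,
    ← mul_assoc (CliffordAlgebra.ι _ v), hsq, one_mul, hx]

/-- Lifts to the Pin group are unique up to sign. -/
theorem isLift_eq_or_eq_neg (hB : ∀ x y, B x y = B y x) (hp : ∀ x, x ≠ 0 → 0 < B x x)
    {s s' : Pin B} {A : W → W} (h : IsLift B s A) (h' : IsLift B s' A) :
    ((s' : (Cl B)ˣ) : Cl B) = ((s : (Cl B)ˣ) : Cl B) ∨
      ((s' : (Cl B)ˣ) : Cl B) = -((s : (Cl B)ˣ) : Cl B) := by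
  rw [isLift_iff] at h h'
  -- The quotient `c` of the lifts lifts the identity, so that its symbol is annihilated by all
  -- contractions.  It is thus a scalar, of square `1` because of `reverse_mul_self`.
  set c : Pin B := s⁻¹ * s' with hc
  have hs' : ((s' : (Cl B)ˣ) : Cl B) = ((s : (Cl B)ˣ) : Cl B) * ((c : (Cl B)ˣ) : Cl B) := by
    rw [← Units.val_mul, ← Subgroup.coe_mul, hc, mul_inv_cancel_left]
  have hcomm : ∀ ξ, CliffordAlgebra.involute ((c : (Cl B)ˣ) : Cl B) *
      CliffordAlgebra.ι (halfSq B) ξ = CliffordAlgebra.ι (halfSq B) ξ * ((c : (Cl B)ˣ) : Cl B) := by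
    intro ξ
    have h1 := h' ξ
    rw [hs', map_mul, mul_assoc, ← mul_assoc _ _ ((c : (Cl B)ˣ) : Cl B), ← h, mul_assoc] at h1
    exact ((Units.map (CliffordAlgebra.involute : Cl B →ₐ[ℝ] Cl B).toRingHom.toMonoidHom
      (s : (Cl B)ˣ)).isUnit.mul_right_inj).mp h1
  obtain ⟨r, hr⟩ := eq_algebraMap_of_contractLeft_eq_zero (x := symbol B ((c : (Cl B)ˣ) : Cl B))
    (fun d => by
      obtain ⟨a, rfl⟩ := exists_form_eq hp d
      have h1 := congrArg (symbol B) (hcomm a)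
      rw [symbol_ι_mul hB, symbol_involute_mul_ι hB, sub_eq_add_neg, add_right_inj,
        neg_eq_iff_add_eq_zero, ← add_smul] at h1
      simpa using h1)
  have hcr : ((c : (Cl B)ˣ) : Cl B) = algebraMap ℝ _ r :=
    (symbol B).injective (by rw [hr, symbol_algebraMap])
  have h1 := reverse_mul_self c
  rw [hcr, CliffordAlgebra.reverse.commutes, ← map_mul] at h1
  have h2 : r * r = 1 := by
    have := congrArg (symbol B) h1
    rw [symbol_algebraMap, symbol_one, ← map_one (algebraMap ℝ (ExteriorAlgebra ℝ W))] at this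
    exact ExteriorAlgebra.algebraMap_leftInverse W |>.injective this
  rw [hs', hcr]
  rcases mul_self_eq_one_iff.mp h2 with rfl | rfl
  · left; simp
  · right; simp

end Uniqueness

/-! ### Measurable lifts to the Pin group -/

section Existence

/-- A map into a vector space is weakly measurable if all its coordinates are measurable. -/
def WeakMeasurable {Y V : Type*} [MeasurableSpace Y] [AddCommGroup V] [Module ℝ V]
    (f : Y → V) : Prop :=
  ∀ l : Module.Dual ℝ V, Measurable fun y => l (f y)

namespace WeakMeasurable

variable {Y V V' : Type*} [MeasurableSpace Y] [AddCommGroup V] [Module ℝ V] [AddCommGroup V']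
  [Module ℝ V'] {f g : Y → V}

theorem const (v : V) : WeakMeasurable fun _ : Y => v := fun _ => measurable_const

theorem add (hf : WeakMeasurable f) (hg : WeakMeasurable g) :
    WeakMeasurable fun y => f y + g y := fun l => by
  simp only [map_add]
  exact (hf l).add (hg l)

theorem neg (hf : WeakMeasurable f) : WeakMeasurable fun y => -f y := fun l => by
  simp only [map_neg]
  exact (hf l).neg

theorem sub (hf : WeakMeasurable f) (hg : WeakMeasurable g) :
    WeakMeasurable fun y => f y - g y := by
  simpa only [sub_eq_add_neg] using hf.add hg.neg

theorem smul {c : Y → ℝ} (hc : Measurable c) (hf : WeakMeasurable f) :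
    WeakMeasurable fun y => c y • f y := fun l => by
  simp only [map_smul, smul_eq_mul]
  exact hc.mul (hf l)

theorem sum {ι : Type*} (s : Finset ι) {f : ι → Y → V} (hf : ∀ i ∈ s, WeakMeasurable (f i)) :
    WeakMeasurable fun y => ∑ i ∈ s, f i y := fun l => by
  simp only [map_sum]
  exact Finset.measurable_sum _ fun i hi => hf i hi l

theorem map (hf : WeakMeasurable f) (L : V →ₗ[ℝ] V') : WeakMeasurable fun y => L (f y) :=
  fun l => hf (l ∘ₗ L)

theorem ite {p : Y → Prop} [DecidablePred p] (hp : MeasurableSet {y | p y})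
    (hf : WeakMeasurable f) (hg : WeakMeasurable g) :
    WeakMeasurable fun y => if p y then f y else g y := fun l => by
  have : (fun y => l (if p y then f y else g y)) = fun y => if p y then l (f y) else l (g y) := by
    funext y; split_ifs <;> rfl
  rw [this]
  exact Measurable.ite hp (hf l) (hg l)

/-- Families of linear maps that are weakly measurable pointwise can be applied to weakly
measurable families in a finite-dimensional space. -/
theorem apply [FiniteDimensional ℝ V] {L : Y → V →ₗ[ℝ] V'}
    (hL : ∀ v, WeakMeasurable fun y => L y v) (hf : WeakMeasurable f) :
    WeakMeasurable fun y => L y (f y) := by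
  have h : (fun y => L y (f y)) = fun y => ∑ i, (Module.finBasis ℝ V).coord i (f y) •
      L y (Module.finBasis ℝ V i) := by
    funext y
    conv_lhs => rw [← (Module.finBasis ℝ V).sum_repr (f y), map_sum]
    simp only [map_smul, Module.Basis.coord_apply]
  rw [h]
  exact sum _ fun i _ => smul (hf _) (hL _)

theorem of_dual [FiniteDimensional ℝ V] {f : Y → Module.Dual ℝ V}
    (hf : ∀ v, Measurable fun y => f y v) : WeakMeasurable f := fun l => by
  obtain ⟨v, rfl⟩ := (Module.evalEquiv ℝ V).surjective l
  exact hf v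

end WeakMeasurable

variable {W : Type*} [AddCommGroup W] [Module ℝ W] [FiniteDimensional ℝ W]
  {B : LinearMap.BilinForm ℝ W} {Y : Type*} [MeasurableSpace Y]

theorem WeakMeasurable.form {f g : Y → W} (hf : WeakMeasurable f) (hg : WeakMeasurable g) :
    Measurable fun y => B (f y) (g y) :=
  (hg.apply (L := fun y => B (f y)) fun v => hf.map (B.flip v)) LinearMap.id

omit [FiniteDimensional ℝ W] in
/-- Vectors of square length `2` belong to the Pin group. -/
theorem mem_pin_of_form_eq_two {v : W} (hv : B v v = 2) :
    ∃ p : Pin B, ((p : (Cl B)ˣ) : Cl B) = CliffordAlgebra.ι (halfSq B) v := by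
  have hsq : CliffordAlgebra.ι (halfSq B) v * CliffordAlgebra.ι (halfSq B) v = 1 := by
    rw [ι_mul_self, hv]; simp
  exact ⟨⟨⟨_, _, hsq, hsq⟩, Subgroup.subset_closure ⟨v, hv, rfl⟩⟩, rfl⟩

/-- The Cartan-Dieudonné theorem with parameters: a weakly measurable family of isometries has a
weakly measurable family of lifts to the Pin group.  A basis vector `w` that is not fixed by `A` is
moved back to its place by the reflection in `A w - w`, which preserves all fixed vectors. -/
theorem exists_weakMeasurable_lift (hB : ∀ x y, B x y = B y x) (hp : ∀ x, x ≠ 0 → 0 < B x x)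
    (A : Y → W →ₗ[ℝ] W) (hA : ∀ w, WeakMeasurable fun y => A y w)
    (hi : ∀ y v w, B (A y v) (A y w) = B v w) :
    ∃ s : Y → Cl B, WeakMeasurable s ∧
      ∀ y, ∃ p : Pin B, ((p : (Cl B)ˣ) : Cl B) = s y ∧ IsLift B p (A y) := by
  classical
  let e := Module.finBasis ℝ W
  -- Induction on a set of basis vectors outside of which all basis vectors are fixed.
  suffices H : ∀ S : Finset (Fin (Module.finrank ℝ W)), ∀ (A : Y → W →ₗ[ℝ] W),
      (∀ w, WeakMeasurable fun y => A y w) → (∀ y v w, B (A y v) (A y w) = B v w) →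
      (∀ i ∉ S, ∀ y, A y (e i) = e i) → ∃ s : Y → Cl B, WeakMeasurable s ∧
      ∀ y, ∃ p : Pin B, ((p : (Cl B)ˣ) : Cl B) = s y ∧ IsLift B p (A y) from
    H Finset.univ A hA hi (by simp)
  intro S
  induction S using Finset.induction_on with
  | empty =>
    intro A _ _ hfix
    refine ⟨fun _ => 1, WeakMeasurable.const 1, fun y => ⟨1, rfl, ?_⟩⟩
    have : A y = LinearMap.id := e.ext fun i => hfix i (by simp) y
    rw [isLift_iff, this]
    simp
  | insert i S _ ih =>
    intro A hA hi hfix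
    -- Where `u = 0` there is nothing to do.  Elsewhere `v` is the multiple of `u` of square
    -- length `2`.
    set u : Y → W := fun y => A y (e i) - e i with hu
    have hum : WeakMeasurable u := (hA _).sub (WeakMeasurable.const _)
    have hq : Measurable fun y => B (u y) (u y) := hum.form hum
    set v : Y → W := fun y => √(2 / B (u y) (u y)) • u y with hv
    have hvm : WeakMeasurable v := WeakMeasurable.smul (hq.const_div 2).sqrt hum
    have hu2 : ∀ y, B (u y) (u y) = -2 * B (u y) (e i) := by
      intro y
      simp only [hu, map_sub, LinearMap.sub_apply, hi, hB (e i) (A y (e i))]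
      ring
    have hv2 : ∀ y, u y ≠ 0 → B (v y) (v y) = 2 := by
      intro y hy
      have h := hp _ hy
      simp only [hv, map_smul, LinearMap.smul_apply, smul_eq_mul]
      rw [← mul_assoc, Real.mul_self_sqrt (by positivity)]
      field_simp
    have hrefl : ∀ y w, u y ≠ 0 → B (v y) w • v y = (2 / B (u y) (u y) * B (u y) w) • u y := by
      intro y w hy
      have h := hp _ hy
      simp only [hv, map_smul, LinearMap.smul_apply, smul_eq_mul, smul_smul]
      rw [mul_right_comm, Real.mul_self_sqrt (by positivity)]
    set A' : Y → W →ₗ[ℝ] W := fun y => A y - (B (v y) ∘ₗ A y).smulRight (v y) with hA'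
    have hA'v : ∀ y w, A' y w = A y w - B (v y) (A y w) • v y := fun y w => rfl
    have hv0 : ∀ y, u y = 0 → v y = 0 := fun y hy => by simp [hv, hy]
    obtain ⟨t, htm, ht⟩ := ih A' (fun w => by
        simp only [hA'v]
        exact (hA w).sub (WeakMeasurable.smul (hvm.form (hA w)) hvm))
      (by
        intro y x w
        by_cases hy : u y = 0
        · simp only [hA'v, hv0 y hy, smul_zero, sub_zero, hi]
        · simp only [hA'v, map_sub, LinearMap.sub_apply, map_smul, LinearMap.smul_apply, hi,
            smul_eq_mul, hv2 y hy, hB (A y x) (v y)]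
          ring)
      (by
        intro j hj y
        by_cases hy : u y = 0
        · have h1 : A y (e i) = e i := sub_eq_zero.mp hy
          rw [hA'v, hv0 y hy, smul_zero, sub_zero]
          by_cases hji : j = i
          · rw [hji, h1]
          · exact hfix j (by simp [hji, hj]) y
        · rw [hA'v, hrefl y _ hy]
          have h := hp _ hy
          by_cases hji : j = i
          · have h1 : 2 / B (u y) (u y) * B (u y) (A y (e i)) = 1 := by
              have h2 : B (u y) (A y (e i)) = B (u y) (u y) + B (u y) (e i) := by
                rw [← map_add]; simp [hu]
              have h3 := hu2 y
              rw [h2]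
              field_simp
              linarith
            rw [hji, h1, one_smul]
            simp [hu]
          · have h1 : B (u y) (A y (e j)) = 0 := by
              simp only [hu, map_sub, LinearMap.sub_apply, hi]
              rw [hfix j (by simp [hji, hj]) y, sub_self]
            rw [h1, mul_zero, zero_smul, sub_zero]
            exact hfix j (by simp [hji, hj]) y)
    refine ⟨fun y => if B (u y) (u y) = 0 then t y else CliffordAlgebra.ι (halfSq B) (v y) * t y,
      WeakMeasurable.ite (hq (measurableSet_singleton 0)) htm ?_, fun y => ?_⟩
    · have h : (fun y => CliffordAlgebra.ι (halfSq B) (v y) * t y) = fun y =>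
          ∑ j, e.coord j (v y) •
            (LinearMap.mulLeft ℝ (CliffordAlgebra.ι (halfSq B) (e j))) (t y) := by
        funext y
        conv_lhs => rw [← e.sum_repr (v y), map_sum, Finset.sum_mul]
        simp only [map_smul, smul_mul_assoc, Module.Basis.coord_apply, LinearMap.mulLeft_apply]
      rw [h]
      exact WeakMeasurable.sum _ fun j _ => WeakMeasurable.smul (hvm _) (htm.map _)
    · obtain ⟨p, hpt, hpl⟩ := ht y
      by_cases hy : u y = 0
      · refine ⟨p, by simp [hpt, hy], ?_⟩
        have : A' y = A y := by ext w; simp [hA'v, hv0 y hy]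
        rwa [this] at hpl
      · obtain ⟨q, hq⟩ := mem_pin_of_form_eq_two (hv2 y hy)
        have hne : B (u y) (u y) ≠ 0 := (hp _ hy).ne'
        refine ⟨q * p, by simp [hpt, hq, hne], isLift_iff.mpr fun ξ => ?_⟩
        have h1 := involute_ι_mul_lift hB (hv2 y hy) (A := A' y) (isLift_iff.mp hpl) ξ
        rw [Subgroup.coe_mul, Units.val_mul, hq, h1]
        congr 2
        simp only [LinearMap.sub_apply, LinearMap.smulRight_apply, LinearMap.comp_apply, hA'v,
          map_sub, map_smul, smul_eq_mul, hv2 y hy]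
        module

/-- The chosen lift of an isometry is a lift. -/
theorem isLift_someLift (hB : ∀ x y, B x y = B y x) (hp : ∀ x, x ≠ 0 → 0 < B x x)
    (A : W →ₗ[ℝ] W) (hi : ∀ v w, B (A v) (A w) = B v w) : IsLift B (someLift B A) A := by
  obtain ⟨s, -, hs⟩ := exists_weakMeasurable_lift (Y := Unit) hB hp (fun _ => A)
    (fun _ => WeakMeasurable.const _) (fun _ => hi)
  obtain ⟨p, -, h⟩ := hs ()
  exact Classical.epsilon_spec (p := fun s => IsLift B s A) ⟨p, h⟩

end Existence

/-! ### Products of lifts, orthonormal bases -/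

section PinLift

/-- `z ∈ Cl(W)` lies in the Pin group and lifts `A`. -/
def IsPinLift {W : Type*} [AddCommGroup W] [Module ℝ W] (B : LinearMap.BilinForm ℝ W) (z : Cl B)
    (A : W → W) : Prop :=
  ∃ p : Pin B, ((p : (Cl B)ˣ) : Cl B) = z ∧ IsLift B p A

/-- Transport of `IsPinLift` along an equality of types. -/
theorem IsPinLift.congr.{u} {W₁ W₂ : Type u}
    {i₁ : AddCommGroup W₁} {i₂ : AddCommGroup W₂} {mo₁ : Module ℝ W₁} {mo₂ : Module ℝ W₂}
    {B₁ : LinearMap.BilinForm ℝ W₁} {B₂ : LinearMap.BilinForm ℝ W₂}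
    (hW : W₁ = W₂) (hi : HEq i₁ i₂) (hm : HEq mo₁ mo₂) (hB : HEq B₁ B₂)
    {z₁ : Cl B₁} {z₂ : Cl B₂} (hz : HEq z₁ z₂) {A₁ : W₁ → W₁} {A₂ : W₂ → W₂} (hA : HEq A₁ A₂)
    (h : IsPinLift B₁ z₁ A₁) : IsPinLift B₂ z₂ A₂ := by
  subst hW
  obtain rfl := eq_of_heq hi
  obtain rfl := eq_of_heq hm
  obtain rfl := eq_of_heq hB
  obtain rfl := eq_of_heq hz
  obtain rfl := eq_of_heq hA
  exact h

variable {W₁ W₂ : Type*} [AddCommGroup W₁] [Module ℝ W₁] [AddCommGroup W₂]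
    [Module ℝ W₂] {B₁ : LinearMap.BilinForm ℝ W₁} {B₂ : LinearMap.BilinForm ℝ W₂}

theorem IsPinLift.clInl_mul_clInr (h₁ : ∀ x y, B₁ x y = B₁ y x) (h₂ : ∀ x y, B₂ x y = B₂ y x)
    {z₁ : Cl B₁} {z₂ : Cl B₂} {A₁ : W₁ →ₗ[ℝ] W₁} {A₂ : W₂ →ₗ[ℝ] W₂}
    (hz₁ : IsPinLift B₁ z₁ A₁) (hz₂ : IsPinLift B₂ z₂ A₂) :
    IsPinLift (sumForm B₁ B₂) (clInl B₁ B₂ z₁ * clInr B₁ B₂ z₂) (A₁.prodMap A₂) := by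
  obtain ⟨p₁, rfl, hp₁⟩ := hz₁
  obtain ⟨p₂, rfl, hp₂⟩ := hz₂
  have hl : ∃ q : Pin (sumForm B₁ B₂), ((q : (Cl (sumForm B₁ B₂))ˣ) : Cl (sumForm B₁ B₂)) =
      clInl B₁ B₂ (p₁ : (Cl B₁)ˣ) := by
    refine pin_induction (p := fun x => ∃ q : Pin (sumForm B₁ B₂),
      ((q : (Cl (sumForm B₁ B₂))ˣ) : Cl (sumForm B₁ B₂)) = clInl B₁ B₂ x) ⟨1, by simp⟩ ?_ p₁
    rintro v x hv ⟨q, hq⟩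
    obtain ⟨r, hr⟩ := mem_pin_of_form_eq_two (B := sumForm B₁ B₂) (v := (v, 0)) (by simp [hv])
    exact ⟨r * q, by rw [Subgroup.coe_mul, Units.val_mul, hr, hq, map_mul, clInl_ι]⟩
  have hr : ∃ q : Pin (sumForm B₁ B₂), ((q : (Cl (sumForm B₁ B₂))ˣ) : Cl (sumForm B₁ B₂)) =
      clInr B₁ B₂ (p₂ : (Cl B₂)ˣ) := by
    refine pin_induction (p := fun x => ∃ q : Pin (sumForm B₁ B₂),
      ((q : (Cl (sumForm B₁ B₂))ˣ) : Cl (sumForm B₁ B₂)) = clInr B₁ B₂ x) ⟨1, by simp⟩ ?_ p₂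
    rintro v x hv ⟨q, hq⟩
    obtain ⟨r, hr⟩ := mem_pin_of_form_eq_two (B := sumForm B₁ B₂) (v := (0, v)) (by simp [hv])
    exact ⟨r * q, by rw [Subgroup.coe_mul, Units.val_mul, hr, hq, map_mul, clInr_ι]⟩
  obtain ⟨q₁, hq₁⟩ := hl
  obtain ⟨q₂, hq₂⟩ := hr
  have hq : (((q₁ * q₂ : Pin (sumForm B₁ B₂)) : (Cl (sumForm B₁ B₂))ˣ) : Cl (sumForm B₁ B₂)) =
      clInl B₁ B₂ (p₁ : (Cl B₁)ˣ) * clInr B₁ B₂ (p₂ : (Cl B₂)ˣ) := by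
    rw [Subgroup.coe_mul, Units.val_mul, hq₁, hq₂]
  refine ⟨q₁ * q₂, hq, isLift_iff.mpr fun ξ => ?_⟩
  rw [hq]
  exact lift_clInl_mul_clInr h₁ h₂ (isLift_iff.mp hp₁) (isLift_iff.mp hp₂) ξ

theorem isLift_mul {s₁ s₂ : Pin B₁} {A₁ A₂ : W₁ → W₁} (h₁ : IsLift B₁ s₁ A₁)
    (h₂ : IsLift B₁ s₂ A₂) : IsLift B₁ (s₁ * s₂) (fun ξ => A₁ (A₂ ξ)) := by
  rw [isLift_iff] at *
  intro ξ
  rw [Subgroup.coe_mul, Units.val_mul, map_mul, mul_assoc, h₂, ← mul_assoc, h₁, mul_assoc]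

/-- An inner product on a finite-dimensional space has an orthonormal basis. -/
theorem exists_orthonormal_basis [FiniteDimensional ℝ W₁] (hs : ∀ x y, B₁ x y = B₁ y x)
    (hp : ∀ x, x ≠ 0 → 0 < B₁ x x) : ∃ e : Module.Basis (Fin (Module.finrank ℝ W₁)) ℝ W₁,
      ∀ i j, B₁ (e i) (e j) = if i = j then 1 else 0 := by
  obtain ⟨v, hv⟩ := LinearMap.BilinForm.exists_orthogonal_basis (B := B₁) ⟨fun x y => hs x y⟩
  have hpos : ∀ i, 0 < B₁ (v i) (v i) := fun i => hp _ (v.ne_zero i)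
  have hne : ∀ i, (√(B₁ (v i) (v i)))⁻¹ ≠ 0 := fun i =>
    inv_ne_zero (Real.sqrt_pos.mpr (hpos i)).ne'
  refine ⟨v.unitsSMul fun i => Units.mk0 _ (hne i), fun i j => ?_⟩
  simp only [Module.Basis.unitsSMul_apply, Units.smul_def, Units.val_mk0, map_smul,
    LinearMap.smul_apply, smul_eq_mul]
  split_ifs with h
  · subst h
    have h1 := Real.mul_self_sqrt (hpos i).le
    have h2 := Real.sqrt_pos.mpr (hpos i)
    field_simp
    rw [sq, h1]
  · have : B₁ (v i) (v j) = 0 := hv h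
    rw [this, mul_zero, mul_zero]

end PinLift

/-! ### Linearity of the evaluation of forms -/

section Eval

variable {V : Type*} [AddCommGroup V] [Module ℝ V]

theorem evalForm_smul {k : ℕ} (c : ℝ) (x : Forms V) (v : Fin k → V) :
    evalForm (c • x) v = c * evalForm x v := by
  simp [evalForm, degreePart_smul]

theorem evalForm_neg {k : ℕ} (x : Forms V) (v : Fin k → V) : evalForm (-x) v = -evalForm x v := by
  simpa using evalForm_smul (-1) x v

theorem evalForm_congr {k : ℕ} {x y : Forms V} (h : degreePart k x = degreePart k y)
    (v : Fin k → V) : evalForm x v = evalForm y v := by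
  rw [evalForm, evalForm, h]

end Eval

/-! ### Fusion of forms with values in the orientation bundle -/

section Twisted

variable {E : Type*} [NormedAddCommGroup E] [NormedSpace ℝ E] [FiniteDimensional ℝ E]
  {H : Type*} [TopologicalSpace H] {I : ModelWithCorners ℝ E H} {G : Type*} [TopologicalSpace G]
  [ChartedSpace H G] [Group G]
  {F : Type*} [NormedAddCommGroup F] [NormedSpace ℝ F] [FiniteDimensional ℝ F] {K : Type*}
  [TopologicalSpace K] {J : ModelWithCorners ℝ F K} {M : Type*} [TopologicalSpace M]
  [ChartedSpace K M]

omit [FiniteDimensional ℝ E] in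
theorem Gamma_neg (B : LinearMap.BilinForm ℝ (GroupLieAlgebra I G)) (X : Triple G J M) (m : M)
    (z : Cl B) : Gamma I B X m (-z) = -Gamma I B X m z := by
  rw [Gamma_eq_expSubst, Gamma_eq_expSubst, map_neg]

/-- The form `Γ` with values in the orientation bundle can be computed from any lift. -/
theorem twistedGamma_eq {B : LinearMap.BilinForm ℝ (GroupLieAlgebra I G)}
    (hs : ∀ x y, B x y = B y x) (hp : ∀ x, x ≠ 0 → 0 < B x x) (X : Triple G J M) (m : M)
    (hi : ∀ x y, B (Ad I (X.moment m) x) (Ad I (X.moment m) y) = B x y)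
    {z : Cl B} (hz : IsPinLift B z (Ad I (X.moment m)))
    (b : Fin (Module.finrank ℝ F) → TangentSpace J m) :
    twistedGamma I B X m b =
      (SignType.sign (evalForm (Gamma I B X m z) b) : ℝ) • Gamma I B X m z := by
  obtain ⟨p, rfl, h⟩ := hz
  have h' : IsLift B (someLift B (Ad I (X.moment m))) (Ad I (X.moment m)) :=
    isLift_someLift hs hp (Ad I (X.moment m)).toLinearMap hi
  rw [twistedGamma]
  rcases isLift_eq_or_eq_neg hs hp h h' with h1 | h1
  · rw [h1]
  · rw [h1, Gamma_neg, evalForm_neg, Left.sign_neg]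
    simp

/-- The density defined by `Γ` is the absolute value of the top degree part of `Γ`, for any lift. -/
theorem evalForm_twistedGamma {B : LinearMap.BilinForm ℝ (GroupLieAlgebra I G)}
    (hs : ∀ x y, B x y = B y x) (hp : ∀ x, x ≠ 0 → 0 < B x x) (X : Triple G J M) (m : M)
    (hi : ∀ x y, B (Ad I (X.moment m) x) (Ad I (X.moment m) y) = B x y)
    {z : Cl B} (hz : IsPinLift B z (Ad I (X.moment m)))
    (b : Fin (Module.finrank ℝ F) → TangentSpace J m) :
    evalForm (twistedGamma I B X m b) b = |evalForm (Gamma I B X m z) b| := by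
  rw [twistedGamma_eq hs hp X m hi hz, evalForm_smul, sign_mul_self]

omit [FiniteDimensional ℝ E] in
theorem squareForm_pos {B : LinearMap.BilinForm ℝ (GroupLieAlgebra I G)}
    (hp : ∀ x, x ≠ 0 → 0 < B x x) (x) (hx : x ≠ 0) : 0 < squareForm I B x x := by
  have h0 : ∀ y, 0 ≤ B y y := fun y => by
    by_cases hy : y = 0
    · simp [hy]
    · exact (hp y hy).le
  by_cases h1 : (x : E × E).1 = 0
  · have h2 : (x : E × E).2 ≠ 0 := fun h2 => hx (Prod.ext h1 h2)
    exact add_pos_of_nonneg_of_pos (h0 _) (hp _ h2)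
  · exact add_pos_of_pos_of_nonneg (hp _ h1) (h0 _)

variable [LieGroup I ∞ G]

omit [FiniteDimensional ℝ E] in
/-- The product of lifts of `Ad_g₁` and `Ad_g₂` in the Clifford algebra of `𝔤 ⊕ 𝔤` lifts
`Ad_(g₁, g₂)`. -/
theorem isPinLift_square {B : LinearMap.BilinForm ℝ (GroupLieAlgebra I G)}
    (hs : ∀ x y, B x y = B y x) (g : G × G) {z₁ z₂ : Cl B} (h₁ : IsPinLift B z₁ (Ad I g.1))
    (h₂ : IsPinLift B z₂ (Ad I g.2)) :
    IsPinLift (squareForm I B) (clInl B B z₁ * clInr B B z₂ : Cl (sumForm B B))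
      (Ad (I.prod I) g) := by
  have h := IsPinLift.clInl_mul_clInr hs hs (A₁ := (Ad I g.1).toLinearMap)
    (A₂ := (Ad I g.2).toLinearMap) h₁ h₂
  have hA : HEq (((Ad I g.1).toLinearMap.prodMap (Ad I g.2).toLinearMap) :
      GroupLieAlgebra I G × GroupLieAlgebra I G → GroupLieAlgebra I G × GroupLieAlgebra I G)
      (Ad (I.prod I) g :
        GroupLieAlgebra (I.prod I) (G × G) → GroupLieAlgebra (I.prod I) (G × G)) := by
    have : (Ad (I.prod I) g : GroupLieAlgebra I G × GroupLieAlgebra I G →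
        GroupLieAlgebra I G × GroupLieAlgebra I G) =
        ((Ad I g.1).toLinearMap.prodMap (Ad I g.2).toLinearMap) := funext fun ξ => Ad_prod g ξ
    exact heq_of_eq this.symm
  exact @IsPinLift.congr (GroupLieAlgebra I G × GroupLieAlgebra I G)
    (GroupLieAlgebra (I.prod I) (G × G)) Prod.instAddCommGroup
    (instAddCommGroupTangentSpace (I.prod I) 1) Prod.instModule
    (instModuleTangentSpace (I.prod I) 1) (sumForm B B) (squareForm I B) rfl HEq.rfl HEq.rfl HEq.rfl
    _ _ HEq.rfl _ _ hA h

omit [FiniteDimensional ℝ E] in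
theorem isPinLift_Ad_mul {B : LinearMap.BilinForm ℝ (GroupLieAlgebra I G)}
    (g h : G) {s₁ s₂ : Pin B} (h₁ : IsLift B s₁ (Ad I g)) (h₂ : IsLift B s₂ (Ad I h)) :
    IsPinLift B ((s₁ * s₂ : Pin B) : (Cl B)ˣ) (Ad I (g * h)) :=
  ⟨_, rfl, by
    have : (Ad I (g * h) : GroupLieAlgebra I G → GroupLieAlgebra I G) =
      fun ξ => Ad I g (Ad I h ξ) := funext fun ξ => Ad_mul g h ξ
    rw [this]
    exact isLift_mul h₁ h₂⟩

/-- The fusion formula for the forms with values in the orientation bundle, at a point. -/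
theorem twistedGamma_fusion {B : LinearMap.BilinForm ℝ (GroupLieAlgebra I G)}
    (hB : IsInvariantInner I B)
    {d : ℕ} (e : Module.Basis (Fin d) ℝ (GroupLieAlgebra I G))
    (he : ∀ i j, B (e i) (e j) = if i = j then 1 else 0) {X : Triple (G × G) J M} {m : M}
    (hX : MomentAt (I.prod I) (squareForm I B) X m)
    (b : Fin (Module.finrank ℝ F) → TangentSpace J m) :
    twistedGamma I B (X.fusion I B) m b =
      expUpTo (Module.finrank ℝ F) (fusionOperator I X e m)
        (twistedGamma (I.prod I) (squareForm I B) X m b) := by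
  have hl : ∀ g : G, IsLift B (someLift B (Ad I g)) (Ad I g) := fun g =>
    isLift_someLift hB.symm hB.pos (Ad I g).toLinearMap (hB.invariant g)
  set s₁ := someLift B (Ad I (X.moment m).1)
  set s₂ := someLift B (Ad I (X.moment m).2)
  have h1 : IsPinLift B ((s₁ * s₂ : Pin B) : (Cl B)ˣ) (Ad I ((X.fusion I B).moment m)) :=
    isPinLift_Ad_mul _ _ (hl _) (hl _)
  have h2 := isPinLift_square hB.symm (X.moment m) (z₁ := (s₁ : (Cl B)ˣ)) (z₂ := (s₂ : (Cl B)ˣ))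
    ⟨s₁, rfl, hl _⟩ ⟨s₂, rfl, hl _⟩
  have key := Gamma_fusion hB.symm hB.invariant e he hX s₁ s₂ (hl _) (hl _)
  rw [twistedGamma_eq hB.symm hB.pos (X.fusion I B) m (hB.invariant _) h1,
    twistedGamma_eq (squareForm_symm hB.symm) (squareForm_pos hB.pos) X m
      (squareForm_invariant hB.invariant _) h2, map_smul, ← key]
  congr 3
  refine evalForm_congr ?_ b
  rw [key]
  exact degreePart_fusionOperator e m _

theorem degreePart_twistedGamma_fusion {B : LinearMap.BilinForm ℝ (GroupLieAlgebra I G)}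
    (hB : IsInvariantInner I B) {X : Triple (G × G) J M} {m : M}
    (hX : MomentAt (I.prod I) (squareForm I B) X m)
    (b : Fin (Module.finrank ℝ F) → TangentSpace J m) :
    degreePart (Module.finrank ℝ F) (twistedGamma I B (X.fusion I B) m b) =
      degreePart (Module.finrank ℝ F) (twistedGamma (I.prod I) (squareForm I B) X m b) := by
  obtain ⟨e, he⟩ := exists_orthonormal_basis hB.symm hB.pos
  rw [twistedGamma_fusion hB e he hX]
  exact degreePart_fusionOperator e m _

/-- Fusion does not change the Liouville measure. -/
theorem liouville_fusion [MeasurableSpace M] {B : LinearMap.BilinForm ℝ (GroupLieAlgebra I G)}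
    (hB : IsInvariantInner I B) {X : Triple (G × G) J M}
    (hX : ∀ m, MomentAt (I.prod I) (squareForm I B) X m) :
    liouville I B (X.fusion I B) = liouville (I.prod I) (squareForm I B) X := by
  rw [liouville, liouville]
  congr 1
  funext m b
  exact evalForm_congr (degreePart_twistedGamma_fusion hB (hX m) b) b

omit [Group G] [LieGroup I ∞ G] in
/-- A compact Lie group is second countable, so that its Borel structure is compatible with
products. -/
theorem secondCountable_of_compact_chartedSpace [I.Boundaryless] [CompactSpace G] :
    SecondCountableTopology G := by
  have : ProperSpace E := FiniteDimensional.proper_real E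
  have : SecondCountableTopology H := I.isClosedEmbedding.isEmbedding.secondCountableTopology
  exact ChartedSpace.secondCountable_of_sigmaCompact H G

/-- The Duistermaat-Heckman measure of a fusion is the push-forward under the multiplication. -/
theorem duistermaatHeckman_fusion [MeasurableSpace M] [BorelSpace M] [I.Boundaryless]
    [CompactSpace G] [MeasurableSpace G] [BorelSpace G]
    {B : LinearMap.BilinForm ℝ (GroupLieAlgebra I G)}
    (hB : IsInvariantInner I B) {X : Triple (G × G) J M} (hc : Continuous X.moment)
    (hX : ∀ m, MomentAt (I.prod I) (squareForm I B) X m) :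
    duistermaatHeckman I B (X.fusion I B) =
      (duistermaatHeckman (I.prod I) (squareForm I B) X).map fun g => g.1 * g.2 := by
  have := secondCountable_of_compact_chartedSpace (I := I) (G := G)
  have := topologicalGroup_of_lieGroup I ∞ (G := G)
  rw [duistermaatHeckman, duistermaatHeckman, liouville_fusion hB hX,
    MeasureTheory.Measure.map_map measurable_mul hc.measurable]
  rfl

end Twisted

/-! ### Pull-back of forms -/

section Pullback

variable {V V' : Type*} [AddCommGroup V] [Module ℝ V] [AddCommGroup V'] [Module ℝ V']

theorem pullback_ι (f : V →ₗ[ℝ] V') (l : Module.Dual ℝ V') :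
    pullback f (ExteriorAlgebra.ι ℝ l) = ExteriorAlgebra.ι ℝ (l ∘ₗ f) := by
  rw [pullback, ExteriorAlgebra.map_apply_ι]; rfl

theorem pullback_mem (f : V →ₗ[ℝ] V') {k : ℕ} {x : Forms V'}
    (hx : x ∈ ⋀[ℝ]^k (Module.Dual ℝ V')) : pullback f x ∈ ⋀[ℝ]^k (Module.Dual ℝ V) := by
  induction k generalizing x with
  | zero =>
    rw [ExteriorAlgebra.exteriorPower, pow_zero] at hx ⊢
    obtain ⟨r, rfl⟩ := Submodule.mem_one.mp hx
    exact Submodule.mem_one.mpr ⟨r, (AlgHom.commutes _ r).symm⟩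
  | succ k ih =>
    rw [ExteriorAlgebra.exteriorPower, pow_succ'] at hx ⊢
    refine Submodule.mul_induction_on hx ?_ fun x y hx hy => ?_
    · rintro _ ⟨l, rfl⟩ y hy
      rw [map_mul, pullback_ι]
      exact Submodule.mul_mem_mul ⟨_, rfl⟩ (ih hy)
    · rw [map_add]; exact add_mem hx hy

theorem forms_eq_zero_of_finrank_lt [FiniteDimensional ℝ V] {k : ℕ} {x : Forms V}
    (hx : x ∈ ⋀[ℝ]^k (Module.Dual ℝ V)) (hk : Module.finrank ℝ V < k) : x = 0 := by
  rw [exteriorPower_eq_bot (by rwa [Subspace.dual_finrank_eq])] at hx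
  exact (Submodule.mem_bot ℝ).mp hx

/-- The part of top degree of a product of forms on the two factors of a product. -/
theorem degreePart_pullback_mul {V₁ V₂ : Type*} [AddCommGroup V₁] [Module ℝ V₁] [AddCommGroup V₂]
    [Module ℝ V₂] [FiniteDimensional ℝ V₁] [FiniteDimensional ℝ V₂] (f : V →ₗ[ℝ] V₁)
    (g : V →ₗ[ℝ] V₂) (x : Forms V₁) (y : Forms V₂) :
    (degreePart (Module.finrank ℝ V₁ + Module.finrank ℝ V₂) (pullback f x * pullback g y) :
      Forms V) = pullback f (degreePart (Module.finrank ℝ V₁) x) *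
        pullback g (degreePart (Module.finrank ℝ V₂) y) := by
  refine forms_induction (p := fun x => (degreePart (Module.finrank ℝ V₁ + Module.finrank ℝ V₂)
    (pullback f x * pullback g y) : Forms V) = pullback f (degreePart (Module.finrank ℝ V₁) x) *
        pullback g (degreePart (Module.finrank ℝ V₂) y)) x (fun k x hx => ?_)
    fun x x' hx hx' => by
      simp only [map_add, add_mul, degreePart_add, Submodule.coe_add, hx, hx']
  refine forms_induction (p := fun y => (degreePart (Module.finrank ℝ V₁ + Module.finrank ℝ V₂)
    (pullback f x * pullback g y) : Forms V) = pullback f (degreePart (Module.finrank ℝ V₁) x) *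
        pullback g (degreePart (Module.finrank ℝ V₂) y)) y (fun l y hy => ?_)
    fun y y' hy hy' => by
      simp only [map_add, mul_add, degreePart_add, Submodule.coe_add, hy, hy']
  have hxy : pullback f x * pullback g y ∈ ⋀[ℝ]^(k + l) (Module.Dual ℝ V) :=
    SetLike.mul_mem_graded (A := fun i : ℕ => ⋀[ℝ]^i (Module.Dual ℝ V)) (pullback_mem f hx)
      (pullback_mem g hy)
  rcases lt_trichotomy k (Module.finrank ℝ V₁) with h1 | h1 | h1
  · rw [degreePart_of_mem_ne hx h1.ne]
    rcases le_or_gt l (Module.finrank ℝ V₂) with h2 | h2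
    · rw [degreePart_of_mem_ne hxy (by omega)]
      simp
    · rw [forms_eq_zero_of_finrank_lt hy h2]
      simp [degreePart]
  · rcases lt_trichotomy l (Module.finrank ℝ V₂) with h2 | h2 | h2
    · rw [degreePart_of_mem_ne hy h2.ne, degreePart_of_mem_ne hxy (by omega)]
      simp
    · rw [← h1, ← h2, degreePart_coe_of_mem hxy, degreePart_coe_of_mem hx, degreePart_coe_of_mem hy]
    · rw [forms_eq_zero_of_finrank_lt hy h2]
      simp [degreePart]
  · rw [forms_eq_zero_of_finrank_lt hx h1]
    simp [degreePart]

theorem ofTwoForm_eq_sum_coord [TopologicalSpace V] [FiniteDimensional ℝ V]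
    (w : V [⋀^Fin 2]→L[ℝ] ℝ) : ofTwoForm w =
      ∑ i, ExteriorAlgebra.ι ℝ ((1 / 2 : ℝ) • (Module.finBasis ℝ V).coord i) *
        ExteriorAlgebra.ι ℝ (twoFormBilin w (Module.finBasis ℝ V i)) := by
  rw [ofTwoForm, Finset.smul_sum]
  refine Finset.sum_congr rfl fun i _ => ?_
  rw [ι_eq_sum_coord (twoFormBilin w (Module.finBasis ℝ V i)), Finset.mul_sum, Finset.smul_sum]
  refine Finset.sum_congr rfl fun j _ => ?_
  rw [mul_smul_comm, map_smul, smul_mul_assoc, smul_comm]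
  rfl

/-- Pull-backs of 2-forms, computed in the exterior algebra. -/
theorem ofTwoForm_comp [TopologicalSpace V] [FiniteDimensional ℝ V] [TopologicalSpace V']
    [FiniteDimensional ℝ V'] (w : V' [⋀^Fin 2]→L[ℝ] ℝ) (f : V →L[ℝ] V') :
    ofTwoForm (w.compContinuousLinearMap f) = pullback f.toLinearMap (ofTwoForm w) := by
  rw [ofTwoForm_eq_sum_coord w, map_sum]
  simp only [map_mul, pullback_ι]
  refine ofTwoForm_eq_sum _ _ _ _ fun u v => ?_
  set b := Module.finBasis ℝ V' with hb
  have h1 : ∀ x y : V', ∑ i, b.coord i x * twoFormBilin w (b i) y = twoFormBilin w x y := by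
    intro x y
    have := congrArg (fun z => twoFormBilin w z y) (b.sum_repr x)
    simpa only [map_sum, map_smul, LinearMap.sum_apply, LinearMap.smul_apply, smul_eq_mul,
      Module.Basis.coord_apply] using this
  have h2 : w.compContinuousLinearMap f ![u, v] = twoFormBilin w (f u) (f v) := by
    rw [twoFormBilin_apply, ContinuousAlternatingMap.compContinuousLinearMap_apply]
    congr 1
    ext i; fin_cases i <;> rfl
  have h3 := twoFormBilin_swap w (f u) (f v)
  rw [h2, Finset.sum_sub_distrib]
  simp only [LinearMap.comp_apply, LinearMap.smul_apply, smul_eq_mul, mul_assoc, ← Finset.mul_sum]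
  simp only [ContinuousLinearMap.coe_coe, h1]
  linarith

end Pullback

/-! ### Direct products of group valued Hamiltonian manifolds -/

section Product

variable {E : Type*} [NormedAddCommGroup E] [NormedSpace ℝ E]
  {H : Type*} [TopologicalSpace H] {I : ModelWithCorners ℝ E H} {G : Type*} [TopologicalSpace G]
  [ChartedSpace H G] [Group G] [LieGroup I ∞ G]
  {F₁ : Type*} [NormedAddCommGroup F₁] [NormedSpace ℝ F₁]
  {K₁ : Type*} [TopologicalSpace K₁] {J₁ : ModelWithCorners ℝ F₁ K₁}
  {M₁ : Type*} [TopologicalSpace M₁] [ChartedSpace K₁ M₁]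
  {F₂ : Type*} [NormedAddCommGroup F₂] [NormedSpace ℝ F₂]
  {K₂ : Type*} [TopologicalSpace K₂] {J₂ : ModelWithCorners ℝ F₂ K₂}
  {M₂ : Type*} [TopologicalSpace M₂] [ChartedSpace K₂ M₂]
  {B : LinearMap.BilinForm ℝ (GroupLieAlgebra I G)} {X₁ : Triple G J₁ M₁} {X₂ : Triple G J₂ M₂}

omit [LieGroup I ∞ G] in
theorem prod_dMoment {m : M₁ × M₂} (h₁ : MDifferentiableAt J₁ I X₁.moment m.1)
    (h₂ : MDifferentiableAt J₂ I X₂.moment m.2) (v : TangentSpace (J₁.prod J₂) m) :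
    ((X₁.prod X₂).dMoment (I.prod I) m v : E × E) =
      (X₁.dMoment I m.1 (v : F₁ × F₂).1, X₂.dMoment I m.2 (v : F₁ × F₂).2) :=
  DFunLike.congr_fun (modelDeriv_prodMap (p := m) h₁ h₂) v

omit [LieGroup I ∞ G] in
theorem prod_genField {m : M₁ × M₂}
    (h₁ : MDifferentiableAt I J₁ (fun g : G => X₁.act g m.1) 1)
    (h₂ : MDifferentiableAt I J₂ (fun g : G => X₂.act g m.2) 1) (ξ : E × E) :
    (genField (I.prod I) (J₁.prod J₂) (X₁.prod X₂).act ξ m : F₁ × F₂) =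
      (genField I J₁ X₁.act ξ.1 m.1, genField I J₂ X₂.act ξ.2 m.2) :=
  congrArg Neg.neg (DFunLike.congr_fun (modelDeriv_prodMap (p := ((1, 1) : G × G)) h₁ h₂) ξ)

omit [TopologicalSpace G] [ChartedSpace H G] [LieGroup I ∞ G] in
theorem prod_form (m : M₁ × M₂) (u v : F₁ × F₂) :
    (X₁.prod X₂).form m ![u, v] = X₁.form m.1 ![u.1, v.1] + X₂.form m.2 ![u.2, v.2] := by
  refine congrArg₂ (fun a b : ℝ => a + b) ?_ ?_
  · refine (ContinuousAlternatingMap.compContinuousLinearMap_apply _ _ _).trans ?_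
    congr 1
    ext i; fin_cases i
    · exact DFunLike.congr_fun (modelDeriv_fst (I := J₁) (I' := J₂) (p := m)) u
    · exact DFunLike.congr_fun (modelDeriv_fst (I := J₁) (I' := J₂) (p := m)) v
  · refine (ContinuousAlternatingMap.compContinuousLinearMap_apply _ _ _).trans ?_
    congr 1
    ext i; fin_cases i
    · exact DFunLike.congr_fun (modelDeriv_snd (I := J₁) (I' := J₂) (p := m)) u
    · exact DFunLike.congr_fun (modelDeriv_snd (I := J₁) (I' := J₂) (p := m)) v

theorem prod_thetaR {m : M₁ × M₂} (h₁ : MDifferentiableAt J₁ I X₁.moment m.1)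
    (h₂ : MDifferentiableAt J₂ I X₂.moment m.2) (v : F₁ × F₂) :
    (thetaR (I.prod I) ((X₁.prod X₂).moment m) ((X₁.prod X₂).dMoment (I.prod I) m v) : E × E) =
      (thetaR I (X₁.moment m.1) (X₁.dMoment I m.1 v.1),
        thetaR I (X₂.moment m.2) (X₂.dMoment I m.2 v.2)) := by
  refine (thetaR_prod _ _).trans ?_
  have h := prod_dMoment (X₁ := X₁) (X₂ := X₂) h₁ h₂ v
  exact congrArg (fun z : E × E => ((thetaR I (X₁.moment m.1) z.1 : E),
    (thetaR I (X₂.moment m.2) z.2 : E))) h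

/-- The moment map condition and the equivariance for a direct product. -/
theorem MomentAt.prod {m : M₁ × M₂} (h₁ : MomentAt I B X₁ m.1) (h₂ : MomentAt I B X₂ m.2) :
    MomentAt (I.prod I) (squareForm I B) (X₁.prod X₂) m where
  mdiff_act := MDifferentiableAt.prodMap' (p := ((1, 1) : G × G)) h₁.mdiff_act h₂.mdiff_act
  mdiff_moment := MDifferentiableAt.prodMap' (p := m) h₁.mdiff_moment h₂.mdiff_moment
  form_genField ξ v := by
    have hA := Ad_prod ((X₁.prod X₂).moment m) ξ
    have hξ := prod_genField (X₁ := X₁) (X₂ := X₂) h₁.mdiff_act h₂.mdiff_act ξ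
    have hθ := prod_thetaR (X₁ := X₁) (X₂ := X₂) h₁.mdiff_moment h₂.mdiff_moment v
    have e1 := (congrArg (fun u : F₁ × F₂ => (X₁.prod X₂).form m ![u, v]) hξ).trans
      (prod_form m _ v)
    refine e1.trans ((congrArg₂ (fun a b : ℝ => a + b) (h₁.form_genField _ _)
      (h₂.form_genField _ _)).trans ?_)
    let ξ₁ : GroupLieAlgebra I G := (ξ : E × E).1
    let ξ₂ : GroupLieAlgebra I G := (ξ : E × E).2
    have e2 : momentSubst (I.prod I) (squareForm I B) (X₁.prod X₂) m
        (Ad (I.prod I) ((X₁.prod X₂).moment m) ξ + ξ) v = (1 / 2) *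
          (B (thetaR I (X₁.moment m.1) (X₁.dMoment I m.1 (v : F₁ × F₂).1))
            (Ad I (X₁.moment m.1) ξ₁ + ξ₁) +
          B (thetaR I (X₂.moment m.2) (X₂.dMoment I m.2 (v : F₁ × F₂).2))
            (Ad I (X₂.moment m.2) ξ₂ + ξ₂)) :=
      congrArg₂ (fun z w : GroupLieAlgebra (I.prod I) (G × G) =>
        (1 / 2 : ℝ) * squareForm I B z (w + ξ)) hθ hA
    rw [e2, mul_add]
    rfl
  theta_genField ξ := by
    have hA := Ad_prod ((X₁.prod X₂).moment m) ξ
    have hξ := prod_genField (X₁ := X₁) (X₂ := X₂) h₁.mdiff_act h₂.mdiff_act ξ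
    have hθ := prod_thetaR (X₁ := X₁) (X₂ := X₂) h₁.mdiff_moment h₂.mdiff_moment
      (genField (I.prod I) (J₁.prod J₂) (X₁.prod X₂).act ξ m)
    refine hθ.trans (Eq.trans ?_ (congrArg
      (fun z : GroupLieAlgebra (I.prod I) (G × G) => z - ξ) hA).symm)
    refine (congrArg (fun z : F₁ × F₂ => ((thetaR I (X₁.moment m.1) (X₁.dMoment I m.1 z.1) : E),
      (thetaR I (X₂.moment m.2) (X₂.dMoment I m.2 z.2) : E))) hξ).trans ?_
    exact Prod.ext (h₁.theta_genField _) (h₂.theta_genField _)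

variable [FiniteDimensional ℝ F₁] [FiniteDimensional ℝ F₂]

/-- The form `Γ` of a direct product is the product of the forms `Γ` of the factors. -/
theorem Gamma_prod {m : M₁ × M₂} (h₁ : MDifferentiableAt J₁ I X₁.moment m.1)
    (h₂ : MDifferentiableAt J₂ I X₂.moment m.2) (hs : ∀ x y, B x y = B y x) (z₁ z₂ : Cl B) :
    Gamma (I.prod I) (squareForm I B) (X₁.prod X₂) m
        (clInl B B z₁ * clInr B B z₂ : Cl (sumForm B B)) =
      pullback (mfderiv (J₁.prod J₂) J₁ Prod.fst m).toLinearMap (Gamma I B X₁ m.1 z₁) *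
        pullback (mfderiv (J₁.prod J₂) J₂ Prod.snd m).toLinearMap (Gamma I B X₂ m.2 z₂) := by
  have hΦ : MDifferentiableAt (J₁.prod J₂) (I.prod I) (X₁.prod X₂).moment m :=
    MDifferentiableAt.prodMap' (p := m) h₁ h₂
  set p₁ := (mfderiv (J₁.prod J₂) J₁ Prod.fst m) with hp₁
  set p₂ := (mfderiv (J₁.prod J₂) J₂ Prod.snd m) with hp₂
  have hr₁ : squareSubst I B (X₁.prod X₂) m ∘ₗ LinearMap.inl ℝ _ _ =
      p₁.toLinearMap.dualMap ∘ₗ momentSubst I B X₁ m.1 := by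
    ext ξ v
    have hc := modelDeriv_comp (I := J₁.prod J₂) (x := m) (f := Prod.fst) rfl h₁
      mdifferentiableAt_fst
    have : squareSubst I B (X₁.prod X₂) m (ξ, 0) v = (1 / 2) *
      (B (thetaR I (X₁.moment m.1) (mfderiv J₁ I X₁.moment m.1 (p₁ v))) ξ + 0) := by
      rw [squareSubst_apply, map_zero]
      exact congrArg (fun z => (1 / 2) * (B (thetaR I (X₁.moment m.1) z) ξ + 0))
        (DFunLike.congr_fun hc v)
    refine this.trans ?_
    rw [add_zero]
    rfl
  have hr₂ : squareSubst I B (X₁.prod X₂) m ∘ₗ LinearMap.inr ℝ _ _ =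
      p₂.toLinearMap.dualMap ∘ₗ momentSubst I B X₂ m.2 := by
    ext ξ v
    have hc := modelDeriv_comp (I := J₁.prod J₂) (x := m) (f := Prod.snd) rfl h₂
      mdifferentiableAt_snd
    have : squareSubst I B (X₁.prod X₂) m (0, ξ) v = (1 / 2) *
      (0 + B (thetaR I (X₂.moment m.2) (mfderiv J₂ I X₂.moment m.2 (p₂ v))) ξ) := by
      rw [squareSubst_apply, map_zero]
      exact congrArg (fun z => (1 / 2) * (0 + B (thetaR I (X₂.moment m.2) z) ξ))
        (DFunLike.congr_fun hc v)
    refine this.trans ?_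
    rw [zero_add]
    rfl
  have hΩ : ofTwoForm ((X₁.prod X₂).form m) = pullback p₁.toLinearMap (ofTwoForm (X₁.form m.1)) +
      pullback p₂.toLinearMap (ofTwoForm (X₂.form m.2)) := by
    rw [← ofTwoForm_comp, ← ofTwoForm_comp, ← ofTwoForm_add]
    rfl
  set n₁ := Module.finrank ℝ F₁
  set n₂ := Module.finrank ℝ F₂
  have hn : Module.finrank ℝ (F₁ × F₂) = n₁ + n₂ := Module.finrank_prod
  have hm₁ := pullback_mem p₁.toLinearMap (ofTwoForm_mem (X₁.form m.1))
  have hm₂ := pullback_mem p₂.toLinearMap (ofTwoForm_mem (X₂.form m.2))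
  have hd₁ : Module.finrank ℝ (Module.Dual ℝ (TangentSpace J₁ m.1)) ≤ n₁ :=
    Subspace.dual_finrank_eq.le
  have hd₂ : Module.finrank ℝ (Module.Dual ℝ (TangentSpace J₂ m.2)) ≤ n₂ :=
    Subspace.dual_finrank_eq.le
  have hd : Module.finrank ℝ (Module.Dual ℝ (TangentSpace (J₁.prod J₂) m)) ≤
      Module.finrank ℝ (F₁ × F₂) := Subspace.dual_finrank_eq.le
  have he : expUpTo (Module.finrank ℝ (F₁ × F₂)) (ofTwoForm ((X₁.prod X₂).form m)) =
      pullback p₁.toLinearMap (expUpTo n₁ (ofTwoForm (X₁.form m.1))) *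
        pullback p₂.toLinearMap (expUpTo n₂ (ofTwoForm (X₂.form m.2))) := by
    rw [hΩ, expUpTo_add (two_form_commute hm₁ _) (two_form_pow_eq_zero hm₁ hd)
      (two_form_pow_eq_zero hm₂ hd) (two_form_pow_eq_zero (add_mem hm₁ hm₂) hd), ← map_expUpTo,
      ← map_expUpTo, expUpTo_of_le (two_form_pow_eq_zero (ofTwoForm_mem (X₁.form m.1)) hd₁)
        (by omega), expUpTo_of_le (two_form_pow_eq_zero (ofTwoForm_mem (X₂.form m.2)) hd₂)
        (by omega)]
  have hcomm : ∀ y, Commute (pullback p₂.toLinearMap (expUpTo n₂ (ofTwoForm (X₂.form m.2)))) y := by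
    intro y
    rw [map_expUpTo]
    exact (Commute.expUpTo_right (two_form_commute hm₂ y).symm n₂).symm
  rw [Gamma_square B hΦ, expSubst_apply, symbol_clInl_mul_clInr hs hs, map_mul, he,
    Gamma_eq_expSubst, Gamma_eq_expSubst, expSubst_apply, expSubst_apply, map_mul, map_mul]
  have hx₁ : ExteriorAlgebra.map (squareSubst I B (X₁.prod X₂) m)
      (ExteriorAlgebra.map (LinearMap.inl ℝ _ _) (symbol B z₁)) =
      pullback p₁.toLinearMap (ExteriorAlgebra.map (momentSubst I B X₁ m.1) (symbol B z₁)) := by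
    rw [pullback, ← AlgHom.comp_apply, ← AlgHom.comp_apply, ExteriorAlgebra.map_comp_map,
      ExteriorAlgebra.map_comp_map, hr₁]
  have hx₂ : ExteriorAlgebra.map (squareSubst I B (X₁.prod X₂) m)
      (ExteriorAlgebra.map (LinearMap.inr ℝ _ _) (symbol B z₂)) =
      pullback p₂.toLinearMap (ExteriorAlgebra.map (momentSubst I B X₂ m.2) (symbol B z₂)) := by
    rw [pullback, ← AlgHom.comp_apply, ← AlgHom.comp_apply, ExteriorAlgebra.map_comp_map,
      ExteriorAlgebra.map_comp_map, hr₂]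
  rw [hx₁, hx₂, mul_assoc, mul_assoc]
  congr 1
  rw [← mul_assoc, (hcomm _).eq, mul_assoc]

variable [FiniteDimensional ℝ E]

/-- The volume form of a fusion product. -/
theorem degreePart_Gamma_fusion_prod {m : M₁ × M₂} (hB : IsInvariantInner I B)
    (h₁ : MomentAt I B X₁ m.1) (h₂ : MomentAt I B X₂ m.2) (s₁ s₂ : Pin B)
    (hs₁ : IsLift B s₁ (Ad I (X₁.moment m.1))) (hs₂ : IsLift B s₂ (Ad I (X₂.moment m.2))) :
    (degreePart (Module.finrank ℝ (F₁ × F₂)) (Gamma I B ((X₁.prod X₂).fusion I B) m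
      ((s₁ * s₂ : Pin B) : (Cl B)ˣ)) : Forms (TangentSpace (J₁.prod J₂) m)) =
      pullback (mfderiv (J₁.prod J₂) J₁ Prod.fst m).toLinearMap
        (degreePart (Module.finrank ℝ F₁) (Gamma I B X₁ m.1 (s₁ : (Cl B)ˣ))) *
      pullback (mfderiv (J₁.prod J₂) J₂ Prod.snd m).toLinearMap
        (degreePart (Module.finrank ℝ F₂) (Gamma I B X₂ m.2 (s₂ : (Cl B)ˣ))) := by
  obtain ⟨e, he⟩ := exists_orthonormal_basis hB.symm hB.pos
  rw [Gamma_fusion hB.symm hB.invariant e he (h₁.prod h₂) s₁ s₂ hs₁ hs₂,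
    degreePart_fusionOperator, Gamma_prod h₁.mdiff_moment h₂.mdiff_moment hB.symm,
    Module.finrank_prod]
  exact degreePart_pullback_mul (V₁ := TangentSpace J₁ m.1) (V₂ := TangentSpace J₂ m.2) _ _ _ _

end Product

/-! ### Gluing of measures along an open cover -/

section Gluing

open MeasureTheory Set

variable {M : Type*} [TopologicalSpace M] [SecondCountableTopology M] [MeasurableSpace M]
  [BorelSpace M] {κ : Type*} {U : κ → Set M} {μ : κ → Measure M}

/-- A countable measurable partition subordinate to an open cover. -/
theorem exists_partition_of_cover [Nonempty κ] (hU : ∀ x, IsOpen (U x)) (hc : ⋃ x, U x = univ) :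
    ∃ (x : ℕ → κ) (D : ℕ → Set M), (∀ n, D n ⊆ U (x n)) ∧ (∀ n, MeasurableSet (D n)) ∧
      Pairwise (Function.onFun Disjoint D) ∧ ⋃ n, D n = univ := by
  obtain ⟨T, hT, hTU⟩ := TopologicalSpace.isOpen_iUnion_countable U hU
  have hne : (insert (Classical.arbitrary κ) T).Nonempty := ⟨_, mem_insert _ _⟩
  obtain ⟨x, hx⟩ := (hT.insert (Classical.arbitrary κ)).exists_eq_range hne
  refine ⟨x, disjointed fun n => U (x n), fun n => disjointed_subset _ n,
    MeasurableSet.disjointed fun n => (hU _).measurableSet, disjoint_disjointed _, ?_⟩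
  rw [iUnion_disjointed, eq_univ_iff_forall]
  intro m
  have hm : m ∈ ⋃ i ∈ T, U i := by rw [hTU, hc]; trivial
  simp only [mem_iUnion] at hm ⊢
  obtain ⟨i, hi, hmi⟩ := hm
  have : i ∈ range x := hx ▸ mem_insert_of_mem _ hi
  obtain ⟨n, rfl⟩ := this
  exact ⟨n, hmi⟩

omit [TopologicalSpace M] [SecondCountableTopology M] [BorelSpace M] in
/-- A measure is the sum of its restrictions to the members of a countable partition. -/
theorem eq_sum_restrict {D : ℕ → Set M} (hD : ∀ n, MeasurableSet (D n))
    (hd : Pairwise (Function.onFun Disjoint D)) (hu : ⋃ n, D n = univ) (ν : Measure M) :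
    ν = Measure.sum fun n => ν.restrict (D n) := by
  rw [← Measure.restrict_iUnion hd hD, hu, Measure.restrict_univ]

/-- A measure that restricts to given measures on the members of an open cover is their
supremum. -/
theorem iSup_eq_of_restrict_eq (hU : ∀ x, IsOpen (U x)) (hc : ⋃ x, U x = univ) {ν : Measure M}
    (h : ∀ x, ν.restrict (U x) = μ x) : ⨆ x, μ x = ν := by
  rcases isEmpty_or_nonempty κ with hκ | hκ
  · have : IsEmpty M := by
      rw [← univ_eq_empty_iff, ← hc]; simp
    exact Subsingleton.elim _ _
  obtain ⟨x, D, hDU, hDm, hd, hu⟩ := exists_partition_of_cover hU hc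
  refine le_antisymm (iSup_le fun x => h x ▸ Measure.restrict_le_self) ?_
  rw [eq_sum_restrict hDm hd hu ν, eq_sum_restrict hDm hd hu (⨆ x, μ x)]
  refine Measure.le_intro fun s hs _ => ?_
  rw [Measure.sum_apply _ hs, Measure.sum_apply _ hs]
  refine ENNReal.tsum_le_tsum fun n => ?_
  have h1 : ν.restrict (D n) = (μ (x n)).restrict (D n) := by
    rw [← h, Measure.restrict_restrict (hDm n), inter_eq_left.mpr (hDU n)]
  rw [h1]
  exact Measure.restrict_mono le_rfl (le_iSup μ (x n)) s

/-- Measures on the members of an open cover that agree on overlaps glue to their supremum. -/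
theorem restrict_iSup_of_overlap (hU : ∀ x, IsOpen (U x)) (hc : ⋃ x, U x = univ)
    (hμ : ∀ x, (μ x).restrict (U x) = μ x)
    (hov : ∀ x y, (μ x).restrict (U x ∩ U y) = (μ y).restrict (U x ∩ U y)) :
    (∀ x, (⨆ x, μ x).restrict (U x) = μ x) ∧ ((∀ x, SFinite (μ x)) → SFinite (⨆ x, μ x)) := by
  rcases isEmpty_or_nonempty κ with hκ | hκ
  · refine ⟨fun x => isEmptyElim x, fun _ => ?_⟩
    rw [iSup_of_empty]
    exact inferInstanceAs (SFinite (0 : Measure M))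
  obtain ⟨x, D, hDU, hDm, hd, hu⟩ := exists_partition_of_cover hU hc
  set ν := Measure.sum fun n => (μ (x n)).restrict (D n) with hν
  have h : ∀ y, ν.restrict (U y) = μ y := by
    intro y
    rw [hν, Measure.restrict_sum _ (hU y).measurableSet, ← hμ y, eq_sum_restrict hDm hd hu
      ((μ y).restrict (U y))]
    congr 1
    funext n
    rw [Measure.restrict_restrict (hU y).measurableSet, Measure.restrict_restrict (hDm n)]
    have h1 : D n ∩ U y ⊆ U (x n) ∩ U y := inter_subset_inter_left _ (hDU n)
    rw [inter_comm (U y), ← inter_eq_left.mpr h1,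
      ← Measure.restrict_restrict ((hDm n).inter (hU y).measurableSet), hov,
      Measure.restrict_restrict ((hDm n).inter (hU y).measurableSet)]
  rw [iSup_eq_of_restrict_eq hU hc h]
  exact ⟨h, fun hs => inferInstance⟩

end Gluing

/-! ### The measure of a density in charts -/

section ChartMeasure

open MeasureTheory Set

variable {F : Type*} [NormedAddCommGroup F] [NormedSpace ℝ F]
  {K : Type*} [TopologicalSpace K] (J : ModelWithCorners ℝ F K) {M : Type*} [TopologicalSpace M]
  [ChartedSpace K M]

/-- The differential of the inverse of the preferred chart at `x₀`, as a map of model spaces. -/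
def chartDeriv (x₀ : M) (z : F) : F →L[ℝ] F :=
  modelDeriv 𝓘(ℝ, F) J (extChartAt J x₀).symm z

variable {J}

/-- A family of functions of frames that are absolute values of alternating forms. -/
def IsDensity {n : ℕ} (δ : M → (Fin n → F) → ℝ) : Prop :=
  ∀ m, ∃ a : F [⋀^Fin n]→ₗ[ℝ] ℝ, ∀ v, δ m v = |a v|

omit [TopologicalSpace M] in
/-- The transformation of a density under a change of frame. -/
theorem IsDensity.comp_basis {n : ℕ} {δ : M → (Fin n → F) → ℝ} (hδ : IsDensity δ) (m : M)
    (L : F →L[ℝ] F) (b : Module.Basis (Fin n) ℝ F) (v : Fin n → F) :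
    δ m (fun i => L (v i)) = |b.det v| * δ m (fun i => L (b i)) := by
  obtain ⟨a, ha⟩ := hδ m
  have h := congrArg (fun f => f v) ((a.compLinearMap L.toLinearMap).eq_smul_basis_det b)
  have h1 : a (fun i => L (v i)) = a (fun i => L (b i)) * b.det v := h
  rw [ha, ha, h1, abs_mul, mul_comm]

omit [TopologicalSpace M] in
/-- The transformation of a density under a linear map. -/
theorem IsDensity.comp_linearMap {n : ℕ} {δ : M → (Fin n → F) → ℝ} (hδ : IsDensity δ) (m : M)
    (L A : F →L[ℝ] F) (b : Module.Basis (Fin n) ℝ F) :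
    δ m (fun i => L (A (b i))) = |A.det| * δ m (fun i => L (b i)) := by
  rw [hδ.comp_basis m L b fun i => A (b i)]
  congr 2
  have := b.det_comp A.toLinearMap b
  rw [b.det_self, mul_one] at this
  exact this

omit [TopologicalSpace M] in
theorem IsDensity.nonneg {n : ℕ} {δ : M → (Fin n → F) → ℝ} (hδ : IsDensity δ) (m : M)
    (v : Fin n → F) : 0 ≤ δ m v := by
  obtain ⟨a, ha⟩ := hδ m
  rw [ha]; exact abs_nonneg _

/-- The Lebesgue measures normalised by two bases differ by the absolute value of a determinant. -/
theorem addHaar_eq_smul [MeasurableSpace F] [BorelSpace F] {ι : Type*} [Fintype ι]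
    [DecidableEq ι] [FiniteDimensional ℝ F]
    (b b' : Module.Basis ι ℝ F) : b'.addHaar = ENNReal.ofReal |b'.det b| • b.addHaar := by
  have : ProperSpace F := FiniteDimensional.proper_real F
  have h0 : b'.det b ≠ 0 := (b'.isUnit_det b).ne_zero
  have : Measure.IsAddHaarMeasure (ENNReal.ofReal |b'.det b| • b.addHaar) :=
    Measure.IsAddHaarMeasure.smul _ (by simpa using h0) ENNReal.ofReal_ne_top
  rw [Module.Basis.addHaar_eq_iff, Measure.smul_apply, Module.Basis.coe_parallelepiped,
    Measure.addHaar_parallelepiped, smul_eq_mul, ← ENNReal.ofReal_mul (abs_nonneg _), ← abs_mul,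
    Module.Basis.det_mul_det, b'.det_self, abs_one, ENNReal.ofReal_one]

variable [FiniteDimensional ℝ F] [MeasurableSpace F] [BorelSpace F] [J.Boundaryless]
  [IsManifold J ∞ M]

omit [FiniteDimensional ℝ F] [MeasurableSpace F] [BorelSpace F] in
theorem mdifferentiableAt_extChartAt_symm {x₀ : M} {z : F} (hz : z ∈ (extChartAt J x₀).target) :
    MDifferentiableAt 𝓘(ℝ, F) J (extChartAt J x₀).symm z :=
  (((contMDiffOn_extChartAt_symm (n := ∞) x₀).contMDiffAt
    ((isOpen_extChartAt_target x₀).mem_nhds hz)).mdifferentiableAt (by simp))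

omit [FiniteDimensional ℝ F] [MeasurableSpace F] [BorelSpace F] [J.Boundaryless] in
theorem mdifferentiableAt_extChartAt_of_mem {x₀ m : M} (hm : m ∈ (extChartAt J x₀).source) :
    MDifferentiableAt J 𝓘(ℝ, F) (extChartAt J x₀) m :=
  (contMDiffAt_extChartAt' (n := ∞) (by rwa [extChartAt_source] at hm)).mdifferentiableAt (by simp)

omit [FiniteDimensional ℝ F] [MeasurableSpace F] [BorelSpace F] in
/-- The differentials of two charts are related by the differential of the coordinate change. -/
theorem chartDeriv_eq {x y : M} {z : F} (hz : z ∈ (extChartAt J x).target)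
    (hy : (extChartAt J x).symm z ∈ (extChartAt J y).source) :
    HasFDerivAt (fun z => extChartAt J y ((extChartAt J x).symm z))
        (fderiv ℝ (fun z => extChartAt J y ((extChartAt J x).symm z)) z) z ∧
      chartDeriv J x z = (chartDeriv J y (extChartAt J y ((extChartAt J x).symm z))).comp
        (fderiv ℝ (fun z => extChartAt J y ((extChartAt J x).symm z)) z) := by
  have h1 : MDifferentiableAt 𝓘(ℝ, F) 𝓘(ℝ, F)
      (fun z => extChartAt J y ((extChartAt J x).symm z)) z :=
    (mdifferentiableAt_extChartAt_of_mem hy).comp z (mdifferentiableAt_extChartAt_symm hz)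
  have h2 := mdifferentiableAt_extChartAt_symm (J := J) ((extChartAt J y).map_source hy)
  refine ⟨(mdifferentiableAt_iff_differentiableAt.mp h1).hasFDerivAt, ?_⟩
  rw [← mfderiv_eq_fderiv]
  have h3 := modelDeriv_comp (x := z) rfl h2 h1
  refine Eq.trans ?_ h3
  refine Filter.EventuallyEq.mfderiv_eq ?_
  have hU : (extChartAt J x).target ∩ (extChartAt J x).symm ⁻¹' (extChartAt J y).source ∈ nhds z :=
    ((continuousOn_extChartAt_symm x).isOpen_inter_preimage (isOpen_extChartAt_target x)
      (isOpen_extChartAt_source y)).mem_nhds ⟨hz, hy⟩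
  filter_upwards [hU] with w hw
  exact ((extChartAt J y).left_inv hw.2).symm

variable [MeasurableSpace M] [BorelSpace M]
  {δ : M → (Fin (Module.finrank ℝ F) → F) → ℝ}

omit [FiniteDimensional ℝ F] [IsManifold J ∞ M] in
theorem measurableSet_target_inter (x : M) {S : Set M} (hS : MeasurableSet S) :
    MeasurableSet ((extChartAt J x).symm ⁻¹' S ∩ (extChartAt J x).target) := by
  have h1 : Measurable fun z : (extChartAt J x).target => (extChartAt J x).symm z :=
    (continuousOn_iff_continuous_domRestrict.mp (continuousOn_extChartAt_symm x)).measurable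
  have h2 := MeasurableSet.subtype_image (isOpen_extChartAt_target (I := J) x).measurableSet (h1 hS)
  convert h2 using 1
  ext z
  simp [and_comm]

omit [IsManifold J ∞ M] in
/-- The measure on a chart domain as an integral over the model space. -/
theorem chartMeasure_apply (x : M) {S : Set M} (hS : MeasurableSet S) :
    chartMeasure J δ x S = ∫⁻ z in (extChartAt J x).symm ⁻¹' S ∩ (extChartAt J x).target,
      ENNReal.ofReal (δ ((extChartAt J x).symm z)
        fun i => chartDeriv J x z (Module.finBasis ℝ F i)) ∂(Module.finBasis ℝ F).addHaar := by
  set b := Module.finBasis ℝ F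
  set T := (extChartAt J x).target
  have hT : IsOpen T := isOpen_extChartAt_target x
  let e : (Fin (Module.finrank ℝ F) → ℝ) ≃ᵐ F := b.equivFunL.symm.toHomeomorph.toMeasurableEquiv
  have he : Measure.map e volume = b.addHaar := by
    rw [← addHaarMeasure_eq_volume_pi, ← Module.Basis.parallelepiped_basisFun,
      ← Module.Basis.addHaar]
    refine ((Pi.basisFun ℝ _).map_addHaar b.equivFunL.symm).trans ?_
    congr 1
    refine Module.Basis.eq_of_apply_eq fun i => ?_
    rw [Module.Basis.map_apply, Pi.basisFun_apply]
    have := b.equivFun_symm_apply (Pi.single i 1)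
    refine this.trans ?_
    simp [Pi.single_apply]
  have hTm : MeasurableSet (e ⁻¹' T) := e.measurable hT.measurableSet
  have hae : AEMeasurable (coordSymm J x) (volume.restrict (e ⁻¹' T)) := by
    refine ContinuousOn.aemeasurable ?_ hTm
    exact (continuousOn_extChartAt_symm x).comp b.equivFunL.symm.continuous.continuousOn
      fun y hy => hy
  have hdef : chartMeasure J δ x = ((volume.restrict (e ⁻¹' T)).withDensity fun y =>
      ENNReal.ofReal (δ ((extChartAt J x).symm (e y)) fun i => chartDeriv J x (e y) (b i))).map
        (coordSymm J x) := rfl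
  rw [hdef, Measure.map_apply_of_aemeasurable
    (hae.mono_ac (withDensity_absolutelyContinuous _ _)) hS, withDensity_apply',
    Measure.restrict_restrict' hTm, ← he, e.restrict_map, lintegral_map_equiv]
  rfl

omit [IsManifold J ∞ M] in
/-- The measure on a chart domain can be computed from any basis of the model space. -/
theorem chartMeasure_apply_basis (hδ : IsDensity δ)
    (b : Module.Basis (Fin (Module.finrank ℝ F)) ℝ F) (x : M) {S : Set M} (hS : MeasurableSet S) :
    chartMeasure J δ x S = ∫⁻ z in (extChartAt J x).symm ⁻¹' S ∩ (extChartAt J x).target,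
      ENNReal.ofReal (δ ((extChartAt J x).symm z) fun i => chartDeriv J x z (b i)) ∂b.addHaar := by
  rw [chartMeasure_apply x hS, addHaar_eq_smul b (Module.finBasis ℝ F), Measure.restrict_smul,
    lintegral_smul_measure, smul_eq_mul, ← lintegral_const_mul' _ _ ENNReal.ofReal_ne_top]
  refine lintegral_congr fun z => ?_
  rw [← ENNReal.ofReal_mul (abs_nonneg _), ← hδ.comp_basis]

/-- The measures defined by a density in two charts agree on the overlap. -/
theorem chartMeasure_overlap (hδ : IsDensity δ) (x y : M) :
    (chartMeasure J δ x).restrict ((extChartAt J x).source ∩ (extChartAt J y).source) =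
      (chartMeasure J δ y).restrict ((extChartAt J x).source ∩ (extChartAt J y).source) := by
  have : ProperSpace F := FiniteDimensional.proper_real F
  have hov : MeasurableSet ((extChartAt J x).source ∩ (extChartAt J y).source) :=
    ((isOpen_extChartAt_source x).inter (isOpen_extChartAt_source y)).measurableSet
  ext S hS
  rw [Measure.restrict_apply hS, Measure.restrict_apply hS]
  set S' := S ∩ ((extChartAt J x).source ∩ (extChartAt J y).source) with hS'
  have hSm : MeasurableSet S' := hS.inter hov
  rw [chartMeasure_apply x hSm, chartMeasure_apply y hSm]
  set A := (extChartAt J x).symm ⁻¹' S' ∩ (extChartAt J x).target with hA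
  set ψ := fun z => extChartAt J y ((extChartAt J x).symm z) with hψ
  have hAx : ∀ z ∈ A, z ∈ (extChartAt J x).target := fun z hz => hz.2
  have hAy : ∀ z ∈ A, (extChartAt J x).symm z ∈ (extChartAt J y).source := fun z hz => hz.1.2.2
  have himg : ψ '' A = (extChartAt J y).symm ⁻¹' S' ∩ (extChartAt J y).target := by
    ext w
    constructor
    · rintro ⟨z, hz, rfl⟩
      refine ⟨?_, (extChartAt J y).map_source (hAy z hz)⟩
      rw [mem_preimage, (extChartAt J y).left_inv (hAy z hz)]
      exact hz.1
    · rintro ⟨hw, hwt⟩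
      refine ⟨extChartAt J x ((extChartAt J y).symm w),
        ⟨?_, (extChartAt J x).map_source hw.2.1⟩, ?_⟩
      · rw [mem_preimage, (extChartAt J x).left_inv hw.2.1]
        exact hw
      · simp only [hψ]
        rw [(extChartAt J x).left_inv hw.2.1, (extChartAt J y).right_inv hwt]
  have hinj : InjOn ψ A := by
    intro z hz z' hz' h
    have h1 := (extChartAt J y).injOn (hAy z hz) (hAy z' hz') h
    exact (extChartAt J x).symm.injOn (hAx z hz) (hAx z' hz') h1
  rw [← himg, lintegral_image_eq_lintegral_abs_det_fderiv_mul _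
    (measurableSet_target_inter x hSm) (fun z hz =>
      (chartDeriv_eq (hAx z hz) (hAy z hz)).1.hasFDerivWithinAt) hinj]
  refine setLIntegral_congr_fun (measurableSet_target_inter x hSm) fun z hz => ?_
  rw [← ENNReal.ofReal_mul (abs_nonneg _), ← hδ.comp_linearMap]
  rw [(extChartAt J y).left_inv (hAy z hz), (chartDeriv_eq (hAx z hz) (hAy z hz)).2]
  rfl

omit [IsManifold J ∞ M] in
theorem chartMeasure_restrict_source (x : M) :
    (chartMeasure J δ x).restrict (extChartAt J x).source = chartMeasure J δ x := by
  ext S hS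
  have hm : MeasurableSet (extChartAt J x).source := (isOpen_extChartAt_source x).measurableSet
  rw [Measure.restrict_apply hS, chartMeasure_apply x hS, chartMeasure_apply x (hS.inter hm)]
  congr 2
  ext z
  simp only [mem_inter_iff, mem_preimage]
  exact ⟨fun h => ⟨h.1.1, h.2⟩, fun h => ⟨⟨h.1, (extChartAt J x).map_target h.2⟩, h.2⟩⟩

/-- The measure of a density restricts to the measures on the chart domains. -/
theorem densityMeasure_restrict [SecondCountableTopology M] (hδ : IsDensity δ) :
    (∀ x, (densityMeasure J δ).restrict (extChartAt J x).source = chartMeasure J δ x) ∧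
      ((∀ x, SFinite (chartMeasure J δ x)) → SFinite (densityMeasure J δ)) :=
  restrict_iSup_of_overlap (U := fun x : M => (extChartAt J x).source)
    (fun x => isOpen_extChartAt_source x)
    (eq_univ_of_forall fun m => mem_iUnion.mpr ⟨m, mem_extChartAt_source m⟩)
    (fun x => chartMeasure_restrict_source x) (chartMeasure_overlap hδ)

end ChartMeasure

/-! ### The measure of a product of densities -/

section ProductMeasure

open MeasureTheory Set

section Chart

variable {F : Type*} [NormedAddCommGroup F] [NormedSpace ℝ F] [FiniteDimensional ℝ F]
  [MeasurableSpace F] [BorelSpace F]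
  {K : Type*} [TopologicalSpace K] {J : ModelWithCorners ℝ F K} [J.Boundaryless]
  {M : Type*} [TopologicalSpace M] [ChartedSpace K M] [MeasurableSpace M] [BorelSpace M]

/-- The density `δ` in the coordinates of the preferred chart at `x`, as a measure on the model
space. -/
def coordMeasure (J : ModelWithCorners ℝ F K) (δ : M → (Fin (Module.finrank ℝ F) → F) → ℝ)
    (b : Module.Basis (Fin (Module.finrank ℝ F)) ℝ F) (x : M) : Measure F :=
  (b.addHaar.restrict (extChartAt J x).target).withDensity fun z =>
    ENNReal.ofReal (δ ((extChartAt J x).symm z) fun i => chartDeriv J x z (b i))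

instance (J : ModelWithCorners ℝ F K) (δ : M → (Fin (Module.finrank ℝ F) → F) → ℝ)
    (b : Module.Basis (Fin (Module.finrank ℝ F)) ℝ F) (x : M) : SFinite (coordMeasure J δ b x) :=
  inferInstanceAs (SFinite (Measure.withDensity _ _))

variable {δ : M → (Fin (Module.finrank ℝ F) → F) → ℝ}

omit [FiniteDimensional ℝ F] in
theorem aemeasurable_extChartAt_symm (b : Module.Basis (Fin (Module.finrank ℝ F)) ℝ F) (x : M) :
    AEMeasurable (extChartAt J x).symm (coordMeasure J δ b x) :=
  AEMeasurable.mono_ac ((continuousOn_extChartAt_symm x).aemeasurable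
    (isOpen_extChartAt_target x).measurableSet) (withDensity_absolutelyContinuous _ _)

/-- The measure on a chart domain is the push-forward of the density in coordinates. -/
theorem chartMeasure_eq_map (hδ : IsDensity δ) (b : Module.Basis (Fin (Module.finrank ℝ F)) ℝ F)
    (x : M) : chartMeasure J δ x = (coordMeasure J δ b x).map (extChartAt J x).symm := by
  ext S hS
  rw [chartMeasure_apply_basis hδ b x hS,
    Measure.map_apply_of_aemeasurable (aemeasurable_extChartAt_symm b x) hS, coordMeasure,
    withDensity_apply', Measure.restrict_restrict' (isOpen_extChartAt_target x).measurableSet]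

instance sFinite_chartMeasure (J : ModelWithCorners ℝ F K)
    (δ : M → (Fin (Module.finrank ℝ F) → F) → ℝ) (x : M) :
    SFinite (chartMeasure J δ x) :=
  inferInstanceAs (SFinite (Measure.map _ (Measure.withDensity _ _)))

end Chart

variable {F₁ : Type*} [NormedAddCommGroup F₁] [NormedSpace ℝ F₁] [FiniteDimensional ℝ F₁]
  [MeasurableSpace F₁] [BorelSpace F₁]
  {K₁ : Type*} [TopologicalSpace K₁] {J₁ : ModelWithCorners ℝ F₁ K₁} [J₁.Boundaryless]
  {M₁ : Type*} [TopologicalSpace M₁] [ChartedSpace K₁ M₁] [MeasurableSpace M₁] [BorelSpace M₁]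
  [IsManifold J₁ ∞ M₁] [SecondCountableTopology M₁]
  {F₂ : Type*} [NormedAddCommGroup F₂] [NormedSpace ℝ F₂] [FiniteDimensional ℝ F₂]
  [MeasurableSpace F₂] [BorelSpace F₂]
  {K₂ : Type*} [TopologicalSpace K₂] {J₂ : ModelWithCorners ℝ F₂ K₂} [J₂.Boundaryless]
  {M₂ : Type*} [TopologicalSpace M₂] [ChartedSpace K₂ M₂] [MeasurableSpace M₂] [BorelSpace M₂]
  [IsManifold J₂ ∞ M₂] [SecondCountableTopology M₂]

/-- The push-forward of a product measure under a product of almost everywhere measurable maps. -/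
theorem map_prodMap_of_aemeasurable {α β γ ε : Type*} [MeasurableSpace α] [MeasurableSpace β]
    [MeasurableSpace γ] [MeasurableSpace ε] {μ : Measure α} {ν : Measure β} [SFinite μ] [SFinite ν]
    {f : α → γ} {g : β → ε} (hf : AEMeasurable f μ) (hg : AEMeasurable g ν) :
    (μ.map f).prod (ν.map g) = (μ.prod ν).map (Prod.map f g) := by
  rw [Measure.map_congr hf.ae_eq_mk, Measure.map_congr hg.ae_eq_mk,
    Measure.map_prod_map _ _ hf.measurable_mk hg.measurable_mk]
  refine Measure.map_congr ?_
  filter_upwards [Measure.quasiMeasurePreserving_fst.ae_eq_comp hf.ae_eq_mk,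
    Measure.quasiMeasurePreserving_snd.ae_eq_comp hg.ae_eq_mk] with p h1 h2
  exact Prod.ext h1.symm h2.symm

variable (F₁ F₂) in
/-- The numbering of the basis vectors of a product, first those of the first factor. -/
def prodIndex : Fin (Module.finrank ℝ F₁) ⊕ Fin (Module.finrank ℝ F₂) ≃
    Fin (Module.finrank ℝ (F₁ × F₂)) :=
  finSumFinEquiv.trans (finCongr Module.finrank_prod.symm)

/-- The frame of `F₁ × F₂` composed of frames of the factors. -/
def prodFrame (v₁ : Fin (Module.finrank ℝ F₁) → F₁) (v₂ : Fin (Module.finrank ℝ F₂) → F₂)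
    (i : Fin (Module.finrank ℝ (F₁ × F₂))) : F₁ × F₂ :=
  Sum.elim (fun k => (v₁ k, 0)) (fun k => (0, v₂ k)) ((prodIndex F₁ F₂).symm i)

variable {δ₁ : M₁ → (Fin (Module.finrank ℝ F₁) → F₁) → ℝ}
  {δ₂ : M₂ → (Fin (Module.finrank ℝ F₂) → F₂) → ℝ}
  {δ : M₁ × M₂ → (Fin (Module.finrank ℝ (F₁ × F₂)) → F₁ × F₂) → ℝ}

omit [FiniteDimensional ℝ F₁] [MeasurableSpace F₁] [BorelSpace F₁] [MeasurableSpace M₁]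
  [BorelSpace M₁] [SecondCountableTopology M₁] [FiniteDimensional ℝ F₂] [MeasurableSpace F₂]
  [BorelSpace F₂] [MeasurableSpace M₂] [BorelSpace M₂] [SecondCountableTopology M₂] in
theorem chartDeriv_prod {x : M₁ × M₂} {z : F₁ × F₂} (h₁ : z.1 ∈ (extChartAt J₁ x.1).target)
    (h₂ : z.2 ∈ (extChartAt J₂ x.2).target) :
    chartDeriv (J₁.prod J₂) x z = (chartDeriv J₁ x.1 z.1).prodMap (chartDeriv J₂ x.2 z.2) := by
  have h := modelDeriv_prodMap (p := z) (mdifferentiableAt_extChartAt_symm h₁)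
    (mdifferentiableAt_extChartAt_symm h₂)
  refine Eq.trans ?_ h
  rw [chartDeriv, extChartAt_prod, modelWithCornersSelf_prod, ← chartedSpaceSelf_prod]
  rfl

omit [MeasurableSpace M₁] [BorelSpace M₁] [SecondCountableTopology M₁] [MeasurableSpace M₂]
  [BorelSpace M₂] [SecondCountableTopology M₂] in
/-- In coordinates, the measure of a product density is the product measure, by Tonelli's
theorem. -/
theorem coordMeasure_prod (h₁ : IsDensity δ₁)
    (hδ : ∀ m v₁ v₂, δ m (prodFrame v₁ v₂) = δ₁ m.1 v₁ * δ₂ m.2 v₂)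
    (b₁ : Module.Basis (Fin (Module.finrank ℝ F₁)) ℝ F₁)
    (b₂ : Module.Basis (Fin (Module.finrank ℝ F₂)) ℝ F₂) (x : M₁ × M₂)
    (hm₁ : AEMeasurable (fun z => δ₁ ((extChartAt J₁ x.1).symm z)
      fun i => chartDeriv J₁ x.1 z (b₁ i)) (b₁.addHaar.restrict (extChartAt J₁ x.1).target))
    (hm₂ : AEMeasurable (fun z => δ₂ ((extChartAt J₂ x.2).symm z)
      fun i => chartDeriv J₂ x.2 z (b₂ i)) (b₂.addHaar.restrict (extChartAt J₂ x.2).target)) :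
    coordMeasure (J₁.prod J₂) δ ((b₁.prod b₂).reindex (prodIndex F₁ F₂)) x =
      (coordMeasure J₁ δ₁ b₁ x.1).prod (coordMeasure J₂ δ₂ b₂ x.2) := by
  have : ProperSpace F₁ := FiniteDimensional.proper_real F₁
  have hT : (extChartAt (J₁.prod J₂) x).target =
      (extChartAt J₁ x.1).target ×ˢ (extChartAt J₂ x.2).target := by
    rw [extChartAt_prod]; rfl
  rw [coordMeasure, coordMeasure, coordMeasure, prod_withDensity₀ hm₁.ennreal_ofReal
    hm₂.ennreal_ofReal, Measure.prod_restrict, Module.Basis.addHaar_reindex,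
    Module.Basis.prod_addHaar, hT]
  refine withDensity_congr_ae ?_
  refine (ae_restrict_iff' ?_).mpr (Filter.Eventually.of_forall fun z hz => ?_)
  · exact (isOpen_extChartAt_target x.1).measurableSet.prod
      (isOpen_extChartAt_target x.2).measurableSet
  have hc : (extChartAt (J₁.prod J₂) x).symm z =
      ((extChartAt J₁ x.1).symm z.1, (extChartAt J₂ x.2).symm z.2) := by
    rw [extChartAt_prod]; rfl
  have hfr : (fun i => chartDeriv (J₁.prod J₂) x z ((b₁.prod b₂).reindex (prodIndex F₁ F₂) i)) =
      prodFrame (fun i => chartDeriv J₁ x.1 z.1 (b₁ i))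
        (fun i => chartDeriv J₂ x.2 z.2 (b₂ i)) := by
    funext i
    rw [chartDeriv_prod hz.1 hz.2, Module.Basis.reindex_apply, prodFrame]
    rcases (prodIndex F₁ F₂).symm i with k | k <;> simp
  beta_reduce
  rw [hfr, hδ, hc, ← ENNReal.ofReal_mul (h₁.nonneg _ _)]

/-- If a density on a product of manifolds is the product of densities on the factors, then its
measure is the product measure. -/
theorem densityMeasure_prod (h₁ : IsDensity δ₁) (h₂ : IsDensity δ₂) (h : IsDensity δ)
    (hδ : ∀ m v₁ v₂, δ m (prodFrame v₁ v₂) = δ₁ m.1 v₁ * δ₂ m.2 v₂)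
    (hm₁ : ∀ x : M₁, AEMeasurable (fun z => δ₁ ((extChartAt J₁ x).symm z)
      fun i => chartDeriv J₁ x z (Module.finBasis ℝ F₁ i))
      ((Module.finBasis ℝ F₁).addHaar.restrict (extChartAt J₁ x).target))
    (hm₂ : ∀ x : M₂, AEMeasurable (fun z => δ₂ ((extChartAt J₂ x).symm z)
      fun i => chartDeriv J₂ x z (Module.finBasis ℝ F₂ i))
      ((Module.finBasis ℝ F₂).addHaar.restrict (extChartAt J₂ x).target)) :
    densityMeasure (J₁.prod J₂) δ = (densityMeasure J₁ δ₁).prod (densityMeasure J₂ δ₂) := by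
  have : ProperSpace F₁ := FiniteDimensional.proper_real F₁
  have : ProperSpace F₂ := FiniteDimensional.proper_real F₂
  obtain ⟨hr₁, hs₁⟩ := densityMeasure_restrict (J := J₁) h₁
  obtain ⟨hr₂, hs₂⟩ := densityMeasure_restrict (J := J₂) h₂
  have := hs₁ fun x => inferInstance
  have := hs₂ fun x => inferInstance
  refine iSup_eq_of_restrict_eq (U := fun x : M₁ × M₂ => (extChartAt (J₁.prod J₂) x).source)
    (fun x => isOpen_extChartAt_source x)
    (eq_univ_of_forall fun m => mem_iUnion.mpr ⟨m, mem_extChartAt_source m⟩) fun x => ?_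
  have hU : (extChartAt (J₁.prod J₂) x).source =
      (extChartAt J₁ x.1).source ×ˢ (extChartAt J₂ x.2).source := by
    rw [extChartAt_prod]; rfl
  rw [hU, ← Measure.prod_restrict, hr₁, hr₂, chartMeasure_eq_map h₁ (Module.finBasis ℝ F₁),
    chartMeasure_eq_map h₂ (Module.finBasis ℝ F₂),
    chartMeasure_eq_map h (((Module.finBasis ℝ F₁).prod (Module.finBasis ℝ F₂)).reindex
      (prodIndex F₁ F₂)), coordMeasure_prod h₁ hδ _ _ x (hm₁ x.1) (hm₂ x.2),
    map_prodMap_of_aemeasurable (aemeasurable_extChartAt_symm _ _)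
      (aemeasurable_extChartAt_symm _ _), extChartAt_prod]
  rfl

end ProductMeasure

/-! ### Evaluation of pull-backs and products of forms -/

section EvalForm

variable {V V' : Type*} [AddCommGroup V] [Module ℝ V] [AddCommGroup V'] [Module ℝ V']

/-- Induction on decomposable forms of a given degree. -/
theorem exteriorPower_induction {k : ℕ} {p : Forms V → Prop} {x : Forms V}
    (hx : x ∈ ⋀[ℝ]^k (Module.Dual ℝ V))
    (hι : ∀ l : Fin k → Module.Dual ℝ V, p (ExteriorAlgebra.ιMulti ℝ k l))
    (hadd : ∀ x y, p x → p y → p (x + y)) (hsmul : ∀ (c : ℝ) x, p x → p (c • x)) : p x := by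
  rw [← ExteriorAlgebra.ιMulti_span_fixedDegree] at hx
  refine Submodule.span_induction (p := fun x _ => p x) ?_ ?_ (fun x y _ _ => hadd x y)
    (fun c x _ => hsmul c x) hx
  · rintro _ ⟨l, rfl⟩; exact hι l
  · simpa using hsmul 0 _ (hι fun _ => 0)

theorem evalForm_add {k : ℕ} (x y : Forms V) (v : Fin k → V) :
    evalForm (x + y) v = evalForm x v + evalForm y v := by
  simp [evalForm, degreePart_add]

/-- The value of a wedge product of linear forms is a determinant. -/
theorem evalForm_ιMulti {k : ℕ} (l : Fin k → Module.Dual ℝ V) (v : Fin k → V) :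
    evalForm (ExteriorAlgebra.ιMulti ℝ k l) v = Matrix.det (.of fun i j => l j (v i)) := by
  have h : degreePart k (ExteriorAlgebra.ιMulti ℝ k l : Forms V) = exteriorPower.ιMulti ℝ k l :=
    Subtype.ext (degreePart_coe_of_mem (exteriorPower.ιMulti ℝ k l).2)
  rw [evalForm, h, exteriorPower.pairingDual_ιMulti_ιMulti]

theorem evalForm_degreePart {k : ℕ} (x : Forms V) (v : Fin k → V) :
    evalForm (degreePart k x : Forms V) v = evalForm x v :=
  evalForm_congr (Subtype.ext (degreePart_coe_of_mem (degreePart k x).2)) v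

/-- The component of degree `k` of a form as an alternating map. -/
def evalAlt (k : ℕ) (x : Forms V) : V [⋀^Fin k]→ₗ[ℝ] ℝ :=
  (exteriorPower.pairingDual ℝ V k (degreePart k x)).compAlternatingMap (exteriorPower.ιMulti ℝ k)

theorem evalAlt_apply {k : ℕ} (x : Forms V) (v : Fin k → V) : evalAlt k x v = evalForm x v := rfl

/-- The value of the degree `k` component of a form on given vectors depends linearly on the
form. -/
def evalLinear {k : ℕ} (v : Fin k → V) : Forms V →ₗ[ℝ] ℝ where
  toFun x := evalForm x v
  map_add' x y := evalForm_add x y v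
  map_smul' c x := evalForm_smul c x v

theorem evalForm_pullback {k : ℕ} (f : V →ₗ[ℝ] V') (x : Forms V') (v : Fin k → V) :
    evalForm (pullback f x) v = evalForm x fun i => f (v i) := by
  refine forms_induction (p := fun x => evalForm (pullback f x) v = evalForm x fun i => f (v i)) x
    (fun l x hx => ?_) fun x y hx hy => by
      rw [map_add, evalForm_add, evalForm_add, hx, hy]
  by_cases hl : l = k
  · subst hl
    refine exteriorPower_induction
      (p := fun x => evalForm (pullback f x) v = evalForm x fun i => f (v i)) hx (fun m => ?_)
      (fun x y hx hy => by rw [map_add, evalForm_add, evalForm_add, hx, hy])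
      fun c x hx => by rw [map_smul, evalForm_smul, evalForm_smul, hx]
    rw [pullback, ExteriorAlgebra.map_apply_ιMulti, evalForm_ιMulti, evalForm_ιMulti]
    rfl
  · rw [evalForm, evalForm, degreePart_of_mem_ne (pullback_mem f hx) hl, degreePart_of_mem_ne hx hl]
    simp

theorem evalForm_cast {k l : ℕ} (h : k = l) (x : Forms V) (v : Fin l → V) :
    evalForm x v = evalForm x fun i : Fin k => v (finCongr h i) := by
  subst h; rfl

/-- The value of a product of forms on the two factors of a product, on a frame composed of frames
of the factors. -/
theorem evalForm_pullback_mul {V₀ : Type*} [AddCommGroup V₀] [Module ℝ V₀] {k l : ℕ} {x : Forms V}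
    {y : Forms V'} (hx : x ∈ ⋀[ℝ]^k (Module.Dual ℝ V)) (hy : y ∈ ⋀[ℝ]^l (Module.Dual ℝ V'))
    {v : Fin k → V} {w : Fin l → V'} (f : V₀ →ₗ[ℝ] V) (g : V₀ →ₗ[ℝ] V') {u : Fin (k + l) → V₀}
    (hfv : ∀ i, f (u (finSumFinEquiv (Sum.inl i))) = v i)
    (hfw : ∀ i, f (u (finSumFinEquiv (Sum.inr i))) = 0)
    (hgw : ∀ i, g (u (finSumFinEquiv (Sum.inr i))) = w i) :
    evalForm (pullback f x * pullback g y) u = evalForm x v * evalForm y w := by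
  refine exteriorPower_induction (p := fun x =>
    evalForm (pullback f x * pullback g y) u = evalForm x v * evalForm y w) hx (fun a => ?_)
    (fun x x' hx hx' => by rw [map_add, add_mul, evalForm_add, evalForm_add, hx, hx', add_mul])
    fun c x hx => by rw [map_smul, smul_mul_assoc, evalForm_smul, evalForm_smul, hx, mul_assoc]
  refine exteriorPower_induction (p := fun y =>
    evalForm (pullback f (ExteriorAlgebra.ιMulti ℝ k a) * pullback g y) u =
      evalForm (ExteriorAlgebra.ιMulti ℝ k a) v * evalForm y w) hy (fun b => ?_)
    (fun x x' hx hx' => by rw [map_add, mul_add, evalForm_add, evalForm_add, hx, hx', mul_add])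
    fun c x hx => by
      rw [map_smul, mul_smul_comm, evalForm_smul, evalForm_smul, hx, mul_left_comm]
  rw [pullback, pullback, ExteriorAlgebra.map_apply_ιMulti, ExteriorAlgebra.map_apply_ιMulti,
    ExteriorAlgebra.ιMulti_mul_ιMulti, evalForm_ιMulti, evalForm_ιMulti, evalForm_ιMulti,
    ← Matrix.det_fromBlocks_zero₂₁ _ (.of fun i j => b j (g (u (finSumFinEquiv (Sum.inl i))))),
    ← Matrix.det_submatrix_equiv_self finSumFinEquiv]
  congr 1
  ext i j
  simp only [finSumFinEquiv_apply_left, finSumFinEquiv_apply_right] at hfv hfw hgw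
  rcases i with i | i <;> rcases j with j | j <;> simp [hfv, hfw, hgw]

end EvalForm

/-! ### The density defined by `Γ` -/

section Density

variable {E : Type*} [NormedAddCommGroup E] [NormedSpace ℝ E] [FiniteDimensional ℝ E]
  {H : Type*} [TopologicalSpace H] {I : ModelWithCorners ℝ E H} {G : Type*} [TopologicalSpace G]
  [ChartedSpace H G] [Group G]
  {F : Type*} [NormedAddCommGroup F] [NormedSpace ℝ F] [FiniteDimensional ℝ F] {K : Type*}
  [TopologicalSpace K] {J : ModelWithCorners ℝ F K} {M : Type*} [TopologicalSpace M]
  [ChartedSpace K M]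

/-- The absolute value of the top degree part of `Γ` is a density. -/
theorem isDensity_twistedGamma {B : LinearMap.BilinForm ℝ (GroupLieAlgebra I G)}
    (hs : ∀ x y, B x y = B y x) (hp : ∀ x, x ≠ 0 → 0 < B x x)
    (hi : ∀ g x y, B (Ad I g x) (Ad I g y) = B x y) (X : Triple G J M) :
    IsDensity fun (m : M) (b : Fin (Module.finrank ℝ F) → F) =>
      evalForm (V := TangentSpace J m) (twistedGamma I B X m b) b := fun m => by
  have hl : IsLift B (someLift B (Ad I (X.moment m))) (Ad I (X.moment m)) :=
    isLift_someLift hs hp (Ad I (X.moment m)).toLinearMap (hi _)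
  let γ : Forms F := Gamma I B X m (someLift B (Ad I (X.moment m)) : (Cl B)ˣ)
  refine ⟨evalAlt (Module.finrank ℝ F) γ, fun v => ?_⟩
  have h := evalForm_twistedGamma hs hp X m (hi _) ⟨_, rfl, hl⟩ v
  rw [evalAlt_apply]
  exact h

variable [LieGroup I ∞ G]
  {F₁ : Type*} [NormedAddCommGroup F₁] [NormedSpace ℝ F₁] [FiniteDimensional ℝ F₁]
  {K₁ : Type*} [TopologicalSpace K₁] {J₁ : ModelWithCorners ℝ F₁ K₁}
  {M₁ : Type*} [TopologicalSpace M₁] [ChartedSpace K₁ M₁]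
  {F₂ : Type*} [NormedAddCommGroup F₂] [NormedSpace ℝ F₂] [FiniteDimensional ℝ F₂]
  {K₂ : Type*} [TopologicalSpace K₂] {J₂ : ModelWithCorners ℝ F₂ K₂}
  {M₂ : Type*} [TopologicalSpace M₂] [ChartedSpace K₂ M₂]

/-- The density of a direct product is the product of the densities. -/
theorem evalForm_twistedGamma_prod {B : LinearMap.BilinForm ℝ (GroupLieAlgebra I G)}
    (hB : IsInvariantInner I B) {X₁ : Triple G J₁ M₁} {X₂ : Triple G J₂ M₂} {m : M₁ × M₂}
    (h₁ : MDifferentiableAt J₁ I X₁.moment m.1) (h₂ : MDifferentiableAt J₂ I X₂.moment m.2)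
    (v₁ : Fin (Module.finrank ℝ F₁) → F₁) (v₂ : Fin (Module.finrank ℝ F₂) → F₂) :
    evalForm (V := TangentSpace (J₁.prod J₂) m)
      (twistedGamma (I.prod I) (squareForm I B) (X₁.prod X₂) m (prodFrame v₁ v₂))
      (prodFrame v₁ v₂) =
      evalForm (V := TangentSpace J₁ m.1) (twistedGamma I B X₁ m.1 v₁) v₁ *
        evalForm (V := TangentSpace J₂ m.2) (twistedGamma I B X₂ m.2 v₂) v₂ := by
  have hl : ∀ g : G, IsPinLift B (someLift B (Ad I g) : (Cl B)ˣ) (Ad I g) := fun g =>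
    ⟨_, rfl, isLift_someLift hB.symm hB.pos (Ad I g).toLinearMap (hB.invariant g)⟩
  have hsq := isPinLift_square hB.symm ((X₁.prod X₂).moment m) (hl _) (hl _)
  refine (evalForm_twistedGamma (squareForm_symm hB.symm) (squareForm_pos hB.pos) _ m
    (squareForm_invariant hB.invariant _) hsq _).trans (Eq.trans ?_
      (congrArg₂ (fun a b : ℝ => a * b)
      (evalForm_twistedGamma hB.symm hB.pos X₁ m.1 (hB.invariant _) (hl _) v₁)
      (evalForm_twistedGamma hB.symm hB.pos X₂ m.2 (hB.invariant _) (hl _) v₂)).symm)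
  refine Eq.trans ?_ (abs_mul _ _)
  refine congrArg abs ?_
  set x := Gamma I B X₁ m.1 (someLift B (Ad I (X₁.moment m.1)) : (Cl B)ˣ) with hx
  set y := Gamma I B X₂ m.2 (someLift B (Ad I (X₂.moment m.2)) : (Cl B)ˣ) with hy
  have hG := Gamma_prod (m := m) h₁ h₂ hB.symm
    (someLift B (Ad I (X₁.moment m.1)) : (Cl B)ˣ) (someLift B (Ad I (X₂.moment m.2)) : (Cl B)ˣ)
  have hu : ∀ i, (prodFrame v₁ v₂ (finCongr Module.finrank_prod.symm (finSumFinEquiv i)) :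
      F₁ × F₂) = Sum.elim (fun k => (v₁ k, 0)) (fun k => (0, v₂ k)) i := fun i =>
    congrArg (Sum.elim (fun k => (v₁ k, 0)) (fun k => (0, v₂ k)))
      ((prodIndex F₁ F₂).symm_apply_apply i)
  have hf : ∀ v : F₁ × F₂, mfderiv (J₁.prod J₂) J₁ Prod.fst m v = v.1 := fun v =>
    DFunLike.congr_fun (modelDeriv_fst (I := J₁) (I' := J₂) (p := m)) v
  have hg : ∀ v : F₁ × F₂, mfderiv (J₁.prod J₂) J₂ Prod.snd m v = v.2 := fun v =>
    DFunLike.congr_fun (modelDeriv_snd (I := J₁) (I' := J₂) (p := m)) v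
  have key := evalForm_pullback_mul (V := TangentSpace J₁ m.1) (V' := TangentSpace J₂ m.2)
    (V₀ := TangentSpace (J₁.prod J₂) m)
    (degreePart (Module.finrank ℝ F₁) x).2 (degreePart (Module.finrank ℝ F₂) y).2
    (v := v₁) (w := v₂) (mfderiv (J₁.prod J₂) J₁ Prod.fst m).toLinearMap
    (mfderiv (J₁.prod J₂) J₂ Prod.snd m).toLinearMap
    (u := fun i => prodFrame v₁ v₂ (finCongr Module.finrank_prod.symm i))
    (fun i => (hf _).trans (congrArg Prod.fst (hu (Sum.inl i))))
    (fun i => (hf _).trans (congrArg Prod.fst (hu (Sum.inr i))))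
    (fun i => (hg _).trans (congrArg Prod.snd (hu (Sum.inr i))))
  have hd := degreePart_pullback_mul (V₁ := TangentSpace J₁ m.1) (V₂ := TangentSpace J₂ m.2)
    (mfderiv (J₁.prod J₂) J₁ Prod.fst m).toLinearMap
    (mfderiv (J₁.prod J₂) J₂ Prod.snd m).toLinearMap x y
  replace key := key.trans (congrArg₂ (fun a b : ℝ => a * b)
    (evalForm_degreePart (V := TangentSpace J₁ m.1) x v₁)
    (evalForm_degreePart (V := TangentSpace J₂ m.2) y v₂))
  refine (congrArg (fun z => evalForm z (prodFrame v₁ v₂)) hG).trans ?_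
  refine (evalForm_cast Module.finrank_prod.symm _ _).trans (Eq.trans ?_ key)
  refine (evalForm_degreePart _ _).symm.trans ?_
  exact congrArg (fun z => evalForm z _) hd

end Density

/-! ### Measurable families of forms -/

section WeakMeasurableForms

namespace WeakMeasurable

variable {Y : Type*} [MeasurableSpace Y]

theorem mul {A : Type*} [Ring A] [Algebra ℝ A] [FiniteDimensional ℝ A] {f g : Y → A}
    (hf : WeakMeasurable f) (hg : WeakMeasurable g) : WeakMeasurable fun y => f y * g y :=
  hg.apply (L := fun y => LinearMap.mulLeft ℝ (f y)) fun v => hf.map (LinearMap.mulRight ℝ v)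

theorem expUpTo {A : Type*} [Ring A] [Algebra ℝ A] [FiniteDimensional ℝ A] {f : Y → A}
    (hf : WeakMeasurable f) (n : ℕ) : WeakMeasurable fun y => expUpTo n (f y) := by
  suffices h : ∀ k : ℕ, WeakMeasurable fun y => f y ^ k from
    sum _ fun k _ => smul measurable_const (h k)
  intro k
  induction k with
  | zero => simpa only [pow_zero] using const 1
  | succ k ih => simpa only [pow_succ] using ih.mul hf

theorem ofTwoForm {V : Type*} [AddCommGroup V] [Module ℝ V] [TopologicalSpace V]
    [FiniteDimensional ℝ V] {w : Y → V [⋀^Fin 2]→L[ℝ] ℝ}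
    (hw : ∀ u v, Measurable fun y => w y ![u, v]) : WeakMeasurable fun y => ofTwoForm (w y) :=
  smul measurable_const (sum _ fun _ _ => sum _ fun _ _ => smul (hw _ _) (const _))

/-- The algebra homomorphisms between exterior algebras extending a weakly measurable family of
linear maps, applied to a weakly measurable family. -/
theorem exteriorMap {W V : Type*} [AddCommGroup W] [Module ℝ W] [FiniteDimensional ℝ W]
    [AddCommGroup V] [Module ℝ V] [FiniteDimensional ℝ V] {r : Y → W →ₗ[ℝ] V}
    (hr : ∀ w, WeakMeasurable fun y => r y w) {x : Y → ExteriorAlgebra ℝ W}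
    (hx : WeakMeasurable x) : WeakMeasurable fun y => ExteriorAlgebra.map (r y) (x y) := by
  refine hx.apply (L := fun y => (ExteriorAlgebra.map (r y)).toLinearMap) fun v => ?_
  simp only [AlgHom.toLinearMap_apply]
  induction v using ExteriorAlgebra.induction with
  | algebraMap c => simpa only [AlgHom.commutes] using const _
  | ι w => simpa only [ExteriorAlgebra.map_apply_ι] using (hr w).map (ExteriorAlgebra.ι ℝ)
  | mul a b ha hb => simpa only [map_mul] using ha.mul hb
  | add a b ha hb => simpa only [map_add] using ha.add hb

theorem of_continuous {V : Type*} [TopologicalSpace Y] [OpensMeasurableSpace Y] [AddCommGroup V]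
    [Module ℝ V] [TopologicalSpace V] [IsTopologicalAddGroup V] [ContinuousSMul ℝ V] [T2Space V]
    [FiniteDimensional ℝ V] {f : Y → V} (hf : Continuous f) : WeakMeasurable f := fun l =>
  (l.continuous_of_finiteDimensional.comp hf).measurable

end WeakMeasurable

end WeakMeasurableForms

/-! ### Continuity of the adjoint action and of the Maurer-Cartan form -/

section Continuity

variable {E : Type*} [NormedAddCommGroup E] [NormedSpace ℝ E] {H : Type*} [TopologicalSpace H]
  {I : ModelWithCorners ℝ E H} {G : Type*} [TopologicalSpace G] [ChartedSpace H G]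
  {F : Type*} [NormedAddCommGroup F] [NormedSpace ℝ F] {K : Type*} [TopologicalSpace K]
  {J : ModelWithCorners ℝ F K} {M : Type*} [TopologicalSpace M] [ChartedSpace K M]
  {E₀ : Type*} [NormedAddCommGroup E₀] [NormedSpace ℝ E₀] {H₀ : Type*} [TopologicalSpace H₀]
  {I₀ : ModelWithCorners ℝ E₀ H₀} {N : Type*} [TopologicalSpace N] [ChartedSpace H₀ N]

/-- The differential at a point `p` of a smooth family of maps, all with the same value at `p`,
depends continuously on the parameter. -/
theorem continuousAt_modelDeriv [IsManifold J ∞ M] [IsManifold I ∞ G] [IsManifold I₀ ∞ N]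
    {f : N → M → G} {p : M} {q : G} {z₀ : N}
    (hf : ContMDiffAt (I₀.prod J) I ∞ (Function.uncurry f) (z₀, p)) (hq : ∀ z, f z p = q) :
    ContinuousAt (fun z => modelDeriv J I (f z) p) z₀ := by
  have : IsManifold J 1 M := .of_le (n := ∞) (by simp)
  have : IsManifold I 1 G := .of_le (n := ∞) (by simp)
  have : IsManifold I₀ 1 N := .of_le (n := ∞) (by simp)
  have h := (ContMDiffAt.mfderiv (m := 0) f (fun _ => p) hf contMDiffAt_const
    (by simp)).continuousAt
  refine h.congr (Filter.Eventually.of_forall fun z => ?_)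
  have hq' : (fun z => f z p) = fun _ => q := funext hq
  rw [hq']
  change inTangentCoordinates J I (fun _ => p) (fun _ => q) (fun z => modelDeriv J I (f z) p)
    z₀ z = _
  rw [inTangentCoordinates_eq (x₀ := z₀) (x := z) _ _ _ (mem_chart_source _ _)
    (mem_chart_source _ _)]
  ext v
  simp only [ContinuousLinearMap.comp_apply]
  rw [(tangentBundleCore J M).coordChange_self _ _ (mem_chart_source _ _),
    (tangentBundleCore I G).coordChange_self _ _ (mem_chart_source _ _)]

/-- The differential at `z` is the differential at `0` after a translation. -/
theorem modelDeriv_add_left {Ψ : F → G} {z : F} (hΨ : MDifferentiableAt 𝓘(ℝ, F) I Ψ z) :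
    modelDeriv 𝓘(ℝ, F) I (fun u => Ψ (z + u)) 0 = modelDeriv 𝓘(ℝ, F) I Ψ z := by
  have hd : DifferentiableAt ℝ (fun u : F => z + u) 0 := by fun_prop
  rw [modelDeriv_comp (add_zero z) hΨ hd.mdifferentiableAt]
  have : modelDeriv 𝓘(ℝ, F) 𝓘(ℝ, F) (fun u => z + u) 0 = ContinuousLinearMap.id ℝ F := by
    have h : fderiv ℝ (fun u : F => z + u) 0 = ContinuousLinearMap.id ℝ F := by
      rw [fderiv_const_add, fderiv_fun_id]
    exact mfderiv_eq_fderiv.trans h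
  rw [this, ContinuousLinearMap.comp_id]

variable [Group G] [LieGroup I ∞ G]

/-- The adjoint action depends continuously on the group element. -/
theorem continuousOn_Ad {Ψ : F → G} {T : Set F} (hT : IsOpen T)
    (hΨ : ContMDiffOn 𝓘(ℝ, F) I ∞ Ψ T) : ContinuousOn
      (fun z => modelDeriv I I (fun x => Ψ z * x * (Ψ z)⁻¹) 1) T := by
  intro z₀ hz₀
  refine (continuousAt_modelDeriv (I₀ := 𝓘(ℝ, F)) (J := I) (f := fun z x => Ψ z * x * (Ψ z)⁻¹)
    (p := 1) (q := 1) ?_ fun z => by simp).continuousWithinAt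
  have h : ContMDiffAt (𝓘(ℝ, F).prod I) I ∞ (fun y : F × G => Ψ y.1) (z₀, 1) :=
    ContMDiffAt.comp (z₀, (1 : G)) (hΨ.contMDiffAt (hT.mem_nhds hz₀)) contMDiffAt_fst
  exact (h.mul contMDiffAt_snd).mul h.inv

/-- The pull-back of the right Maurer-Cartan form to an open subset of a vector space is
continuous. -/
theorem continuousOn_thetaR {Ψ : F → G} {T : Set F} (hT : IsOpen T)
    (hΨ : ContMDiffOn 𝓘(ℝ, F) I ∞ Ψ T) :
    ContinuousOn (fun z => modelDeriv 𝓘(ℝ, F) I (fun y => Ψ y * (Ψ z)⁻¹) z) T := by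
  intro z₀ hz₀
  have hs : ∀ z ∈ T, MDifferentiableAt 𝓘(ℝ, F) I Ψ z := fun z hz =>
    (hΨ.contMDiffAt (hT.mem_nhds hz)).mdifferentiableAt (by simp)
  have h := (continuousAt_modelDeriv (I₀ := 𝓘(ℝ, F)) (J := 𝓘(ℝ, F)) (I := I)
    (f := fun z u => Ψ (z + u) * (Ψ z)⁻¹) (p := 0) (q := 1) (z₀ := z₀) ?_
      fun z => by simp).continuousWithinAt (s := T)
  · refine h.congr_of_mem (fun z hz => ?_) hz₀
    exact (modelDeriv_add_left (Ψ := fun y => Ψ y * (Ψ z)⁻¹)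
      (mdifferentiableAt_mul' (hs z hz) mdifferentiableAt_const)).symm
  · have h1 : ContMDiffAt (𝓘(ℝ, F).prod 𝓘(ℝ, F)) I ∞ (fun y : F × F => Ψ y.1) (z₀, 0) :=
      ContMDiffAt.comp (z₀, (0 : F)) (hΨ.contMDiffAt (hT.mem_nhds hz₀)) contMDiffAt_fst
    have h2 : ContMDiffAt (𝓘(ℝ, F).prod 𝓘(ℝ, F)) I ∞ (fun y : F × F => Ψ (y.1 + y.2)) (z₀, 0) := by
      have hz : ContMDiffAt 𝓘(ℝ, F) I ∞ Ψ (z₀ + 0) := by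
        rw [add_zero]; exact hΨ.contMDiffAt (hT.mem_nhds hz₀)
      have ha : ContMDiffAt (𝓘(ℝ, F).prod 𝓘(ℝ, F)) 𝓘(ℝ, F) ∞ (fun y : F × F => y.1 + y.2) (z₀, 0) :=
        contMDiffAt_fst.add contMDiffAt_snd
      exact ContMDiffAt.comp (z₀, (0 : F)) hz ha
    exact h2.mul h1.inv

end Continuity

/-! ### Measurability of the density in charts -/

section Measurable

open MeasureTheory

variable {E : Type*} [NormedAddCommGroup E] [NormedSpace ℝ E] [FiniteDimensional ℝ E]
  {H : Type*} [TopologicalSpace H] {I : ModelWithCorners ℝ E H} {G : Type*} [TopologicalSpace G]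
  [ChartedSpace H G] [Group G] [LieGroup I ∞ G]
  {F : Type*} [NormedAddCommGroup F] [NormedSpace ℝ F] [FiniteDimensional ℝ F]
  [MeasurableSpace F] [BorelSpace F] {K : Type*}
  [TopologicalSpace K] {J : ModelWithCorners ℝ F K} [J.Boundaryless] {M : Type*}
  [TopologicalSpace M] [ChartedSpace K M] [IsManifold J ∞ M]

/-- In a chart, the density defined by `Γ` is a measurable function. -/
theorem aemeasurable_twistedGamma {B : LinearMap.BilinForm ℝ (GroupLieAlgebra I G)}
    (hB : IsInvariantInner I B) {X : Triple G J M} (hΦ : ContMDiff J I ∞ X.moment)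
    (hω : IsSmoothForm J X.form) (b : Fin (Module.finrank ℝ F) → F) (x : M) (μ : Measure F) :
    AEMeasurable (fun z => evalForm (V := TangentSpace J ((extChartAt J x).symm z))
        (twistedGamma I B X ((extChartAt J x).symm z) (fun i => chartDeriv J x z (b i)))
        (fun i => chartDeriv J x z (b i))) (μ.restrict (extChartAt J x).target) := by
  set T := (extChartAt J x).target with hT
  have hTo : IsOpen T := isOpen_extChartAt_target x
  set c := (extChartAt J x).symm with hc
  set Ψ : F → G := fun z => X.moment (c z) with hΨ
  have hΨs : ContMDiffOn 𝓘(ℝ, F) I ∞ Ψ T := hΦ.comp_contMDiffOn (contMDiffOn_extChartAt_symm x)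
  have hA : ∀ w : GroupLieAlgebra I G, WeakMeasurable fun y : T => Ad I (Ψ y) w := fun w => by
    have h := (continuousOn_iff_continuous_domRestrict.mp (continuousOn_Ad hTo hΨs)).clm_apply
      (continuous_const (y := (show E from w)))
    exact WeakMeasurable.of_continuous (V := GroupLieAlgebra I G) h
  -- The value of the density is computed from a lift that depends measurably on the point.
  obtain ⟨s, hs, hsl⟩ := exists_weakMeasurable_lift (Y := T) hB.symm hB.pos
    (fun y => (Ad I (Ψ y)).toLinearMap) hA (fun y => hB.invariant _)
  let D : ∀ z : F, F →L[ℝ] TangentSpace J (c z) := fun z => mfderiv 𝓘(ℝ, F) J c z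
  let r : T → GroupLieAlgebra I G →ₗ[ℝ] Module.Dual ℝ F := fun y =>
    (D y).toLinearMap.dualMap ∘ₗ momentSubst I B X (c y)
  have hr : ∀ ξ, WeakMeasurable fun y => r y ξ := fun ξ => WeakMeasurable.of_dual fun u => by
    have h := (continuousOn_iff_continuous_domRestrict.mp (continuousOn_thetaR hTo hΨs)).clm_apply
      (continuous_const (y := u))
    have h1 := WeakMeasurable.of_continuous (V := GroupLieAlgebra I G) h
    have h2 := (h1 (B.flip ξ)).const_mul (1 / 2)
    refine (congrArg Measurable (funext fun y => ?_)).mpr h2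
    have hcy := mdifferentiableAt_extChartAt_symm (J := J) y.2
    have hΦy : MDifferentiableAt J I X.moment (c y) := hΦ.mdifferentiableAt (by simp)
    have h3 := modelDeriv_comp (I := 𝓘(ℝ, F)) (f := c) (x := y.1) rfl hΦy hcy
    have h4 := thetaR_comp Ψ y.1 (hΦy.comp y.1 hcy)
    have h5 : thetaR I (Ψ y) (X.dMoment I (c y) (D y u)) =
        modelDeriv 𝓘(ℝ, F) I (fun z => Ψ z * (Ψ y)⁻¹) y u :=
      (congrArg (thetaR I (Ψ y)) (DFunLike.congr_fun h3 u).symm).trans (DFunLike.congr_fun h4 u)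
    exact congrArg (fun v => (1 / 2) * B v ξ) h5
  have hw : ∀ u v, Measurable fun y : T => formInChart J X.form x y ![u, v] := fun u v => by
    have h := continuousOn_iff_continuous_domRestrict.mp (hω x).continuousOn
    exact ((continuous_eval_const (F := F [⋀^Fin 2]→L[ℝ] ℝ) (![u, v] : Fin 2 → F)).comp
      h).measurable
  -- The form `Γ` pulled back to the fixed vector space `F`.
  have hΓ : WeakMeasurable fun y : T => expUpTo (Module.finrank ℝ F)
      (ofTwoForm (formInChart J X.form x y)) * ExteriorAlgebra.map (r y) (symbol B (s y)) :=
    ((WeakMeasurable.ofTwoForm hw).expUpTo _).mul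
      (WeakMeasurable.exteriorMap hr (hs.map (symbol B).toLinearMap))
  refine aemeasurable_restrict_of_measurable_subtype hTo.measurableSet ?_
  refine (congrArg Measurable (funext fun y => ?_)).mpr (hΓ (evalLinear b)).abs
  refine (evalForm_twistedGamma hB.symm hB.pos X (c y) (hB.invariant _) (hsl y) _).trans ?_
  refine congrArg abs ((evalForm_pullback (D y).toLinearMap _ b).symm.trans ?_)
  refine congrArg (fun γ => evalForm γ b) ?_
  rw [Gamma_eq_expSubst, expSubst_apply, map_mul, map_expUpTo, ← ofTwoForm_comp]
  refine congrArg₂ (fun a b => a * b) rfl ?_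
  rw [pullback, ← AlgHom.comp_apply, ExteriorAlgebra.map_comp_map]

end Measurable

/-! ### Measures of fusion products -/

section FusionProduct

open MeasureTheory

variable {E : Type*} [NormedAddCommGroup E] [NormedSpace ℝ E] [FiniteDimensional ℝ E]
  {H : Type*} [TopologicalSpace H] {I : ModelWithCorners ℝ E H} {G : Type*} [TopologicalSpace G]
  [ChartedSpace H G] [Group G] [LieGroup I ∞ G]
  {F₁ : Type*} [NormedAddCommGroup F₁] [NormedSpace ℝ F₁] [FiniteDimensional ℝ F₁]
  {K₁ : Type*} [TopologicalSpace K₁] {J₁ : ModelWithCorners ℝ F₁ K₁} [J₁.Boundaryless]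
  {M₁ : Type*} [TopologicalSpace M₁] [ChartedSpace K₁ M₁] [IsManifold J₁ ∞ M₁]
  [SecondCountableTopology M₁] [MeasurableSpace M₁] [BorelSpace M₁]
  {F₂ : Type*} [NormedAddCommGroup F₂] [NormedSpace ℝ F₂] [FiniteDimensional ℝ F₂]
  {K₂ : Type*} [TopologicalSpace K₂] {J₂ : ModelWithCorners ℝ F₂ K₂} [J₂.Boundaryless]
  {M₂ : Type*} [TopologicalSpace M₂] [ChartedSpace K₂ M₂] [IsManifold J₂ ∞ M₂]
  [SecondCountableTopology M₂] [MeasurableSpace M₂] [BorelSpace M₂]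
  {B : LinearMap.BilinForm ℝ (GroupLieAlgebra I G)} {X₁ : Triple G J₁ M₁} {X₂ : Triple G J₂ M₂}

omit [LieGroup I ∞ G] in
/-- Liouville measures are s-finite, as required for product measures. -/
theorem sFinite_liouville (hB : IsInvariantInner I B) (X : Triple G J₁ M₁) :
    SFinite (liouville I B X) := by
  borelize F₁
  exact (densityMeasure_restrict (J := J₁)
    (isDensity_twistedGamma hB.symm hB.pos hB.invariant X)).2 fun x => sFinite_chartMeasure J₁ _ x

/-- The Liouville measure of a fusion product. -/
theorem liouville_fusion_prod (hB : IsInvariantInner I B) (h₁ : IsHamiltonian I B X₁)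
    (h₂ : IsHamiltonian I B X₂) : liouville I B ((X₁.prod X₂).fusion I B) =
      (liouville I B X₁).prod (liouville I B X₂) := by
  borelize F₁ F₂
  have hm₁ := fun m => h₁.momentAt hB.invariant m
  have hm₂ := fun m => h₂.momentAt hB.invariant m
  rw [liouville_fusion hB fun m => (hm₁ m.1).prod (hm₂ m.2)]
  exact densityMeasure_prod (isDensity_twistedGamma hB.symm hB.pos hB.invariant X₁)
    (isDensity_twistedGamma hB.symm hB.pos hB.invariant X₂)
    (isDensity_twistedGamma (squareForm_symm hB.symm) (squareForm_pos hB.pos)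
      (squareForm_invariant hB.invariant) (X₁.prod X₂))
    (fun m v₁ v₂ => evalForm_twistedGamma_prod hB (hm₁ m.1).mdiff_moment (hm₂ m.2).mdiff_moment
      v₁ v₂)
    (fun x => aemeasurable_twistedGamma hB h₁.smooth_moment h₁.smooth_form _ x _)
    (fun x => aemeasurable_twistedGamma hB h₂.smooth_moment h₂.smooth_form _ x _)

/-- The Duistermaat-Heckman measure of a fusion product. -/
theorem duistermaatHeckman_fusion_prod [I.Boundaryless] [CompactSpace G] [MeasurableSpace G]
    [BorelSpace G] (hB : IsInvariantInner I B) (h₁ : IsHamiltonian I B X₁)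
    (h₂ : IsHamiltonian I B X₂) : duistermaatHeckman I B ((X₁.prod X₂).fusion I B) =
      (duistermaatHeckman I B X₁).mconv (duistermaatHeckman I B X₂) := by
  have := secondCountable_of_compact_chartedSpace (I := I) (G := G)
  have := topologicalGroup_of_lieGroup I ∞ (G := G)
  have := sFinite_liouville hB X₁
  have := sFinite_liouville hB X₂
  have hm₁ := h₁.smooth_moment.continuous.measurable
  have hm₂ := h₂.smooth_moment.continuous.measurable
  rw [duistermaatHeckman, liouville_fusion_prod hB h₁ h₂, Measure.mconv, duistermaatHeckman,
    duistermaatHeckman, Measure.map_prod_map _ _ hm₁ hm₂,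
    Measure.map_map measurable_mul (hm₁.prodMap hm₂)]
  rfl

end FusionProduct

end GroupValued

end

open GroupValued MeasureTheory in
theorem mainTheorem2
    {E : Type*} [NormedAddCommGroup E] [NormedSpace ℝ E] [FiniteDimensional ℝ E]
    {H : Type*} [TopologicalSpace H] (I : ModelWithCorners ℝ E H) [I.Boundaryless]
    {G : Type*} [TopologicalSpace G] [ChartedSpace H G] [Group G] [LieGroup I ∞ G]
    [CompactSpace G] [T2Space G] [MeasurableSpace G] [BorelSpace G]
    (B : LinearMap.BilinForm ℝ (GroupLieAlgebra I G)) (hB : IsInvariantInner I B) :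
    (∀ {F : Type*} [NormedAddCommGroup F] [NormedSpace ℝ F] [FiniteDimensional ℝ F]
        {K : Type*} [TopologicalSpace K] (J : ModelWithCorners ℝ F K) [J.Boundaryless]
        {M : Type*} [TopologicalSpace M] [ChartedSpace K M] [IsManifold J ∞ M]
        [T2Space M] [SecondCountableTopology M] [MeasurableSpace M] [BorelSpace M]
        (X : Triple (G × G) J M), IsHamiltonian (I.prod I) (squareForm I B) X →
        -- the formula for a given lift `τ` of the adjoint action
        (∀ τ : G →* Pin B, LiftsAd I B τ →
          ∀ e : Module.Basis (Fin (Module.finrank ℝ E)) ℝ (GroupLieAlgebra I G),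
          (∀ i j, B (e i) (e j) = if i = j then 1 else 0) → ∀ m : M,
          Gamma I B (X.fusion I B) m (τ ((X.fusion I B).moment m) : (Cl B)ˣ) =
              expUpTo (Module.finrank ℝ F) (fusionOperator I X e m)
                (Gamma (I.prod I) (squareForm I B) X m (liftSquare I B τ (X.moment m))) ∧
            degreePart (Module.finrank ℝ F)
                (Gamma I B (X.fusion I B) m (τ ((X.fusion I B).moment m) : (Cl B)ˣ)) =
              degreePart (Module.finrank ℝ F)
                (Gamma (I.prod I) (squareForm I B) X m (liftSquare I B τ (X.moment m)))) ∧
        -- the formula in the general case, for forms with values in the orientation bundle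
        (∀ e : Module.Basis (Fin (Module.finrank ℝ E)) ℝ (GroupLieAlgebra I G),
          (∀ i j, B (e i) (e j) = if i = j then 1 else 0) →
          ∀ (m : M) (b : Module.Basis (Fin (Module.finrank ℝ F)) ℝ (TangentSpace J m)),
          twistedGamma I B (X.fusion I B) m b =
              expUpTo (Module.finrank ℝ F) (fusionOperator I X e m)
                (twistedGamma (I.prod I) (squareForm I B) X m b) ∧
            degreePart (Module.finrank ℝ F) (twistedGamma I B (X.fusion I B) m b) =
              degreePart (Module.finrank ℝ F)
                (twistedGamma (I.prod I) (squareForm I B) X m b)) ∧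
        -- the Liouville measure of the fusion
        liouville I B (X.fusion I B) = liouville (I.prod I) (squareForm I B) X ∧
        duistermaatHeckman I B (X.fusion I B) =
          (duistermaatHeckman (I.prod I) (squareForm I B) X).map fun g => g.1 * g.2) ∧
    (∀ {F₁ : Type*} [NormedAddCommGroup F₁] [NormedSpace ℝ F₁] [FiniteDimensional ℝ F₁]
        {K₁ : Type*} [TopologicalSpace K₁] (J₁ : ModelWithCorners ℝ F₁ K₁) [J₁.Boundaryless]
        {M₁ : Type*} [TopologicalSpace M₁] [ChartedSpace K₁ M₁] [IsManifold J₁ ∞ M₁]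
        [T2Space M₁] [SecondCountableTopology M₁] [MeasurableSpace M₁] [BorelSpace M₁]
        {F₂ : Type*} [NormedAddCommGroup F₂] [NormedSpace ℝ F₂] [FiniteDimensional ℝ F₂]
        {K₂ : Type*} [TopologicalSpace K₂] (J₂ : ModelWithCorners ℝ F₂ K₂) [J₂.Boundaryless]
        {M₂ : Type*} [TopologicalSpace M₂] [ChartedSpace K₂ M₂] [IsManifold J₂ ∞ M₂]
        [T2Space M₂] [SecondCountableTopology M₂] [MeasurableSpace M₂] [BorelSpace M₂]
        (X₁ : Triple G J₁ M₁) (X₂ : Triple G J₂ M₂),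
        IsHamiltonian I B X₁ → IsHamiltonian I B X₂ →
        -- the volume form of the fusion product, for a given lift `τ` of the adjoint action
        (∀ τ : G →* Pin B, LiftsAd I B τ → ∀ m : M₁ × M₂,
          (degreePart (Module.finrank ℝ (F₁ × F₂)) (Gamma I B ((X₁.prod X₂).fusion I B) m
              (τ (((X₁.prod X₂).fusion I B).moment m) : (Cl B)ˣ)) :
                Forms (TangentSpace (J₁.prod J₂) m)) =
            pullback (mfderiv (J₁.prod J₂) J₁ Prod.fst m).toLinearMap
                (degreePart (Module.finrank ℝ F₁)
                  (Gamma I B X₁ m.1 (τ (X₁.moment m.1) : (Cl B)ˣ)) : Forms (TangentSpace J₁ m.1)) *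
              pullback (mfderiv (J₁.prod J₂) J₂ Prod.snd m).toLinearMap
                (degreePart (Module.finrank ℝ F₂)
                  (Gamma I B X₂ m.2 (τ (X₂.moment m.2) : (Cl B)ˣ)) :
                    Forms (TangentSpace J₂ m.2))) ∧
        -- the Liouville measure and the Duistermaat-Heckman measure of the fusion product
        liouville I B ((X₁.prod X₂).fusion I B) =
            (liouville I B X₁).prod (liouville I B X₂) ∧
          duistermaatHeckman I B ((X₁.prod X₂).fusion I B) =
            (duistermaatHeckman I B X₁).mconv (duistermaatHeckman I B X₂)) := by
  refine ⟨?_, ?_⟩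
  · intro F _ _ _ K _ J _ M _ _ _ _ _ _ _ X hX
    have hXm := fun m => hX.momentAt (squareForm_invariant hB.invariant) m
    refine ⟨fun τ hτ e he m => ?_, fun e he m b =>
      ⟨twistedGamma_fusion hB e he (hXm m) b, degreePart_twistedGamma_fusion hB (hXm m) b⟩,
      liouville_fusion hB hXm, duistermaatHeckman_fusion hB hX.smooth_moment.continuous hXm⟩
    have key := Gamma_fusion hB.symm hB.invariant e he (hXm m) (τ (X.moment m).1)
      (τ (X.moment m).2) (hτ _) (hτ _)
    rw [← map_mul] at key
    refine ⟨key, (congrArg (degreePart _) key).trans (degreePart_fusionOperator e m _)⟩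
  · intro F₁ _ _ _ K₁ _ J₁ _ M₁ _ _ _ _ _ _ _ F₂ _ _ _ K₂ _ J₂ _ M₂ _ _ _ _ _ _ _ X₁ X₂ h₁ h₂
    refine ⟨fun τ hτ m => ?_, liouville_fusion_prod hB h₁ h₂,
      duistermaatHeckman_fusion_prod hB h₁ h₂⟩
    have key := degreePart_Gamma_fusion_prod hB (h₁.momentAt hB.invariant m.1)
      (h₂.momentAt hB.invariant m.2) (τ (X₁.moment m.1)) (τ (X₂.moment m.2)) (hτ _) (hτ _)
    rw [← map_mul] at key
    exact key
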